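/- Let $k$ be a field, let $n,r\ge 0$ be integers, and let $G$ be the Grassmannian over $k$ of quotients of $\Gamma(\mathbb{P}^n_k,\mathcal{O}(1))\cong k^{n+1}$ that are locally free of rank $n+1-r$; a point $L$ of $G$ is identified with the corresponding linear subspace of codimension $r$ in $\mathbb{P}^n$ ($G$ is empty if $r>n+1$). Let $f:X\to\mathbb{P}^n_k$ be an unramified morphism of finite type, and let $$\mathcal{H}_X=\{(x,L)\in X\times_k G : f(x)\in L\}\subset X\times_k G$$ be the incidence scheme, that is, the closed subscheme of $X\times_kG$ obtained by pulling back along $f\times\mathrm{id}$ the projective bundle of the tautological quotient, viewed as a closed subscheme of $\mathbb{P}^n_k\times_k G$. Let $I$ be its ideal sheaf. Let $m:\mathcal{X}\to X$ be a morphism of finite type with $\dim\mathcal{X}\le d$, let $\mathcal{E}$ be a vector bundle of rank $d$ on $\mathcal{X}$, and let $\pi:m^*\Omega^1_{X/k}\to\mathcal{E}$ be a surjective map of $\mathcal{O}_{\mathcal{X}}$-modules. Put $\mathcal{H}_{\mathcal{X}}=\mathcal{H}_X\times_X\mathcal{X}$. Then the canonical map $\mathrm{pr}_X^*\Omega^1_{X/k}\to\Omega^1_{X\times_kG/G}$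 is an isomorphism. Using it to identify the restriction of $\Omega^1_{X\times_kG/G}$ to $\mathcal{H}_X$ with $\Omega^1_{X/k}\otimes_{\mathcal{O}_X}\mathcal{O}_{\mathcal{H}_X}$, let $$\phi: I/I^2\otimes_{\mathcal{O}_X}\mathcal{O}_{\mathcal{X}}\to\mathcal{E}\otimes_{\mathcal{O}_X}\mathcal{O}_{\mathcal{H}_X}$$ be the map of sheaves of modules on $\mathcal{H}_{\mathcal{X}}$ obtained by pulling back to $\mathcal{H}_{\mathcal{X}}$ the natural map $I/I^2\to\Omega^1_{X/k}\otimes_{\mathcal{O}_X}\mathcal{O}_{\mathcal{H}_X}$ (sending the class of $s$ to $ds$) and composing it with the pullback of $\pi$. There is a dense open $U\subset G$ such that the restriction of $\mathrm{coker}(\phi)$ to $\mathcal{H}_{\mathcal{X}}\times_G U$ is a vector bundle of rank $d-r$ (in particular, if $r>d$, then $\mathcal{H}_{\mathcal{X}}\times_G U$ is empty). -/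

import Mathlib

open CategoryTheory CategoryTheory.Limits AlgebraicGeometry

universe u

namespace Bertini

noncomputable section

/-! ### Grassmannian -/

section Grassmannian

variable (k : Type u) [Field k] (N r : ℕ)

/-- The coordinate ring of the chart `U_I ≅ 𝔸^{r(N-r)}` of the Grassmannian: one free variable for
each entry of an `r × N` matrix outside the columns indexed by `I`. -/
abbrev ChartRing (I : Fin r ↪ Fin N) : Type u :=
  MvPolynomial (Fin r × {j : Fin N // j ∉ Set.range I}) k

open Classical in
/-- The universal `r × N` matrix over `U_I` whose `I`-block is the identity. Its rows `l₁, …, l_r`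
span the kernel of the universal quotient of `𝒪^N` over `U_I`. -/
def chartMatrix (I : Fin r ↪ Fin N) : Matrix (Fin r) (Fin N) (ChartRing k N r I) :=
  fun a j => if h : j ∈ Set.range I then (if I a = j then 1 else 0)
    else MvPolynomial.X (a, ⟨j, h⟩)

variable {N r}

lemma chartMatrix_submatrix (I : Fin r ↪ Fin N) :
    (chartMatrix k N r I).submatrix id I = 1 := by
  ext a b
  simp [chartMatrix, Matrix.one_apply]

variable {k} in
/-- The algebra homomorphism out of the coordinate ring of a chart determined by a matrix. -/
def chartLift {I : Fin r ↪ Fin N} {A : Type*} [CommRing A] [Algebra k A]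
    (M : Matrix (Fin r) (Fin N) A) : ChartRing k N r I →ₐ[k] A :=
  MvPolynomial.aeval fun p => M p.1 p.2

variable {k} in
lemma chartMatrix_map_chartLift {I : Fin r ↪ Fin N} {A : Type*} [CommRing A] [Algebra k A]
    (M : Matrix (Fin r) (Fin N) A) (hM : M.submatrix id I = 1) :
    (chartMatrix k N r I).map (chartLift (k := k) (I := I) M) = M := by
  ext a j
  by_cases h : j ∈ Set.range I
  · obtain ⟨b, rfl⟩ := h
    have := congr_fun (congr_fun hM a) b
    simp only [Matrix.submatrix_apply, id] at this
    simp only [Matrix.map_apply, chartMatrix, Set.mem_range_self, dif_pos, this,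
      EmbeddingLike.apply_eq_iff_eq, Matrix.one_apply, eq_comm (a := a)]
    split_ifs <;> simp
  · simp only [Matrix.map_apply, chartMatrix, dif_neg h, chartLift, MvPolynomial.aeval_X]

variable {k} in
lemma chart_algHom_ext {I : Fin r ↪ Fin N} {A : Type*} [CommRing A] [Algebra k A]
    {φ ψ : ChartRing k N r I →ₐ[k] A}
    (h : (chartMatrix k N r I).map φ = (chartMatrix k N r I).map ψ) : φ = ψ := by
  apply MvPolynomial.algHom_ext
  rintro ⟨a, j, hj⟩
  have := congr_fun (congr_fun h a) j
  simpa [chartMatrix, hj] using this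

/-- The `J`-minor of the universal matrix over `U_I`; its non-vanishing locus is `U_I ∩ U_J`. -/
def chartMinor (I J : Fin r ↪ Fin N) : ChartRing k N r I :=
  ((chartMatrix k N r I).submatrix id J).det

/-- The coordinate ring of `U_I ∩ U_J`, seen inside `U_I`. -/
abbrev OverlapRing (I J : Fin r ↪ Fin N) : Type u :=
  Localization.Away (chartMinor k I J)

/-- The universal matrix of the chart `I`, restricted to `U_I ∩ U_J`. -/
def overlapMatrix (I J : Fin r ↪ Fin N) : Matrix (Fin r) (Fin N) (OverlapRing k I J) :=
  (chartMatrix k N r I).map (algebraMap _ _)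

/-- The universal matrix of the chart `I`, renormalised so that its `J`-block is the identity. -/
def normalisedMatrix (I J : Fin r ↪ Fin N) : Matrix (Fin r) (Fin N) (OverlapRing k I J) :=
  ((overlapMatrix k I J).submatrix id J)⁻¹ * overlapMatrix k I J

lemma isUnit_det_overlapMatrix (I J : Fin r ↪ Fin N) :
    IsUnit ((overlapMatrix k I J).submatrix id J).det := by
  have : ((overlapMatrix k I J).submatrix id J).det =
      algebraMap (ChartRing k N r I) (OverlapRing k I J) (chartMinor k I J) := by
    exact (RingHom.map_det (algebraMap (ChartRing k N r I) (OverlapRing k I J)) _).symm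
  rw [this]
  exact IsLocalization.Away.algebraMap_isUnit _

lemma submatrix_id_mul {A : Type*} [CommRing A] (P : Matrix (Fin r) (Fin r) A)
    (M : Matrix (Fin r) (Fin N) A) (J : Fin r → Fin N) :
    (P * M).submatrix id J = P * M.submatrix id J := rfl

lemma normalisedMatrix_submatrix (I J : Fin r ↪ Fin N) :
    (normalisedMatrix k I J).submatrix id J = 1 := by
  rw [normalisedMatrix, submatrix_id_mul, Matrix.nonsing_inv_mul _ (isUnit_det_overlapMatrix k I J)]

lemma overlapMatrix_submatrix (I J : Fin r ↪ Fin N) :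
    (overlapMatrix k I J).submatrix id I = 1 := by
  have := congr_arg (fun M => M.map (algebraMap _ (OverlapRing k I J)))
    (chartMatrix_submatrix k I)
  simpa [overlapMatrix, Matrix.submatrix_map] using this

/-- The map `k[U_J] → k[U_I ∩ U_J]` under which the universal matrix `M_J` of the chart `J` becomes
`((M_I)_J)⁻¹ * M_I`. -/
def transitionAlgHom (I J : Fin r ↪ Fin N) : ChartRing k N r J →ₐ[k] OverlapRing k I J :=
  chartLift (normalisedMatrix k I J)

lemma chartMatrix_map_transitionAlgHom (I J : Fin r ↪ Fin N) :
    (chartMatrix k N r J).map (transitionAlgHom k I J) = normalisedMatrix k I J :=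
  chartMatrix_map_chartLift _ (normalisedMatrix_submatrix k I J)

lemma isUnit_transitionAlgHom_chartMinor (I J : Fin r ↪ Fin N) :
    IsUnit (transitionAlgHom k I J (chartMinor k J I)) := by
  have : transitionAlgHom k I J (chartMinor k J I) =
      ((normalisedMatrix k I J).submatrix id I).det := by
    rw [← chartMatrix_map_transitionAlgHom]
    exact AlgHom.map_det _ _
  rw [this, normalisedMatrix, submatrix_id_mul, overlapMatrix_submatrix, mul_one]
  exact Matrix.isUnit_nonsing_inv_det _ (isUnit_det_overlapMatrix k I J)

/-- The gluing map on coordinate rings of overlaps. -/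
def transition (I J : Fin r ↪ Fin N) : OverlapRing k J I →ₐ[k] OverlapRing k I J :=
  IsLocalization.liftAlgHom (M := Submonoid.powers (chartMinor k J I))
    (f := transitionAlgHom k I J) (by
      rintro ⟨_, n, rfl⟩
      simpa using (isUnit_transitionAlgHom_chartMinor k I J).pow n)

@[simp]
lemma transition_algebraMap (I J : Fin r ↪ Fin N) (x : ChartRing k N r J) :
    transition k I J (algebraMap _ _ x) = transitionAlgHom k I J x := by
  simp [transition]

lemma overlapMatrix_map_transition (I J : Fin r ↪ Fin N) :
    (overlapMatrix k J I).map (transition k I J) = normalisedMatrix k I J := by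
  rw [← chartMatrix_map_transitionAlgHom]
  ext a j
  simp [overlapMatrix]

lemma overlap_algHom_ext {I J : Fin r ↪ Fin N} {A : Type*} [CommRing A] [Algebra k A]
    {φ ψ : OverlapRing k I J →ₐ[k] A}
    (h : (overlapMatrix k I J).map φ = (overlapMatrix k I J).map ψ) : φ = ψ := by
  apply IsLocalization.algHom_ext (Submonoid.powers (chartMinor k I J))
  apply chart_algHom_ext
  ext a j
  exact congr_fun (congr_fun h a) j

lemma transition_self (I : Fin r ↪ Fin N) : transition k I I = AlgHom.id k _ := by
  apply overlap_algHom_ext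
  rw [overlapMatrix_map_transition, normalisedMatrix, overlapMatrix_submatrix]
  ext; simp


/-- Renormalising three times around a cycle gives back the original matrix. -/
lemma normalise_eq {A : Type*} [CommRing A] {I : Fin r ↪ Fin N}
    {M₀ M₁ M₂ M₃ : Matrix (Fin r) (Fin N) A}
    (h₀ : M₀.submatrix id I = 1) (h₃ : M₃.submatrix id I = 1)
    {P₁ P₂ P₃ : Matrix (Fin r) (Fin r) A}
    (h₁ : M₁ = P₁ * M₀) (h₂ : M₂ = P₂ * M₁) (h₄ : M₃ = P₃ * M₂) : M₃ = M₀ := by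
  have e : M₃ = (P₃ * P₂ * P₁) * M₀ := by rw [h₄, h₂, h₁]; simp only [Matrix.mul_assoc]
  have : (P₃ * P₂ * P₁) = 1 := by
    rw [e, submatrix_id_mul, h₀, mul_one] at h₃
    exact h₃
  rw [e, this]; exact Matrix.one_mul _

/-- The chart `U_I`. -/
abbrev chart (I : Fin r ↪ Fin N) : Scheme.{u} := Spec (.of (ChartRing k N r I))

/-- The open subscheme `U_I ∩ U_J` of `U_I`. -/
abbrev overlap (I J : Fin r ↪ Fin N) : Scheme.{u} := Spec (.of (OverlapRing k I J))

/-- The inclusion `U_I ∩ U_J ⟶ U_I`. -/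
def overlapι (I J : Fin r ↪ Fin N) : overlap k I J ⟶ chart k I :=
  Spec.map (CommRingCat.ofHom (algebraMap (ChartRing k N r I) (OverlapRing k I J)))

/-- The transition isomorphism, from `U_I ∩ U_J` inside `U_I` to `U_I ∩ U_J` inside `U_J`. -/
def overlapTransition (I J : Fin r ↪ Fin N) : overlap k I J ⟶ overlap k J I :=
  Spec.map (CommRingCat.ofHom (transition k I J).toRingHom)

/-- The structure morphism of `U_I`. -/
def chartStr (I : Fin r ↪ Fin N) : chart k I ⟶ Spec (.of k) :=
  Spec.map (CommRingCat.ofHom (algebraMap k (ChartRing k N r I)))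

instance (I J : Fin r ↪ Fin N) : IsOpenImmersion (overlapι k I J) :=
  inferInstanceAs (IsOpenImmersion
    (Spec.map (CommRingCat.ofHom (algebraMap (ChartRing k N r I) (OverlapRing k I J)))))

instance (I : Fin r ↪ Fin N) : IsIso (overlapι k I I) := by
  have h1 : chartMinor k I I = 1 := by
    simp only [chartMinor, chartMatrix_submatrix, Matrix.det_one]
  have : Function.Bijective (algebraMap (ChartRing k N r I) (OverlapRing k I I)) :=
    (IsLocalization.atUnit (ChartRing k N r I) (OverlapRing k I I) (chartMinor k I I)
      (by rw [h1]; exact isUnit_one)).bijective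
  have : IsIso (CommRingCat.ofHom (algebraMap (ChartRing k N r I) (OverlapRing k I I))) :=
    (ConcreteCategory.isIso_iff_bijective _).mpr this
  exact inferInstanceAs (IsIso (Spec.map _))

lemma overlapTransition_str (I J : Fin r ↪ Fin N) :
    overlapTransition k I J ≫ overlapι k J I ≫ chartStr k J = overlapι k I J ≫ chartStr k I := by
  refine (Spec.map_comp_assoc _ _ _).symm.trans ?_
  refine (Spec.map_comp _ _).symm.trans (.trans ?_ (Spec.map_comp _ _))
  congr 1
  ext x
  change transition k I J (algebraMap _ _ (algebraMap k _ x)) = _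
  rw [transition_algebraMap]
  exact (transitionAlgHom k I J).commutes x

variable {k}

/-- The ring map corresponding to a morphism to `U_I`. -/
def chartRingHom {S : Scheme.{u}} {I : Fin r ↪ Fin N} (h : S ⟶ chart k I) :
    ChartRing k N r I →+* Γ(S, ⊤) :=
  ((Scheme.ΓSpecIso (.of (ChartRing k N r I))).inv ≫ h.appTop).hom

/-- The matrix over `Γ(S, ⊤)` corresponding to a morphism `S ⟶ U_I`. -/
def pointMatrix {S : Scheme.{u}} {I : Fin r ↪ Fin N} (h : S ⟶ chart k I) :
    Matrix (Fin r) (Fin N) Γ(S, ⊤) :=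
  (chartMatrix k N r I).map (chartRingHom h)

lemma chartRingHom_comp {S S' : Scheme.{u}} {I : Fin r ↪ Fin N} (g : S' ⟶ S)
    (h : S ⟶ chart k I) : chartRingHom (g ≫ h) = g.appTop.hom.comp (chartRingHom h) := rfl

lemma chartRingHom_specMap {I : Fin r ↪ Fin N} {A : CommRingCat.{u}}
    (φ : CommRingCat.of (ChartRing k N r I) ⟶ A) :
    chartRingHom (Spec.map φ : Spec A ⟶ chart k I) = (φ ≫ (Scheme.ΓSpecIso A).inv).hom := by
  exact congr_arg CommRingCat.Hom.hom (Scheme.ΓSpecIso_inv_naturality φ).symm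

lemma pointMatrix_submatrix {S : Scheme.{u}} {I : Fin r ↪ Fin N} (h : S ⟶ chart k I) :
    (pointMatrix h).submatrix id I = 1 := by
  have := congr_arg (fun M => M.map (chartRingHom h)) (chartMatrix_submatrix k I)
  simpa [pointMatrix, Matrix.submatrix_map] using this

lemma chart_hom_ext {S : Scheme.{u}} {I : Fin r ↪ Fin N} {h h' : S ⟶ chart k I}
    (hs : h ≫ chartStr k I = h' ≫ chartStr k I) (hm : pointMatrix h = pointMatrix h') :
    h = h' := by
  have key : chartRingHom h = chartRingHom h' := by
    apply MvPolynomial.ringHom_ext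
    · intro x
      have e : ∀ g : S ⟶ chart k I, chartRingHom g (MvPolynomial.C x) =
          ((Scheme.ΓSpecIso (.of k)).inv ≫ (g ≫ chartStr k I).appTop).hom x := by
        intro g
        have := congr_arg (fun φ => φ.hom x) (Scheme.ΓSpecIso_inv_naturality
          (CommRingCat.ofHom (algebraMap k (ChartRing k N r I))))
        exact congr_arg g.appTop.hom this
      rw [e, e, hs]
    · rintro ⟨a, j, hj⟩
      have := congr_fun (congr_fun hm a) j
      simpa [pointMatrix, chartMatrix, hj] using this
  have : IsAffine (chart k I) := inferInstanceAs (IsAffine (Spec _))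
  apply ext_of_isAffine
  have := congr_arg CommRingCat.ofHom key
  simp only [chartRingHom, CommRingCat.ofHom_hom] at this
  exact (cancel_epi _).mp this

lemma pointMatrix_transition {S : Scheme.{u}} {I J : Fin r ↪ Fin N} (g : S ⟶ overlap k I J) :
    pointMatrix (g ≫ overlapTransition k I J ≫ overlapι k J I) =
      ((pointMatrix (g ≫ overlapι k I J)).submatrix id J)⁻¹ * pointMatrix (g ≫ overlapι k I J) := by
  let ρ : OverlapRing k I J →+* Γ(S, ⊤) := ((Scheme.ΓSpecIso (.of (OverlapRing k I J))).inv ≫ g.appTop).hom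
  have h1 : pointMatrix (g ≫ overlapι k I J) = (overlapMatrix k I J).map ρ := by
    rw [pointMatrix, chartRingHom_comp, overlapι, chartRingHom_specMap]; rfl
  have h2 : pointMatrix (g ≫ overlapTransition k I J ≫ overlapι k J I) =
      (normalisedMatrix k I J).map ρ := by
    rw [← chartMatrix_map_transitionAlgHom, pointMatrix, chartRingHom_comp, overlapι,
      overlapTransition, ← Spec.map_comp, chartRingHom_specMap]
    ext a j
    simp only [Matrix.map_apply]
    change ρ (transition k I J (algebraMap _ _ _)) = _
    rw [transition_algebraMap]
  let P : Matrix (Fin r) (Fin r) Γ(S, ⊤) := (((overlapMatrix k I J).submatrix id J)⁻¹).map ρ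
  have h3 : (normalisedMatrix k I J).map ρ = P * pointMatrix (g ≫ overlapι k I J) := by
    rw [h1, normalisedMatrix, Matrix.map_mul]
  have h4 : P * (pointMatrix (g ≫ overlapι k I J)).submatrix id J = 1 := by
    rw [← submatrix_id_mul, ← h3, Matrix.submatrix_map, normalisedMatrix_submatrix]
    simp
  rw [h2, h3, Matrix.inv_eq_left_inv h4]

lemma isUnit_det_pointMatrix {S : Scheme.{u}} {I J : Fin r ↪ Fin N} (g : S ⟶ overlap k I J) :
    IsUnit ((pointMatrix (g ≫ overlapι k I J)).submatrix id J).det := by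
  let ρ : OverlapRing k I J →+* Γ(S, ⊤) := ((Scheme.ΓSpecIso (.of (OverlapRing k I J))).inv ≫ g.appTop).hom
  have h1 : pointMatrix (g ≫ overlapι k I J) = (overlapMatrix k I J).map ρ := by
    rw [pointMatrix, chartRingHom_comp, overlapι, chartRingHom_specMap]; rfl
  have := (isUnit_det_overlapMatrix k I J).map ρ
  rw [h1, Matrix.submatrix_map]
  rwa [RingHom.map_det] at this

/-- A morphism to `U_I` along which the `J`-minor becomes invertible lifts to `U_I ∩ U_J`. -/
def overlapLift {S : Scheme.{u}} {I J : Fin r ↪ Fin N} (h : S ⟶ chart k I)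
    (hu : IsUnit ((pointMatrix h).submatrix id J).det) : S ⟶ overlap k I J :=
  S.toSpecΓ ≫ Spec.map (CommRingCat.ofHom
    (IsLocalization.Away.lift (chartMinor k I J) (g := chartRingHom h) (by
      convert hu
      exact RingHom.map_det (chartRingHom h) _)))

lemma overlapLift_ι {S : Scheme.{u}} {I J : Fin r ↪ Fin N} (h : S ⟶ chart k I)
    (hu : IsUnit ((pointMatrix h).submatrix id J).det) :
    overlapLift h hu ≫ overlapι k I J = h := by
  rw [overlapLift, overlapι, Category.assoc]
  rw [← Spec.map_comp]
  rw [← CommRingCat.ofHom_comp, IsLocalization.Away.lift_comp]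
  change S.toSpecΓ ≫ Spec.map (_ ≫ h.appTop) = h
  rw [Spec.map_comp, ← Scheme.toSpecΓ_naturality_assoc]
  exact (congr_arg (h ≫ ·) (toSpecΓ_SpecMap_ΓSpecIso_inv _)).trans (Category.comp_id h)


/-- The inclusion of a triple overlap. -/
def tripleι (I J K : Fin r ↪ Fin N) :
    pullback (overlapι k I J) (overlapι k I K) ⟶ chart k I :=
  pullback.fst _ _ ≫ overlapι k I J

instance (I J K : Fin r ↪ Fin N) : Mono (tripleι (k := k) I J K) := by
  unfold tripleι; infer_instance

lemma tripleι_eq (I J K : Fin r ↪ Fin N) :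
    tripleι (k := k) I J K = pullback.snd _ _ ≫ overlapι k I K := pullback.condition

lemma tripleTransition_isUnit (I J K : Fin r ↪ Fin N) :
    IsUnit ((pointMatrix (pullback.fst (overlapι k I J) (overlapι k I K) ≫
      overlapTransition k I J ≫ overlapι k J I)).submatrix id K).det := by
  rw [pointMatrix_transition, submatrix_id_mul, Matrix.det_mul]
  refine (Matrix.isUnit_nonsing_inv_det _ (isUnit_det_pointMatrix _)).mul ?_
  rw [pullback.condition]
  exact isUnit_det_pointMatrix _

/-- The transition map on triple overlaps. -/
def tripleTransition (I J K : Fin r ↪ Fin N) :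
    pullback (overlapι k I J) (overlapι k I K) ⟶ pullback (overlapι k J K) (overlapι k J I) :=
  pullback.lift (overlapLift _ (tripleTransition_isUnit I J K))
    (pullback.fst _ _ ≫ overlapTransition k I J)
    (by rw [overlapLift_ι, Category.assoc])

lemma tripleTransition_ι (I J K : Fin r ↪ Fin N) :
    tripleTransition (k := k) I J K ≫ tripleι J K I =
      pullback.fst _ _ ≫ overlapTransition k I J ≫ overlapι k J I := by
  rw [tripleι_eq, tripleTransition, pullback.lift_snd_assoc, Category.assoc]

lemma tripleTransition_str (I J K : Fin r ↪ Fin N) :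
    tripleTransition (k := k) I J K ≫ tripleι J K I ≫ chartStr k J =
      tripleι I J K ≫ chartStr k I := by
  rw [← Category.assoc, tripleTransition_ι, Category.assoc, Category.assoc,
    overlapTransition_str, tripleι, Category.assoc]

lemma tripleTransition_matrix {S : Scheme.{u}} (I J K : Fin r ↪ Fin N)
    (g : S ⟶ pullback (overlapι k I J) (overlapι k I K)) :
    pointMatrix (g ≫ tripleTransition I J K ≫ tripleι J K I) =
      ((pointMatrix (g ≫ tripleι I J K)).submatrix id J)⁻¹ * pointMatrix (g ≫ tripleι I J K) := by
  rw [tripleTransition_ι, ← Category.assoc, pointMatrix_transition, Category.assoc, tripleι]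

lemma triple_cocycle (I J K : Fin r ↪ Fin N) :
    tripleTransition (k := k) I J K ≫ tripleTransition J K I ≫ tripleTransition K I J = 𝟙 _ := by
  rw [← cancel_mono (tripleι I J K)]
  apply chart_hom_ext
  · simp only [Category.assoc, tripleTransition_str, Category.id_comp]
  · have e₁ := (congr_arg pointMatrix (Category.id_comp
      (tripleTransition (k := k) I J K ≫ tripleι J K I))).symm.trans
      (tripleTransition_matrix I J K (𝟙 _))
    have e₂ := tripleTransition_matrix J K I (tripleTransition (k := k) I J K)
    have e₃ := tripleTransition_matrix K I J
      (tripleTransition (k := k) I J K ≫ tripleTransition J K I)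
    simp only [Category.assoc] at e₃
    simpa only [Category.assoc] using normalise_eq (pointMatrix_submatrix _)
      (pointMatrix_submatrix _) e₁ e₂ e₃

variable (k N r)

/-- The standard gluing data of the Grassmannian. -/
def grassmannianGlueData : Scheme.GlueData.{u} where
  J := ULift.{u} (Fin r ↪ Fin N)
  U I := chart k I.down
  V p := overlap k p.1.down p.2.down
  f I J := overlapι k I.down J.down
  t I J := overlapTransition k I.down J.down
  t_id I := by
    rw [overlapTransition, transition_self]
    exact Spec.map_id _
  t' I J K := tripleTransition I.down J.down K.down
  t_fac I J K := pullback.lift_snd _ _ _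
  cocycle I J K := triple_cocycle _ _ _
  f_open _ _ := inferInstance

/-- The Grassmannian over `k` of quotients of `𝒪^N` that are locally free of rank `N - r`, glued from
its standard affine charts `U_I`. Over `U_I` the kernel of the universal quotient is spanned by the
rows of `chartMatrix k N r I`. (It is empty for `r > N`.) -/
def Grassmannian : Scheme.{u} := (grassmannianGlueData k N r).glued

namespace Grassmannian

/-- The inclusion of the chart `U_I`. -/
def ι (I : Fin r ↪ Fin N) : chart k I ⟶ Grassmannian k N r :=
  (grassmannianGlueData k N r).ι ⟨I⟩

instance (I : Fin r ↪ Fin N) : IsOpenImmersion (ι k N r I) :=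
  (grassmannianGlueData k N r).ι_isOpenImmersion ⟨I⟩

/-- The structure morphism to `Spec k`. -/
def str : Grassmannian k N r ⟶ Spec (.of k) :=
  Multicoequalizer.desc _ _ (fun I => chartStr k I.down) (by
    rintro ⟨I, J⟩
    exact ((Category.assoc _ _ _).trans (overlapTransition_str k I.down J.down)).symm)

lemma ι_str (I : Fin r ↪ Fin N) : ι k N r I ≫ str k N r = chartStr k I :=
  Multicoequalizer.π_desc _ _ _ _ _

end Grassmannian

end Grassmannian

/-! ### Projective space and the incidence variety -/

section Incidence

attribute [local instance] MvPolynomial.gradedAlgebra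

variable (k : Type u) [Field k] (n r : ℕ)

/-- `ℙⁿ_k = Proj k[X₀, …, Xₙ]`. -/
def ProjectiveSpace : Scheme.{u} :=
  Proj (MvPolynomial.homogeneousSubmodule (Fin (n + 1)) k)

namespace ProjectiveSpace

/-- The structure morphism `ℙⁿ_k ⟶ Spec k`. -/
def str : ProjectiveSpace k n ⟶ Spec (.of k) :=
  Proj.toSpecZero _ ≫ Spec.map (CommRingCat.ofHom
    (algebraMap k (MvPolynomial.homogeneousSubmodule (Fin (n + 1)) k 0)))

/-- The coordinate ring `k[X₀ / Xᵢ, …, Xₙ / Xᵢ]` of the standard open `{Xᵢ ≠ 0}`. -/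
abbrev ChartRing (i : Fin (n + 1)) : Type u :=
  HomogeneousLocalization.Away (MvPolynomial.homogeneousSubmodule (Fin (n + 1)) k)
    (MvPolynomial.X i)

/-- The inclusion of the standard open `{Xᵢ ≠ 0}`. -/
def ι (i : Fin (n + 1)) : Spec (.of (ChartRing k n i)) ⟶ ProjectiveSpace k n :=
  Proj.awayι (MvPolynomial.homogeneousSubmodule (Fin (n + 1)) k) (MvPolynomial.X i)
    (MvPolynomial.isHomogeneous_X k i) one_pos

/-- The coordinate `Xⱼ / Xᵢ`. -/
def coord (i j : Fin (n + 1)) : ChartRing k n i :=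
  HomogeneousLocalization.Away.mk _ (MvPolynomial.isHomogeneous_X k i) 1 (MvPolynomial.X j)
    (MvPolynomial.isHomogeneous_X k j)

end ProjectiveSpace

/-- The product `ℙⁿ_k ×_k G`, where `G` is the Grassmannian of quotients of
`𝒪^{n+1} = Γ(ℙⁿ, 𝒪(1)) ⊗ 𝒪` of rank `n + 1 - r`. -/
abbrev ProjTimesGrass : Scheme.{u} :=
  pullback (ProjectiveSpace.str k n) (Grassmannian.str k (n + 1) r)

/-- The product of the standard open `{Xᵢ ≠ 0}` of `ℙⁿ` with the chart `U_I` of `G`. -/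
abbrev ProductChart (i : Fin (n + 1)) (I : Fin r ↪ Fin (n + 1)) : Scheme.{u} :=
  pullback (ProjectiveSpace.ι k n i ≫ ProjectiveSpace.str k n)
    (Grassmannian.ι k (n + 1) r I ≫ Grassmannian.str k (n + 1) r)

/-- The open immersion of a product of charts into `ℙⁿ ×_k G`. -/
def productChartι (i : Fin (n + 1)) (I : Fin r ↪ Fin (n + 1)) :
    ProductChart k n r i I ⟶ ProjTimesGrass k n r :=
  pullback.lift (pullback.fst _ _ ≫ ProjectiveSpace.ι k n i)
    (pullback.snd _ _ ≫ Grassmannian.ι k (n + 1) r I) (by simpa using pullback.condition)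

/-- The `a`-th linear form `l_a = ∑ⱼ M_I(a, j) Xⱼ`, divided by `Xᵢ`, as a function on
`{Xᵢ ≠ 0} × U_I`. -/
def incidenceEquation (i : Fin (n + 1)) (I : Fin r ↪ Fin (n + 1)) (a : Fin r) :
    Γ(ProductChart k n r i I, ⊤) :=
  ∑ j : Fin (n + 1),
    (pullback.snd (ProjectiveSpace.ι k n i ≫ ProjectiveSpace.str k n)
        (Grassmannian.ι k (n + 1) r I ≫ Grassmannian.str k (n + 1) r)).appTop.hom
      ((Scheme.ΓSpecIso _).inv.hom (chartMatrix k (n + 1) r I a j)) *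
    (pullback.fst (ProjectiveSpace.ι k n i ≫ ProjectiveSpace.str k n)
        (Grassmannian.ι k (n + 1) r I ≫ Grassmannian.str k (n + 1) r)).appTop.hom
      ((Scheme.ΓSpecIso _).inv.hom (ProjectiveSpace.coord k n i j))

/-- The ideal sheaf of `{(x, L) : x ∈ L}` in `ℙⁿ ×_k G`: a local function belongs to it iff on each
product of charts it belongs to the ideal generated by `l₁, …, l_r`. -/
def incidenceIdeal : (ProjTimesGrass k n r).IdealSheafData :=
  ⨅ (i : Fin (n + 1)) (I : Fin r ↪ Fin (n + 1)),
    (Scheme.IdealSheafData.ofIdealTop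
      (Ideal.span (Set.range (incidenceEquation k n r i I)))).map (productChartι k n r i I)

/-- The closed subscheme `{(x, L) : x ∈ L}` of `ℙⁿ ×_k G`, i.e. the projective bundle of the
tautological quotient on `G`. -/
def Incidence : Scheme.{u} := (incidenceIdeal k n r).subscheme

/-- The closed immersion of the incidence variety. -/
def Incidence.ι : Incidence k n r ⟶ ProjTimesGrass k n r := (incidenceIdeal k n r).subschemeι

instance : IsClosedImmersion (Incidence.ι k n r) :=
  inferInstanceAs (IsClosedImmersion (incidenceIdeal k n r).subschemeι)

end Incidence

/-! ### Sheaves of relative differentials -/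

section Differentials

variable {X S : Scheme.{u}} (f : X ⟶ S)

/-- The sections over `U` of the image of the presheaf inverse image `f⁻¹ 𝒪_S` in `𝒪_X`, that is,
the functions on `U` that come from an open subset of `S` containing the image of `U`. -/
def constants (U : X.Opens) : Subring Γ(X, U) where
  carrier := {s | ∃ (V : S.Opens) (h : U ≤ f ⁻¹ᵁ V) (t : Γ(S, V)), (f.appLE V U h).hom t = s}
  zero_mem' := ⟨⊤, le_top, 0, map_zero _⟩
  one_mem' := ⟨⊤, le_top, 1, map_one _⟩
  add_mem' := by
    rintro _ _ ⟨V, hV, s, rfl⟩ ⟨W, hW, t, rfl⟩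
    refine ⟨V ⊓ W, le_inf hV hW, (S.presheaf.map (homOfLE inf_le_left).op).hom s +
      (S.presheaf.map (homOfLE inf_le_right).op).hom t, ?_⟩
    rw [map_add]
    congr 1
    · exact congr_arg (fun φ => φ.hom s)
        (Scheme.Hom.map_appLE f (le_inf hV hW) (homOfLE (inf_le_left : V ⊓ W ≤ V)).op)
    · exact congr_arg (fun φ => φ.hom t)
        (Scheme.Hom.map_appLE f (le_inf hV hW) (homOfLE (inf_le_right : V ⊓ W ≤ W)).op)
  mul_mem' := by
    rintro _ _ ⟨V, hV, s, rfl⟩ ⟨W, hW, t, rfl⟩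
    refine ⟨V ⊓ W, le_inf hV hW, (S.presheaf.map (homOfLE inf_le_left).op).hom s *
      (S.presheaf.map (homOfLE inf_le_right).op).hom t, ?_⟩
    rw [map_mul]
    congr 1
    · exact congr_arg (fun φ => φ.hom s)
        (Scheme.Hom.map_appLE f (le_inf hV hW) (homOfLE (inf_le_left : V ⊓ W ≤ V)).op)
    · exact congr_arg (fun φ => φ.hom t)
        (Scheme.Hom.map_appLE f (le_inf hV hW) (homOfLE (inf_le_right : V ⊓ W ≤ W)).op)
  neg_mem' := by
    rintro _ ⟨V, hV, s, rfl⟩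
    exact ⟨V, hV, -s, map_neg _ _⟩

lemma constants_map {U V : X.Opens} (i : V ⟶ U) {s : Γ(X, U)} (hs : s ∈ constants f U) :
    (X.presheaf.map i.op).hom s ∈ constants f V := by
  obtain ⟨W, hW, t, rfl⟩ := hs
  exact ⟨W, (leOfHom i).trans hW, t,
    (congr_arg (fun φ => φ.hom t) (Scheme.Hom.appLE_map f hW i.op)).symm⟩

/-- The image of the presheaf `f⁻¹ 𝒪_S` in `𝒪_X`. -/
def constantsPresheaf : X.Opensᵒᵖ ⥤ CommRingCat.{u} where
  obj U := .of (constants f U.unop)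
  map i := CommRingCat.ofHom ((X.presheaf.map i).hom.restrict _ _
    fun _ hs => constants_map f i.unop hs)
  map_id U := by
    ext x
    exact congr_arg (fun φ => φ.hom x.1) (X.presheaf.map_id U)
  map_comp i j := by
    ext x
    exact congr_arg (fun φ => φ.hom x.1) (X.presheaf.map_comp i j)

/-- The inclusion of the image of `f⁻¹ 𝒪_S` in `𝒪_X`. -/
def constantsInclusion : constantsPresheaf f ⟶ X.presheaf where
  app U := CommRingCat.ofHom (constants f U.unop).subtype

/-- The sheaf `Ω¹_{X/S}`: the sheafification of the presheaf of Kähler differentials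
`U ↦ Ω¹` of `𝒪_X(U)` over `(f⁻¹ 𝒪_S)(U)`. -/
def Differentials : X.Modules :=
  (PresheafOfModules.sheafification (𝟙 X.ringCatSheaf.obj)).obj
    (PresheafOfModules.DifferentialsConstruction.relativeDifferentials' (constantsInclusion f))

/-- An `S`-derivation of `𝒪_X` with values in a sheaf of modules `M`. -/
structure SheafDerivation (M : X.Modules) where
  /-- The additive maps on sections. -/
  d (U : X.Opens) : Γ(X, U) →+ Γ(M, U)
  d_mul (U : X.Opens) (a b : Γ(X, U)) : d U (a * b) = a • d U b + b • d U a
  d_map {U V : X.Opens} (i : V ⟶ U) (a : Γ(X, U)) :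
    d V ((X.presheaf.map i.op).hom a) = (M.presheaf.map i.op).hom (d U a)
  d_app {U : X.Opens} {a : Γ(X, U)} (ha : a ∈ constants f U) : d U a = 0

variable {f} in
/-- A derivation as a derivation of presheaves. -/
def SheafDerivation.toPresheaf {M : X.Modules} (D : SheafDerivation f M) :
    ((PresheafOfModules.restrictScalars (𝟙 X.ringCatSheaf.obj)).obj
      ((SheafOfModules.forget _).obj M)).Derivation' (constantsInclusion f) where
  d {U} := D.d U.unop
  d_mul {U} a b := D.d_mul U.unop a b
  d_map i a := D.d_map i.unop a
  d_app a := D.d_app a.2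

variable {f} in
/-- The linear map `Ω¹_{X/S} ⟶ M` corresponding to a derivation. -/
def SheafDerivation.desc {M : X.Modules} (D : SheafDerivation f M) : Differentials f ⟶ M :=
  (PresheafOfModules.sheafificationHomEquiv (𝟙 X.ringCatSheaf.obj)).symm
    ((PresheafOfModules.DifferentialsConstruction.isUniversal' (constantsInclusion f)).desc
      D.toPresheaf)

/-- The universal derivation, as a derivation of presheaves. -/
def universalPresheaf : ((PresheafOfModules.restrictScalars (𝟙 X.ringCatSheaf.obj)).obj
      ((SheafOfModules.forget _).obj (Differentials f))).Derivation' (constantsInclusion f) :=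
  (PresheafOfModules.DifferentialsConstruction.derivation' (constantsInclusion f)).postcomp
    (PresheafOfModules.sheafificationHomEquiv (𝟙 X.ringCatSheaf.obj) (𝟙 (Differentials f)))

/-- The universal derivation `d : 𝒪_X ⟶ Ω¹_{X/S}`. -/
def universalDerivation : SheafDerivation f (Differentials f) where
  d U := (universalPresheaf f).d (X := .op U)
  d_mul U a b := (universalPresheaf f).d_mul (X := .op U) a b
  d_map i a := (universalPresheaf f).d_map i.op a
  d_app {U a} ha := (universalPresheaf f).d_app (X := .op U) ⟨a, ha⟩


variable {f} in
/-- For a commutative square with top `a : X' ⟶ X`, an `S'`-derivation `D` of `𝒪_{X'}` gives the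
`S`-derivation `s ↦ D (a^♯ s)` of `𝒪_X` with values in the direct image. -/
def SheafDerivation.push {X' S' : Scheme.{u}} {a : X' ⟶ X} {g : X' ⟶ S'} {b : S' ⟶ S}
    (sq : a ≫ f = g ≫ b) {M : X'.Modules} (D : SheafDerivation g M) :
    SheafDerivation f ((Scheme.Modules.pushforward a).obj M) where
  d U := (D.d (a ⁻¹ᵁ U)).comp (a.app U).hom.toAddMonoidHom
  d_mul U s t := by
    refine (congr_arg (D.d (a ⁻¹ᵁ U)) (map_mul (a.app U).hom s t)).trans ?_
    exact D.d_mul _ _ _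
  d_map {U V} i s := by
    refine (congr_arg (D.d (a ⁻¹ᵁ V)) ?_).trans
      (D.d_map ((TopologicalSpace.Opens.map a.base).map i) ((a.app U).hom s))
    exact congr_arg (fun φ => φ.hom s) (a.naturality i.op)
  d_app {U s} hs := by
    apply D.d_app
    obtain ⟨V, hV, t, rfl⟩ := hs
    have hU : a ⁻¹ᵁ U ≤ g ⁻¹ᵁ (b ⁻¹ᵁ V) := by
      rw [← Scheme.Hom.comp_preimage, ← sq, Scheme.Hom.comp_preimage]
      exact a.preimage_mono hV
    refine ⟨b ⁻¹ᵁ V, hU, (b.app V).hom t, ?_⟩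
    have e : b.app V ≫ g.appLE (b ⁻¹ᵁ V) (a ⁻¹ᵁ U) hU = f.appLE V U hV ≫ a.app U := by
      rw [Scheme.Hom.app_eq_appLE, Scheme.Hom.app_eq_appLE, Scheme.Hom.appLE_comp_appLE,
        Scheme.Hom.appLE_comp_appLE]
      simp only [sq]
    exact congr_arg (fun φ => φ.hom t) e

/-- The canonical map `a^* Ω¹_{X/S} ⟶ Ω¹_{X'/S'}`, `a^*(ds) ↦ d(a^♯ s)`, of a commutative square. -/
def Differentials.baseChange {X' S' : Scheme.{u}} {f : X ⟶ S} {a : X' ⟶ X} {g : X' ⟶ S'}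
    {b : S' ⟶ S} (sq : a ≫ f = g ≫ b) :
    (Scheme.Modules.pullback a).obj (Differentials f) ⟶ Differentials g :=
  ((Scheme.Modules.pullbackPushforwardAdjunction a).homEquiv _ _).symm
    ((universalDerivation g).push sq).desc

end Differentials

section Conormal

variable {Z Y : Scheme.{u}} (i : Z ⟶ Y)

/-- `𝒪_Y` as a sheaf of modules. -/
abbrev structureModule (Y : Scheme.{u}) : Y.Modules := SheafOfModules.unit Y.ringCatSheaf

/-- The map `𝒪_Y ⟶ i_* 𝒪_Z`. -/
def comorphism : structureModule Y ⟶ (Scheme.Modules.pushforward i).obj (structureModule Z) :=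
  SheafOfModules.unitToPushforwardObjUnit i.toRingCatSheafHom

/-- The ideal sheaf `I = ker (𝒪_Y ⟶ i_* 𝒪_Z)`. -/
def idealModule : Y.Modules := kernel (comorphism i)

/-- The inclusion `I ⟶ 𝒪_Y`. -/
def idealInclusion : idealModule i ⟶ structureModule Y := kernel.ι _

/-- For a closed immersion `i`, the conormal sheaf `I/I² = I ⊗ 𝒪_Y/I = i^* I` on `Z`. -/
def conormalSheaf : Z.Modules := (Scheme.Modules.pullback i).obj (idealModule i)

lemma app_idealInclusion {U : Y.Opens} (s : Γ(idealModule i, U)) :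
    (i.app U).hom ((idealInclusion i).app U s) = 0 := by
  have h : idealInclusion i ≫ comorphism i = 0 := kernel.condition _
  exact congr_arg (fun φ => φ.app U s) h

variable {S : Scheme.{u}} (g : Y ⟶ S)

/-- The map `s ↦ 1 ⊗ ds` on local sections of `I`. -/
def conormalAuxApp (U : Y.Opens) :
    Γ(idealModule i, U) →+ Γ((Scheme.Modules.pushforward i).obj
      ((Scheme.Modules.pullback i).obj (Differentials g)), U) :=
  (((Scheme.Modules.pullbackPushforwardAdjunction i).unit.app (Differentials g)).app U).hom.comp
    (((universalDerivation g).d U).comp ((idealInclusion i).app U).hom)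

lemma conormalAuxApp_map {U V : Y.Opens} (j : V ⟶ U) (s : Γ(idealModule i, U)) :
    conormalAuxApp i g V (((idealModule i).presheaf.map j.op).hom s) =
      (((Scheme.Modules.pushforward i).obj ((Scheme.Modules.pullback i).obj
        (Differentials g))).presheaf.map j.op).hom (conormalAuxApp i g U s) := by
  let η := (Scheme.Modules.pullbackPushforwardAdjunction i).unit.app (Differentials g)
  have h₁ := congr_arg (fun φ => φ.hom s) ((idealInclusion i).mapPresheaf.naturality j.op)
  have h₂ := (universalDerivation g).d_map j ((idealInclusion i).app U s)
  have h₃ := congr_arg (fun φ => φ.hom ((universalDerivation g).d U ((idealInclusion i).app U s)))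
    (η.mapPresheaf.naturality j.op)
  refine (congr_arg (fun x => η.app V ((universalDerivation g).d V x)) h₁).trans ?_
  exact (congr_arg (fun x => η.app V x) h₂).trans h₃

lemma pushforward_smul_eq_zero {M : Z.Modules} {U : Y.Opens} {t : Γ(Y, U)}
    (ht : (i.app U).hom t = 0) (x : Γ((Scheme.Modules.pushforward i).obj M, U)) : t • x = 0 :=
  (congr_arg (fun a : Γ(Z, i ⁻¹ᵁ U) => a • (show Γ(M, i ⁻¹ᵁ U) from x)) ht).trans
    (zero_smul _ (show Γ(M, i ⁻¹ᵁ U) from x))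

lemma conormalAuxApp_smul (U : Y.Opens) (r : Γ(Y, U)) (s : Γ(idealModule i, U)) :
    conormalAuxApp i g U (r • s) = r • conormalAuxApp i g U s := by
  let η := (Scheme.Modules.pullbackPushforwardAdjunction i).unit.app (Differentials g)
  let t : Γ(Y, U) := (idealInclusion i).app U s
  have h₁ : (idealInclusion i).app U (r • s) = (r * t : Γ(Y, U)) :=
    (idealInclusion i).app_smul r s
  have h₂ : η.app U (t • (universalDerivation g).d U r) = 0 :=
    (η.app_smul t _).trans (pushforward_smul_eq_zero i (app_idealInclusion i s) _)
  change η.app U ((universalDerivation g).d U ((idealInclusion i).app U (r • s))) = _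
  rw [h₁, SheafDerivation.d_mul, map_add, h₂, add_zero, Scheme.Modules.Hom.app_smul]
  rfl

/-- The `𝒪_Y`-linear map `I ⟶ i_* i^* Ω¹_{Y/S}`, `s ↦ 1 ⊗ ds`. -/
def conormalAux : idealModule i ⟶ (Scheme.Modules.pushforward i).obj
    ((Scheme.Modules.pullback i).obj (Differentials g)) where
  val := PresheafOfModules.homMk
    { app U := AddCommGrpCat.ofHom (conormalAuxApp i g U.unop)
      naturality U V j := by
        ext s
        exact conormalAuxApp_map i g j.unop s }
    (fun U r s => conormalAuxApp_smul i g U.unop r s)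

/-- The natural map `I/I² ⟶ i^* Ω¹_{Y/S}`, `s ↦ 1 ⊗ ds`. -/
def conormalMap : conormalSheaf i ⟶ (Scheme.Modules.pullback i).obj (Differentials g) :=
  ((Scheme.Modules.pullbackPushforwardAdjunction i).homEquiv _ _).symm (conormalAux i g)

end Conormal

section VectorBundle

/-- `M` is a vector bundle of rank `ρ`: locally isomorphic to `𝒪^s` with `s = ρ`. For `ρ < 0` this
means that `Z` is empty. -/
def IsVectorBundleOfRank {Z : Scheme.{u}} (M : Z.Modules) (ρ : ℤ) : Prop :=
  ∀ z : Z, ∃ (V : Z.Opens) (s : ℕ), z ∈ V ∧ (s : ℤ) = ρ ∧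
    Nonempty (M.restrict V.ι ≅ SheafOfModules.free (R := V.toScheme.ringCatSheaf) (ULift.{u} (Fin s)))

end VectorBundle

section Bertini

variable {k : Type u} [Field k] {n : ℕ} {X : Scheme.{u}} (f : X ⟶ ProjectiveSpace k n) (r : ℕ)

/-- The structure morphism of `X` as a `k`-scheme. -/
abbrev overField : X ⟶ Spec (.of k) := f ≫ ProjectiveSpace.str k n

/-- `X ×_k G`. -/
abbrev TimesGrass : Scheme.{u} := pullback (overField f) (Grassmannian.str k (n + 1) r)

/-- The first projection `X ×_k G ⟶ X`. -/
abbrev prX : TimesGrass f r ⟶ X := pullback.fst _ _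

/-- The second projection `X ×_k G ⟶ G`. -/
abbrev prG : TimesGrass f r ⟶ Grassmannian k (n + 1) r := pullback.snd _ _

/-- `f × id : X ×_k G ⟶ ℙⁿ ×_k G`. -/
def timesGrassMap : TimesGrass f r ⟶ ProjTimesGrass k n r :=
  pullback.lift (prX f r ≫ f) (prG f r) (by rw [Category.assoc]; exact pullback.condition)

/-- `H_X = {(x, L) ∈ X × G : f(x) ∈ L}`. -/
abbrev Inc : Scheme.{u} := pullback (timesGrassMap f r) (Incidence.ι k n r)

/-- The closed immersion `H_X ⟶ X ×_k G`. -/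
abbrev incι : Inc f r ⟶ TimesGrass f r := pullback.fst _ _

/-- The canonical map `pr_X^* Ω¹_{X/k} ⟶ Ω¹_{X ×_k G / G}`. -/
def differentialsComparison :
    (Scheme.Modules.pullback (prX f r)).obj (Differentials (overField f)) ⟶
      Differentials (prG f r) :=
  Differentials.baseChange pullback.condition

variable {𝒳 : Scheme.{u}} (m : 𝒳 ⟶ X)

/-- `H_𝒳 = H_X ×_X 𝒳`. -/
abbrev PullInc : Scheme.{u} := pullback (incι f r ≫ prX f r) m

/-- The projection `H_𝒳 ⟶ H_X`. -/
abbrev pullIncToInc : PullInc f r m ⟶ Inc f r := pullback.fst _ _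

/-- The projection `H_𝒳 ⟶ 𝒳`. -/
abbrev pullIncToBase : PullInc f r m ⟶ 𝒳 := pullback.snd _ _

/-- The projection `H_𝒳 ⟶ G`. -/
abbrev pullIncToGrass : PullInc f r m ⟶ Grassmannian k (n + 1) r := pullIncToInc f r m ≫ incι f r ≫ prG f r

/-- The canonical identification of the two pullbacks to `H_𝒳` of a sheaf of modules on `X`, along
`H_𝒳 ⟶ H_X ⟶ X ×_k G ⟶ X` and along `H_𝒳 ⟶ 𝒳 ⟶ X`. -/
def pullbackIso (M : X.Modules) :
    (Scheme.Modules.pullback (pullIncToInc f r m)).obj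
      ((Scheme.Modules.pullback (incι f r)).obj ((Scheme.Modules.pullback (prX f r)).obj M)) ≅
    (Scheme.Modules.pullback (pullIncToBase f r m)).obj ((Scheme.Modules.pullback m).obj M) :=
  (Scheme.Modules.pullback (pullIncToInc f r m)).mapIso
      ((Scheme.Modules.pullbackComp (incι f r) (prX f r)).app M) ≪≫
    (Scheme.Modules.pullbackComp (pullIncToInc f r m) (incι f r ≫ prX f r)).app M ≪≫
    (Scheme.Modules.pullbackCongr pullback.condition).app M ≪≫
    ((Scheme.Modules.pullbackComp (pullIncToBase f r m) m).app M).symm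

variable {ℰ : 𝒳.Modules}
  (π : (Scheme.Modules.pullback m).obj (Differentials (overField f)) ⟶ ℰ)

/-- The map `φ : I/I² ⊗ 𝒪_𝒳 ⟶ ℰ ⊗ 𝒪_{H_X}` on `H_𝒳`: the pullback of the natural map
`I/I² ⟶ Ω¹_{X ×_k G / G}|_{H_X} = Ω¹_{X/k} ⊗ 𝒪_{H_X}`, followed by the pullback of `π`. -/
def conormalToBundle [IsIso (differentialsComparison f r)] :
    (Scheme.Modules.pullback (pullIncToInc f r m)).obj (conormalSheaf (incι f r)) ⟶
      (Scheme.Modules.pullback (pullIncToBase f r m)).obj ℰ :=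
  (Scheme.Modules.pullback (pullIncToInc f r m)).map
      (conormalMap (incι f r) (prG f r) ≫
        (Scheme.Modules.pullback (incι f r)).map (inv (differentialsComparison f r))) ≫
    (pullbackIso f r m (Differentials (overField f))).hom ≫
    (Scheme.Modules.pullback (pullIncToBase f r m)).map π

end Bertini

end

end Bertini

/-! The comparison map. Linear maps out of a sheaf of differentials are the same as derivations
(`SheafDerivation.desc_ofHom`, `SheafDerivation.ofHom_desc`). By Yoneda, the map from the pullback
of `Ω¹_{X/k}` to `Ω¹_{X × G/G}` is therefore invertible as soon as every `k`-derivation of `𝒪_X`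
into a direct image extends uniquely to a derivation over `G` (`Differentials.isIso_baseChange`). On
an affine open `W` inside a product `A × B` of affine opens, the map `𝒪(B) ⊗ 𝒪(A) → 𝒪(W)` is
formally étale, which gives existence and uniqueness on `W`; uniqueness then glues the local
extensions.

The cokernel, seen through maps out of it. Let `V` be open in `H_𝒳`, lying over an open set on which
`ℰ` is free with basis `e_c`. A map from the pullback of `ℰ` to the direct image of a module `N` on
`V` is a `d`-tuple `g` of sections of `N` (`basisValues_bijective`). On a product of charts the
ideal `I` is generated by the forms `∑_l M_{xl} t_l`, where `M` is the universal matrix and `t_l =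
X_l / X_i` (`comap_incidenceIdeal`). Differentiation relative to `G` kills `M`. Writing `∑_c δ_{lc}
e_c` for the image of `dt_l` in `ℰ`, the map given by `g` kills the image of `φ` exactly when `A g =
0` with `A = M δ` (`squareConormal_comp_eq_zero_iff_rows`). If the `r` rows of `A` are independent
at a point, then unit vectors complete `A` to a square matrix invertible near it, the solutions `g`
are parametrised by `d - r` free sections, and the cokernel is free of rank `d - r` there
(`exists_free_cokernel_of_linearIndependent`).

Independence over the generic point of a chart. Let `z` in `H_𝒳` lie over that point, let `F` be the
residue field of its image in `𝒳`, and let `P` be the vector of coordinates of the corresponding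
point of projective space. Since `f` is unramified and `π` is surjective, the `dt_l` span the fibre
of `ℰ`; since `t_i = 1`, the vector `P` and the `d` columns of `δ` are independent over `F`
(`linearIndependent_coordinates`). The free entries of `M` are algebraically independent over `k`,
while `M P = 0`. A relation between the rows of `M δ` would give a combination of rows of `M`
orthogonal to `P` and to all the columns of `δ`. Counting the elements needed to generate `M` over
`F`, and using that `F` has transcendence degree at most `d` because `dim 𝒳 ≤ d`, shows that `M`
would have transcendence degree smaller than `r(N - r)`, where `N = n + 1`
(`linearIndependent_generic_rows`).

Spreading out. The locus where the cokernel is free of rank `d - r` is open, and its complement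
misses the fibres over the generic points of the charts. As `H_𝒳` is quasi-compact over `G`, the
image of this complement in each integral chart lies in the zero set of a nonzero function
(`exists_dense_opens_notMem`). If `r > d`, no point of `H_𝒳` lies over a generic point at all, and
the same argument makes `H_𝒳` empty over a dense open set. -/

namespace Bertini

noncomputable section

/-! ### Sheaves of modules -/

section FreeModules

variable {V : Scheme.{u}}

/-- The free sheaf of modules of rank `s`. -/
abbrev freeModule (V : Scheme.{u}) (s : ℕ) : V.Modules :=
  SheafOfModules.free (R := V.ringCatSheaf) (ULift.{u} (Fin s))

/-- The basis sections of the free sheaf of modules. -/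
def freeBasis (V : Scheme.{u}) (s : ℕ) (i : Fin s) : Γ(freeModule V s, ⊤) :=
  (SheafOfModules.freeSection (R := V.ringCatSheaf) (ULift.up i)).val (.op ⊤)

/-- A compatible family of sections over all opens is recovered from its member on the largest open
by restriction. -/
lemma sections_bijective (M : V.Modules) :
    Function.Bijective (fun (t : SheafOfModules.sections (R := V.ringCatSheaf) M) =>
      (show Γ(M, ⊤) from t.val (.op ⊤))) := by
  constructor
  · intro t t' h
    apply PresheafOfModules.sections_ext
    intro U
    have h1 := t.property (homOfLE (le_top : U.unop ≤ ⊤)).op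
    have h2 := t'.property (homOfLE (le_top : U.unop ≤ ⊤)).op
    rw [← h1, ← h2]
    exact congr_arg (fun x => M.presheaf.map (homOfLE (le_top : U.unop ≤ ⊤)).op x) h
  · intro x
    refine ⟨⟨fun U => M.presheaf.map (homOfLE (le_top : U.unop ≤ ⊤)).op x, ?_⟩, ?_⟩
    · intro U W g
      exact (ConcreteCategory.comp_apply (M.presheaf.map (homOfLE (le_top : U.unop ≤ ⊤)).op)
        (M.presheaf.map g) x).symm.trans (by rw [← Functor.map_comp]; rfl)
    · change M.presheaf.map (𝟙 _) x = x
      simp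

/-- The universal property in the form used throughout: maps out of a free sheaf are tuples of
global sections. -/
lemma freeHom_bijective (s : ℕ) (M : V.Modules) :
    Function.Bijective (fun (g : freeModule V s ⟶ M) (i : Fin s) =>
      g.app ⊤ (freeBasis V s i)) := by
  have h1 : Function.Bijective (SheafOfModules.freeHomEquiv (R := V.ringCatSheaf) M
    (I := ULift.{u} (Fin s))) := Equiv.bijective _
  have h2 : Function.Bijective (fun (t : ULift.{u} (Fin s) →
      SheafOfModules.sections (R := V.ringCatSheaf) M) (i : Fin s) =>
      (show Γ(M, ⊤) from (t ⟨i⟩).val (.op ⊤))) := by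
    have := sections_bijective M
    constructor
    · intro t t' h
      funext i
      exact this.1 (congr_fun h i.down)
    · intro x
      choose t ht using fun i => this.2 (x i)
      exact ⟨fun i => t i.down, funext ht⟩
  exact h2.comp h1

/-- A sheaf of modules corepresenting `N ↦ Γ(N, ⊤)^s` is free of rank `s`. -/
lemma nonempty_iso_free {s : ℕ} (Q : V.Modules)
    (ev : ∀ N : V.Modules, (Q ⟶ N) → Fin s → Γ(N, ⊤))
    (bij : ∀ N, Function.Bijective (ev N))
    (nat : ∀ {N N' : V.Modules} (g : Q ⟶ N) (h : N ⟶ N') i,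
      ev N' (g ≫ h) i = h.app ⊤ (ev N g i)) :
    Nonempty (Q ≅ freeModule V s) := by
  obtain ⟨α, hα⟩ := (bij (freeModule V s)).2 (freeBasis V s)
  obtain ⟨β, hβ⟩ := (freeHom_bijective s Q).2 (ev Q (𝟙 Q))
  refine ⟨⟨α, β, ?_, ?_⟩⟩
  · apply (bij Q).1
    funext i
    rw [nat, hα]
    exact congr_fun hβ i
  · apply (freeHom_bijective s _).1
    funext i
    have e : (β ≫ α).app ⊤ (freeBasis V s i) = α.app ⊤ (β.app ⊤ (freeBasis V s i)) := rfl
    have e2 := congr_fun hβ i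
    dsimp only at e2 ⊢
    rw [e, e2, ← nat, Category.id_comp, hα]
    rfl

end FreeModules

/-! ### Derivations as maps out of the sheaf of differentials -/

section DerivationHom

variable {X S : Scheme.{u}} {f : X ⟶ S}

lemma SheafDerivation.ext' {M : X.Modules} {D D' : SheafDerivation f M}
    (h : ∀ U s, D.d U s = D'.d U s) : D = D' := by
  cases D; cases D'
  congr
  funext U
  ext s
  exact h U s

/-- The derivation corresponding to a linear map out of the sheaf of differentials. -/
def SheafDerivation.ofHom {M : X.Modules} (θ : Differentials f ⟶ M) : SheafDerivation f M where
  d U := (θ.app U).hom.comp ((universalDerivation f).d U)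
  d_mul U a b := by
    refine (congr_arg (θ.app U) ((universalDerivation f).d_mul U a b)).trans ?_
    rw [map_add, Scheme.Modules.Hom.app_smul, Scheme.Modules.Hom.app_smul]
    rfl
  d_map {U V} i a := by
    refine (congr_arg (θ.app V) ((universalDerivation f).d_map i a)).trans ?_
    exact congr_arg (fun φ => φ.hom ((universalDerivation f).d U a)) (θ.mapPresheaf.naturality i.op)
  d_app {U a} ha := by
    refine (congr_arg (θ.app U) ((universalDerivation f).d_app ha)).trans ?_
    exact map_zero _

lemma toPresheaf_eq_postcomp {M : X.Modules} (θ : Differentials f ⟶ M) :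
    (SheafDerivation.ofHom θ).toPresheaf =
      (PresheafOfModules.DifferentialsConstruction.derivation' (constantsInclusion f)).postcomp
        (PresheafOfModules.sheafificationHomEquiv (𝟙 X.ringCatSheaf.obj) θ) := rfl

/-- Combines the sheafification adjunction with the universal property of the presheaf of Kähler
differentials. Together with `SheafDerivation.ofHom_desc` it identifies maps out of `Ω¹` with
derivations. -/
lemma SheafDerivation.desc_ofHom {M : X.Modules} (θ : Differentials f ⟶ M) :
    (SheafDerivation.ofHom θ).desc = θ := by
  unfold SheafDerivation.desc
  apply (PresheafOfModules.sheafificationHomEquiv (𝟙 X.ringCatSheaf.obj)).injective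
  refine (Equiv.apply_symm_apply _ _).trans ?_
  apply (PresheafOfModules.DifferentialsConstruction.isUniversal'
    (constantsInclusion f)).postcomp_injective
  exact PresheafOfModules.Derivation.Universal.fac _ _

lemma SheafDerivation.ofHom_desc {M : X.Modules} (D : SheafDerivation f M) :
    SheafDerivation.ofHom D.desc = D := by
  have : (SheafDerivation.ofHom D.desc).toPresheaf = D.toPresheaf := by
    refine (toPresheaf_eq_postcomp _).trans ?_
    refine (congr_arg _ (Equiv.apply_symm_apply _ _)).trans ?_
    exact PresheafOfModules.Derivation.Universal.fac _ _
  apply SheafDerivation.ext'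
  intro U s
  exact PresheafOfModules.Derivation.congr_d this (X := .op U) s

lemma SheafDerivation.desc_app {M : X.Modules} (D : SheafDerivation f M) (U : X.Opens) (s) :
    D.desc.app U ((universalDerivation f).d U s) = D.d U s :=
  congr_arg (fun D => SheafDerivation.d D U s) (SheafDerivation.ofHom_desc D)

lemma Differentials.hom_ext {M : X.Modules} {θ θ' : Differentials f ⟶ M}
    (h : ∀ U s, θ.app U ((universalDerivation f).d U s) =
      θ'.app U ((universalDerivation f).d U s)) : θ = θ' := by
  rw [← SheafDerivation.desc_ofHom θ, ← SheafDerivation.desc_ofHom θ']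
  congr 1
  exact SheafDerivation.ext' h

variable {X' S' : Scheme.{u}} {a : X' ⟶ X} {g : X' ⟶ S'} {b : S' ⟶ S}

lemma Differentials.baseChange_comp_homEquiv (sq : a ≫ f = g ≫ b) {N : X'.Modules}
    (θ : Differentials g ⟶ N) (U : X.Opens) (s : Γ(X, U)) :
    ((Scheme.Modules.pullbackPushforwardAdjunction a).homEquiv _ _
      (Differentials.baseChange sq ≫ θ)).app U ((universalDerivation f).d U s) =
    θ.app (a ⁻¹ᵁ U) ((universalDerivation g).d _ ((a.app U).hom s)) := by
  rw [Adjunction.homEquiv_naturality_right, Differentials.baseChange, Equiv.apply_symm_apply]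
  have := SheafDerivation.desc_app ((universalDerivation g).push sq) U s
  exact congr_arg (θ.app (a ⁻¹ᵁ U)) this

/-- The base change map of differentials is an isomorphism when derivations extend uniquely. -/
lemma Differentials.isIso_baseChange (sq : a ≫ f = g ≫ b)
    (uniq : ∀ (N : X'.Modules) (D D' : SheafDerivation g N), D.push sq = D'.push sq → D = D')
    (exist : ∀ (N : X'.Modules) (D : SheafDerivation f ((Scheme.Modules.pushforward a).obj N)),
      ∃ D' : SheafDerivation g N, D'.push sq = D) :
    IsIso (Differentials.baseChange sq) := by
  -- By Yoneda it suffices that precomposition is bijective on maps to every `N`; in terms of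
  -- derivations, precomposition is `SheafDerivation.push`.
  rw [isIso_iff_coyoneda_map_bijective]
  intro N
  constructor
  · intro θ θ' h
    dsimp at h
    rw [← SheafDerivation.desc_ofHom θ, ← SheafDerivation.desc_ofHom θ']
    congr 1
    apply uniq
    apply SheafDerivation.ext'
    intro U s
    have h1 := Differentials.baseChange_comp_homEquiv sq θ U s
    rw [h, Differentials.baseChange_comp_homEquiv] at h1
    exact h1.symm
  · intro τ
    obtain ⟨D', hD'⟩ := exist N (SheafDerivation.ofHom
      ((Scheme.Modules.pullbackPushforwardAdjunction a).homEquiv _ _ τ))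
    refine ⟨D'.desc, ?_⟩
    apply ((Scheme.Modules.pullbackPushforwardAdjunction a).homEquiv _ _).injective
    apply Differentials.hom_ext
    intro U s
    refine (Differentials.baseChange_comp_homEquiv sq D'.desc U s).trans ?_
    refine (SheafDerivation.desc_app D' _ _).trans ?_
    exact congr_arg (fun D => SheafDerivation.d D U s) hD'

end DerivationHom

/-! ### Extending derivations -/

section DerivationAlgebra

open TensorProduct KaehlerDifferential

attribute [local instance] Algebra.TensorProduct.rightAlgebra

/-- Base change gives `Ω_{B ⊗ A / B} = (B ⊗ A) ⊗_A Ω_{A/k}`, and formal étaleness gives `Ω_{C/B} = C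
⊗ Ω_{B ⊗ A / B}`. So `δ` extends first to a `B`-derivation of `B ⊗ A` (`D₁`) and then to one of `C`
(`D₂`). -/
lemma exists_derivation_extension {k A B C N : Type*} [CommRing k] [CommRing A] [CommRing B]
    [CommRing C] [Algebra k A] [Algebra k B] [Algebra k C] (φ : A →ₐ[k] C) (ψ : B →ₐ[k] C)
    (h : (Algebra.TensorProduct.productMap ψ φ).toRingHom.FormallyEtale)
    [AddCommGroup N] [Module C N] (δ : A →+ N)
    (hmul : ∀ a b, δ (a * b) = φ a • δ b + φ b • δ a) (hk : ∀ x, δ (algebraMap k A x) = 0) :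
    ∃ D : C →+ N, (∀ a b, D (a * b) = a • D b + b • D a) ∧ (∀ b, D (ψ b) = 0) ∧
      ∀ a, D (φ a) = δ a := by
  let : Algebra (B ⊗[k] A) C := (Algebra.TensorProduct.productMap ψ φ).toRingHom.toAlgebra
  let : Algebra A C := φ.toRingHom.toAlgebra
  let : Algebra B C := ψ.toRingHom.toAlgebra
  have : Algebra.FormallyEtale (B ⊗[k] A) C := h
  have : IsScalarTower k A C := .of_algebraMap_eq fun x => (φ.commutes x).symm
  have : IsScalarTower k B C := .of_algebraMap_eq fun x => (ψ.commutes x).symm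
  have : IsScalarTower A (B ⊗[k] A) C := .of_algebraMap_eq fun x => by
    change φ x = Algebra.TensorProduct.productMap ψ φ (1 ⊗ₜ x)
    simp
  have : IsScalarTower B (B ⊗[k] A) C := .of_algebraMap_eq fun x => by
    change ψ x = Algebra.TensorProduct.productMap ψ φ (x ⊗ₜ 1)
    simp
  let : Module A N := Module.compHom N (algebraMap A C)
  let : Module B N := Module.compHom N (algebraMap B C)
  let : Module k N := Module.compHom N (algebraMap k C)
  let : Module (B ⊗[k] A) N := Module.compHom N (algebraMap (B ⊗[k] A) C)
  have : IsScalarTower (B ⊗[k] A) C N := .of_algebraMap_smul fun _ _ => rfl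
  have : IsScalarTower A C N := .of_algebraMap_smul fun _ _ => rfl
  have : IsScalarTower B C N := .of_algebraMap_smul fun _ _ => rfl
  have : IsScalarTower k C N := .of_algebraMap_smul fun _ _ => rfl
  have : IsScalarTower k A N := .of_algebraMap_smul fun r x => by
    rw [← algebraMap_smul C (algebraMap k A r), ← IsScalarTower.algebraMap_apply, algebraMap_smul]
  have : IsScalarTower A (B ⊗[k] A) N := .of_algebraMap_smul fun r x => by
    rw [← algebraMap_smul C (algebraMap A (B ⊗[k] A) r), ← IsScalarTower.algebraMap_apply,
      algebraMap_smul]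
  have : IsScalarTower B (B ⊗[k] A) N := .of_algebraMap_smul fun r x => by
    rw [← algebraMap_smul C (algebraMap B (B ⊗[k] A) r), ← IsScalarTower.algebraMap_apply,
      algebraMap_smul]
  let δ' : Derivation k A N :=
    { toFun := δ
      map_add' := map_add δ
      map_smul' := fun r a => by
        rw [Algebra.smul_def, hmul, hk, smul_zero, add_zero, RingHom.id_apply,
          ← algebraMap_smul A r]
        rfl
      map_one_eq_zero' := by
        have := hk 1
        rwa [map_one] at this
      leibniz' := hmul }
  let D₁ : Derivation B (B ⊗[k] A) N :=
    ((δ'.liftKaehlerDifferential.liftBaseChange (B ⊗[k] A)).comp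
      (tensorKaehlerEquiv k B A (B ⊗[k] A)).symm.toLinearMap).compDer (KaehlerDifferential.D _ _)
  let D₂ : Derivation B C N :=
    ((D₁.liftKaehlerDifferential.liftBaseChange C).comp
      (tensorKaehlerEquivOfFormallyEtale B (B ⊗[k] A) C).symm.toLinearMap).compDer
        (KaehlerDifferential.D _ _)
  refine ⟨D₂.toLinearMap.toAddMonoidHom, D₂.leibniz, fun b => D₂.map_algebraMap b, fun a => ?_⟩
  have e₁ : D₁ (1 ⊗ₜ a) = δ a := by
    change δ'.liftKaehlerDifferential.liftBaseChange (B ⊗[k] A)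
      ((tensorKaehlerEquiv k B A (B ⊗[k] A)).symm (KaehlerDifferential.D _ _ (1 ⊗ₜ a))) = _
    have : (tensorKaehlerEquiv k B A (B ⊗[k] A)).symm (KaehlerDifferential.D B (B ⊗[k] A) (1 ⊗ₜ a))
        = 1 ⊗ₜ KaehlerDifferential.D k A a := by
      rw [LinearEquiv.symm_apply_eq, tensorKaehlerEquiv_tmul_D, one_smul]
      rfl
    rw [this, LinearMap.liftBaseChange_tmul, one_smul, Derivation.liftKaehlerDifferential_comp_D]
    rfl
  have e₂ : φ a = algebraMap (B ⊗[k] A) C (1 ⊗ₜ a) := by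
    change φ a = Algebra.TensorProduct.productMap ψ φ (1 ⊗ₜ a)
    simp
  rw [e₂, ← e₁]
  change D₁.liftKaehlerDifferential.liftBaseChange C
    ((tensorKaehlerEquivOfFormallyEtale B (B ⊗[k] A) C).symm (KaehlerDifferential.D _ _ _)) = _
  rw [tensorKaehlerEquivOfFormallyEtale_symm_D_algebraMap, LinearMap.liftBaseChange_tmul, one_smul,
    Derivation.liftKaehlerDifferential_comp_D]

/-- A derivation vanishing on a subring over which the algebra is formally unramified is zero. -/
lemma derivation_eq_zero {A C N : Type*} [CommRing A] [CommRing C]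
    (φ : A →+* C) (h : φ.FormallyUnramified) [AddCommGroup N] [Module C N] (D : C →+ N)
    (hmul : ∀ a b, D (a * b) = a • D b + b • D a) (hφ : ∀ a, D (φ a) = 0) : D = 0 := by
  let := φ.toAlgebra
  have : Algebra.FormallyUnramified A C := h
  let : Module A N := Module.compHom N (algebraMap A C)
  have : IsScalarTower A C N := .of_algebraMap_smul fun _ _ => rfl
  let D' : Derivation A C N :=
    { toFun := D
      map_add' := map_add D
      map_smul' := fun r a => by
        rw [Algebra.smul_def, hmul, RingHom.algebraMap_toAlgebra, hφ, smul_zero, add_zero]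
        rfl
      map_one_eq_zero' := by
        have := hφ 1
        rwa [map_one] at this
      leibniz' := hmul }
  have : D' = 0 := by
    rw [← Derivation.liftKaehlerDifferential_comp D',
      Subsingleton.elim D'.liftKaehlerDifferential 0]
    ext; simp
  ext x
  exact congr_arg (fun D : Derivation A C N => D x) this

lemma derivation_eq_zero_of_productMap {k A B C N : Type*} [CommRing k] [CommRing A] [CommRing B]
    [CommRing C] [Algebra k A] [Algebra k B] [Algebra k C] (φ : A →ₐ[k] C) (ψ : B →ₐ[k] C)
    (h : (Algebra.TensorProduct.productMap ψ φ).toRingHom.FormallyUnramified)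
    [AddCommGroup N] [Module C N] (D : C →+ N)
    (hmul : ∀ a b, D (a * b) = a • D b + b • D a) (hφ : ∀ a, D (φ a) = 0) (hψ : ∀ a, D (ψ a) = 0) :
    D = 0 := by
  refine derivation_eq_zero _ h D hmul fun t => ?_
  induction t with
  | zero => simp
  | add x y hx hy => rw [map_add, map_add, hx, hy, add_zero]
  | tmul b a =>
    change D (Algebra.TensorProduct.productMap ψ φ (b ⊗ₜ a)) = 0
    rw [Algebra.TensorProduct.productMap_apply_tmul, hmul, hφ, hψ, smul_zero, smul_zero, add_zero]

end DerivationAlgebra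

/-! ### Étaleness of functions on a product of affine opens -/

section ProductDerivation
open TensorProduct

variable {k : Type u} [CommRing k] {X G : Scheme.{u}} (f : X ⟶ Spec (.of k)) (g : G ⟶ Spec (.of k))

/-- The structure map `k → Γ(X, U)` of a scheme over `Spec k`. -/
def structureMap (U : X.Opens) : k →+* Γ(X, U) :=
  ((Scheme.ΓSpecIso (.of k)).inv ≫ f.appLE ⊤ U le_top).hom

lemma specMap_structureMap {U : X.Opens} (hU : IsAffineOpen U) :
    Spec.map (CommRingCat.ofHom (structureMap f U)) = hU.fromSpec ≫ f := by
  have h := IsAffineOpen.SpecMap_appLE_fromSpec f (isAffineOpen_top (Spec (.of k))) hU le_top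
  rw [← h, structureMap, CommRingCat.ofHom_hom, Spec.map_comp]
  congr 1
  simp [IsAffineOpen.fromSpec_top]

lemma appLE_structureMap {X' : Scheme.{u}} (a : X' ⟶ X) (U : X.Opens) (W : X'.Opens)
    (h : W ≤ a ⁻¹ᵁ U) (x : k) :
    (a.appLE U W h).hom (structureMap f U x) = structureMap (a ≫ f) W x := by
  have := Scheme.Hom.appLE_comp_appLE a f ⊤ U W le_top h
  exact congr_arg (fun φ => φ.hom ((Scheme.ΓSpecIso (.of k)).inv.hom x)) this

variable {f g}

/-- On spectra, the map composed with the open immersion of the product of affine charts into `X ×_k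
G` is the inclusion of `W`. Cancelling the second open immersion shows that the first map is an open
immersion, hence étale. -/
lemma formallyEtale_productMap {W : (pullback f g).Opens} (hW : IsAffineOpen W)
    {A : X.Opens} (hA : IsAffineOpen A) {B : G.Opens} (hB : IsAffineOpen B)
    (hWA : W ≤ pullback.fst f g ⁻¹ᵁ A) (hWB : W ≤ pullback.snd f g ⁻¹ᵁ B)
    [Algebra k Γ(X, A)] [Algebra k Γ(G, B)] [Algebra k Γ(pullback f g, W)]
    (eA : algebraMap k Γ(X, A) = structureMap f A) (eB : algebraMap k Γ(G, B) = structureMap g B)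
    (φ : Γ(X, A) →ₐ[k] Γ(pullback f g, W)) (ψ : Γ(G, B) →ₐ[k] Γ(pullback f g, W))
    (hφ : φ.toRingHom = ((pullback.fst f g).appLE A W hWA).hom)
    (hψ : ψ.toRingHom = ((pullback.snd f g).appLE B W hWB).hom) :
    (Algebra.TensorProduct.productMap ψ φ).toRingHom.FormallyEtale := by
  let θ : CommRingCat.of (TensorProduct k Γ(G, B) Γ(X, A)) ⟶ Γ(pullback f g, W) :=
    CommRingCat.ofHom (Algebra.TensorProduct.productMap ψ φ).toRingHom
  have h1 : Spec.map (CommRingCat.ofHom (algebraMap k Γ(G, B))) ≫ 𝟙 _ = hB.fromSpec ≫ g := by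
    rw [Category.comp_id, eB, specMap_structureMap]
  have h2 : Spec.map (CommRingCat.ofHom (algebraMap k Γ(X, A))) ≫ 𝟙 _ = hA.fromSpec ≫ f := by
    rw [Category.comp_id, eA, specMap_structureMap]
  have key : Spec.map θ ≫ (pullbackSpecIso k Γ(G, B) Γ(X, A)).inv ≫
      pullback.map _ _ g f hB.fromSpec hA.fromSpec (𝟙 _) h1 h2 ≫ (pullbackSymmetry g f).hom =
      hW.fromSpec := by
    apply pullback.hom_ext
    · simp only [Category.assoc, pullbackSymmetry_hom_comp_fst, pullback.map, pullback.lift_snd,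
        pullbackSpecIso_inv_snd_assoc]
      rw [← Spec.map_comp_assoc,
        ← IsAffineOpen.SpecMap_appLE_fromSpec (pullback.fst f g) hA hW hWA]
      congr 2
      ext x
      refine Eq.trans ?_ (congr_arg (fun m => m x) hφ)
      change Algebra.TensorProduct.productMap ψ φ (1 ⊗ₜ x) = φ x
      simp
    · simp only [Category.assoc, pullbackSymmetry_hom_comp_snd, pullback.map, pullback.lift_fst,
        pullbackSpecIso_inv_fst_assoc]
      rw [← Spec.map_comp_assoc,
        ← IsAffineOpen.SpecMap_appLE_fromSpec (pullback.snd f g) hB hW hWB]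
      congr 2
      ext x
      refine Eq.trans ?_ (congr_arg (fun m => m x) hψ)
      change Algebra.TensorProduct.productMap ψ φ (x ⊗ₜ 1) = ψ x
      simp
  have : IsOpenImmersion (Spec.map θ ≫ (pullbackSpecIso k Γ(G, B) Γ(X, A)).inv ≫
      pullback.map _ _ g f hB.fromSpec hA.fromSpec (𝟙 _) h1 h2 ≫ (pullbackSymmetry g f).hom) := by
    rw [key]; infer_instance
  have : IsOpenImmersion (Spec.map θ) := IsOpenImmersion.of_comp (Spec.map θ)
    ((pullbackSpecIso k Γ(G, B) Γ(X, A)).inv ≫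
      pullback.map _ _ g f hB.fromSpec hA.fromSpec (𝟙 _) h1 h2 ≫ (pullbackSymmetry g f).hom)
  have h3 : Etale (Spec.map θ) := inferInstance
  rw [HasRingHomProperty.Spec_iff (P := @Etale)] at h3
  exact h3.formallyEtale
end ProductDerivation

/-! ### Restriction of sections and locality of equations -/

section Locality

variable {X : Scheme.{u}}

/-- Restriction of sections of a sheaf of modules. -/
def resM (M : X.Modules) {U V : X.Opens} (h : U ≤ V) : Γ(M, V) →+ Γ(M, U) :=
  (M.presheaf.map (homOfLE h).op).hom

/-- Restriction of functions. -/
def resO {U V : X.Opens} (h : U ≤ V) : Γ(X, V) →+* Γ(X, U) :=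
  (X.presheaf.map (homOfLE h).op).hom

lemma resM_resM (M : X.Modules) {U V W : X.Opens} (h : U ≤ V) (h' : V ≤ W) (s : Γ(M, W)) :
    resM M h (resM M h' s) = resM M (h.trans h') s :=
  (congr_arg (fun φ => φ.hom s) (M.presheaf.map_comp (homOfLE h').op (homOfLE h).op)).symm

lemma resM_self (M : X.Modules) {U : X.Opens} (h : U ≤ U) (s : Γ(M, U)) : resM M h s = s :=
  congr_arg (fun φ => φ.hom s) (M.presheaf.map_id (.op U))

lemma resO_self {U : X.Opens} (h : U ≤ U) (s : Γ(X, U)) : resO h s = s :=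
  congr_arg (fun φ => φ.hom s) (X.presheaf.map_id (.op U))

lemma resM_smul (M : X.Modules) {U V : X.Opens} (h : U ≤ V) (a : Γ(X, V)) (s : Γ(M, V)) :
    resM M h (a • s) = resO h a • resM M h s :=
  Scheme.Modules.map_smul M (homOfLE h) a s

lemma app_resM {M N : X.Modules} (φ : M ⟶ N) {U V : X.Opens} (h : U ≤ V) (s : Γ(M, V)) :
    φ.app U (resM M h s) = resM N h (φ.app V s) :=
  congr_arg (fun φ => φ.hom s) (φ.mapPresheaf.naturality (homOfLE h).op)

lemma resM_eq_of_locally (M : X.Modules) {U : X.Opens} {s t : Γ(M, U)}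
    (H : ∀ x ∈ U, ∃ (V : X.Opens) (h : V ≤ U), x ∈ V ∧ resM M h s = resM M h t) : s = t := by
  choose V h hx e using fun x : U => H x.1 x.2
  exact TopCat.Sheaf.eq_of_locally_eq' (C := Ab) ⟨M.presheaf, M.isSheaf⟩ V U
    (fun x => homOfLE (h x)) (fun x hxU => TopologicalSpace.Opens.mem_iSup.mpr ⟨⟨x, hxU⟩, hx _⟩)
    s t e

lemma appLE_resO {X' : Scheme.{u}} (a : X' ⟶ X) {U V : X.Opens} {W T : X'.Opens} (hUV : U ≤ V)
    (hWT : W ≤ T) (hT : T ≤ a ⁻¹ᵁ V) (hW : W ≤ a ⁻¹ᵁ U) (s : Γ(X, V)) :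
    resO hWT ((a.appLE V T hT).hom s) = (a.appLE U W hW).hom (resO hUV s) := by
  have h1 := congr_arg (fun φ => φ.hom s) (Scheme.Hom.appLE_map a hT (homOfLE hWT).op)
  have h2 := congr_arg (fun φ => φ.hom s) (Scheme.Hom.map_appLE a hW (homOfLE hUV).op)
  exact h1.trans h2.symm

lemma SheafDerivation.d_resO {S : Scheme.{u}} {f : X ⟶ S} {M : X.Modules}
    (D : SheafDerivation f M) {U V : X.Opens} (h : U ≤ V) (s : Γ(X, V)) :
    D.d U (resO h s) = resM M h (D.d V s) := D.d_map (homOfLE h) s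

end Locality

/-! ### Unique extension of derivations from `X` to `X ×_k G` -/

section ProductDerivation

open TensorProduct

variable {k : Type u} [CommRing k] {X G : Scheme.{u}} {f : X ⟶ Spec (.of k)} {g : G ⟶ Spec (.of k)}

lemma structureMap_mem_constants (U : X.Opens) (x : k) : structureMap f U x ∈ constants f U :=
  ⟨⊤, le_top, (Scheme.ΓSpecIso (.of k)).inv.hom x, rfl⟩

/-- An affine open of `X ×_k G` contained in a product of affine opens. -/
structure IsProductSmall (W : (pullback f g).Opens) (A : X.Opens) (B : G.Opens) : Prop where
  affine : IsAffineOpen W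
  affine_left : IsAffineOpen A
  affine_right : IsAffineOpen B
  le_left : W ≤ pullback.fst f g ⁻¹ᵁ A
  le_right : W ≤ pullback.snd f g ⁻¹ᵁ B

/-- Products of opens do not form a basis of a fibre product of schemes, so a small affine open is
chosen inside such a product instead. The freedom in `U` and `V` is used when extensions are
compared. -/
lemma exists_isProductSmall {W : (pullback f g).Opens} {w : ↥(pullback f g)} (hw : w ∈ W)
    {U : X.Opens} {V : G.Opens} (hU : W ≤ pullback.fst f g ⁻¹ᵁ U)
    (hV : W ≤ pullback.snd f g ⁻¹ᵁ V) :
    ∃ (W' : (pullback f g).Opens) (A : X.Opens) (B : G.Opens), IsProductSmall W' A B ∧ w ∈ W' ∧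
      W' ≤ W ∧ A ≤ U ∧ B ≤ V := by
  obtain ⟨A, hA, hxA, hAU⟩ := exists_isAffineOpen_mem_and_subset (U := U) (x := pullback.fst f g w) (hU hw)
  obtain ⟨B, hB, hxB, hBV⟩ := exists_isAffineOpen_mem_and_subset (U := V) (x := pullback.snd f g w) (hV hw)
  obtain ⟨W', hW', hwW', h⟩ := exists_isAffineOpen_mem_and_subset (X := pullback f g)
    (U := W ⊓ pullback.fst f g ⁻¹ᵁ A ⊓ pullback.snd f g ⁻¹ᵁ B) (x := w) ⟨⟨hw, hxA⟩, hxB⟩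
  exact ⟨W', A, B, ⟨hW', hA, hB, fun x hx => (h hx).1.2, fun x hx => (h hx).2⟩, hwW',
    fun x hx => (h hx).1.1, hAU, hBV⟩

lemma structureMap_comp_eq {W : (pullback f g).Opens} {A : X.Opens} {B : G.Opens}
    (h : IsProductSmall W A B) (x : k) :
    ((pullback.snd f g).appLE B W h.le_right).hom (structureMap g B x) =
      structureMap (pullback.fst f g ≫ f) W x := by
  rw [appLE_structureMap]
  simp only [pullback.condition]

lemma formallyUnramified_of_formallyEtale {R S : Type*} [CommRing R] [CommRing S] {φ : R →+* S}
    (h : φ.FormallyEtale) : φ.FormallyUnramified := by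
  let := φ.toAlgebra
  have : Algebra.FormallyEtale R S := h
  exact inferInstanceAs (Algebra.FormallyUnramified R S)

/-- Values are allowed over a smaller open `T`, so that the lemma applies to differences of
restrictions of derivations. -/
lemma product_derivation_eq_zero {W T : (pullback f g).Opens} {A : X.Opens} {B : G.Opens}
    (h : IsProductSmall W A B) (hT : T ≤ W) {N : (pullback f g).Modules}
    (E : Γ(pullback f g, W) →+ Γ(N, T))
    (leib : ∀ x y, E (x * y) = resO hT x • E y + resO hT y • E x)
    (hA : ∀ s, E (((pullback.fst f g).appLE A W h.le_left).hom s) = 0)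
    (hB : ∀ s, E (((pullback.snd f g).appLE B W h.le_right).hom s) = 0) : E = 0 := by
  let : Algebra k Γ(X, A) := (structureMap f A).toAlgebra
  let : Algebra k Γ(G, B) := (structureMap g B).toAlgebra
  let : Algebra k Γ(pullback f g, W) := (structureMap (pullback.fst f g ≫ f) W).toAlgebra
  let φ : Γ(X, A) →ₐ[k] Γ(pullback f g, W) :=
    { ((pullback.fst f g).appLE A W h.le_left).hom with
      commutes' := fun x => appLE_structureMap f (pullback.fst f g) A W h.le_left x }
  let ψ : Γ(G, B) →ₐ[k] Γ(pullback f g, W) :=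
    { ((pullback.snd f g).appLE B W h.le_right).hom with
      commutes' := fun x => structureMap_comp_eq h x }
  have et := formallyEtale_productMap h.affine h.affine_left h.affine_right h.le_left h.le_right
    rfl rfl φ ψ rfl rfl
  let : Module Γ(pullback f g, W) Γ(N, T) := Module.compHom _ (resO hT)
  exact derivation_eq_zero_of_productMap φ ψ (formallyUnramified_of_formallyEtale et) E leib hA hB

lemma exists_product_derivation {W : (pullback f g).Opens} {A : X.Opens} {B : G.Opens}
    (h : IsProductSmall W A B) {N : (pullback f g).Modules}
    (D : SheafDerivation f ((Scheme.Modules.pushforward (pullback.fst f g)).obj N)) :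
    ∃ E : Γ(pullback f g, W) →+ Γ(N, W), (∀ x y, E (x * y) = x • E y + y • E x) ∧
      (∀ s, E (((pullback.snd f g).appLE B W h.le_right).hom s) = 0) ∧
      ∀ s, E (((pullback.fst f g).appLE A W h.le_left).hom s) = resM N h.le_left (D.d A s) := by
  let : Algebra k Γ(X, A) := (structureMap f A).toAlgebra
  let : Algebra k Γ(G, B) := (structureMap g B).toAlgebra
  let : Algebra k Γ(pullback f g, W) := (structureMap (pullback.fst f g ≫ f) W).toAlgebra
  let φ : Γ(X, A) →ₐ[k] Γ(pullback f g, W) :=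
    { ((pullback.fst f g).appLE A W h.le_left).hom with
      commutes' := fun x => appLE_structureMap f (pullback.fst f g) A W h.le_left x }
  let ψ : Γ(G, B) →ₐ[k] Γ(pullback f g, W) :=
    { ((pullback.snd f g).appLE B W h.le_right).hom with
      commutes' := fun x => structureMap_comp_eq h x }
  have et := formallyEtale_productMap h.affine h.affine_left h.affine_right h.le_left h.le_right
    rfl rfl φ ψ rfl rfl
  refine exists_derivation_extension φ ψ et ((resM N h.le_left).comp (D.d A)) ?_ ?_
  · intro a b
    refine (congr_arg (resM N h.le_left) (D.d_mul A a b)).trans ?_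
    refine (map_add _ _ _).trans ?_
    congr 1
    · exact resM_smul N h.le_left (((pullback.fst f g).app A).hom a) (D.d A b)
    · exact resM_smul N h.le_left (((pullback.fst f g).app A).hom b) (D.d A a)
  · intro x
    refine (congr_arg (resM N h.le_left) (D.d_app (structureMap_mem_constants A x))).trans ?_
    exact map_zero _

/-- An extension to `W` of a derivation along the first projection. -/
structure IsExtension {N : (pullback f g).Modules}
    (D : SheafDerivation f ((Scheme.Modules.pushforward (pullback.fst f g)).obj N))
    (W : (pullback f g).Opens) (E : Γ(pullback f g, W) →+ Γ(N, W)) : Prop where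
  leibniz : ∀ x y, E (x * y) = x • E y + y • E x
  extends_left : ∀ (U : X.Opens) (h : W ≤ pullback.fst f g ⁻¹ᵁ U) (s : Γ(X, U)),
    E (((pullback.fst f g).appLE U W h).hom s) = resM N h (D.d U s)
  constants_eq_zero : ∀ c ∈ constants (pullback.snd f g) W, E c = 0

/-- The difference of the two sides is a derivation from functions on `W` to sections over `W'` that
kills everything coming from `A` and from `B`. -/
lemma IsExtension.resM_eq {N : (pullback f g).Modules}
    {D : SheafDerivation f ((Scheme.Modules.pushforward (pullback.fst f g)).obj N)}
    {W W' : (pullback f g).Opens} {E : Γ(pullback f g, W) →+ Γ(N, W)}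
    {E' : Γ(pullback f g, W') →+ Γ(N, W')} {A : X.Opens} {B : G.Opens}
    (h : IsProductSmall W A B) (hE : ∀ x y, E (x * y) = x • E y + y • E x)
    (hE' : ∀ x y, E' (x * y) = x • E' y + y • E' x) (hW : W' ≤ W)
    (hA : ∀ s, E (((pullback.fst f g).appLE A W h.le_left).hom s) = resM N h.le_left (D.d A s))
    (hA' : ∀ s, E' (((pullback.fst f g).appLE A W' (hW.trans h.le_left)).hom s) =
      resM N (hW.trans h.le_left) (D.d A s))
    (hB : ∀ s, E (((pullback.snd f g).appLE B W h.le_right).hom s) = 0)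
    (hB' : ∀ s, E' (((pullback.snd f g).appLE B W' (hW.trans h.le_right)).hom s) = 0)
    (x : Γ(pullback f g, W)) : resM N hW (E x) = E' (resO hW x) := by
  have := product_derivation_eq_zero h hW
    ((resM N hW).comp E - E'.comp (resO hW).toAddMonoidHom) ?_ ?_ ?_
  · exact sub_eq_zero.mp (congr_arg (fun φ : Γ(pullback f g, W) →+ Γ(N, W') => φ x) this)
  · intro x y
    change resM N hW (E (x * y)) - E' (resO hW (x * y)) =
      resO hW x • (resM N hW (E y) - E' (resO hW y)) +
      resO hW y • (resM N hW (E x) - E' (resO hW x))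
    rw [hE, map_mul, hE', map_add, resM_smul, resM_smul, smul_sub, smul_sub]
    abel
  · intro s
    change resM N hW (E _) - E' (resO hW _) = 0
    rw [hA, appLE_resO (pullback.fst f g) le_rfl hW h.le_left (hW.trans h.le_left), resO_self, hA']
    exact sub_eq_zero.mpr (resM_resM N _ _ _)
  · intro s
    change resM N hW (E _) - E' (resO hW _) = 0
    rw [hB, appLE_resO (pullback.snd f g) le_rfl hW h.le_right (hW.trans h.le_right), resO_self,
      hB', map_zero, sub_self]

/-- The algebraic extension is prescribed only on functions from the chosen `A` and `B`. Its values
on functions from other opens of `X` or `G` are computed locally, on smaller products contained in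
both. -/
lemma exists_isExtension {W : (pullback f g).Opens} {A : X.Opens} {B : G.Opens}
    (h : IsProductSmall W A B) {N : (pullback f g).Modules}
    (D : SheafDerivation f ((Scheme.Modules.pushforward (pullback.fst f g)).obj N)) :
    ∃ E, IsExtension D W E := by
  obtain ⟨E, hE, hB, hA⟩ := exists_product_derivation h D
  -- By uniqueness, `E` restricts to the extension constructed from any smaller product.
  have key : ∀ {W' : (pullback f g).Opens} {A' : X.Opens} {B' : G.Opens}
      (h' : IsProductSmall W' A' B') (hW : W' ≤ W) (_ : A' ≤ A) (_ : B' ≤ B),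
      ∃ E' : Γ(pullback f g, W') →+ Γ(N, W'), (∀ x, resM N hW (E x) = E' (resO hW x)) ∧
      (∀ s, E' (((pullback.snd f g).appLE B' W' h'.le_right).hom s) = 0) ∧
      ∀ s, E' (((pullback.fst f g).appLE A' W' h'.le_left).hom s) = resM N h'.le_left (D.d A' s) := by
    intro W' A' B' h' hW hAA hBB
    obtain ⟨E', hE', hB', hA'⟩ := exists_product_derivation h' D
    refine ⟨E', fun x => ?_, hB', hA'⟩
    refine IsExtension.resM_eq (D := D) h hE hE' hW hA ?_ hB ?_ x
    · intro s
      have := appLE_resO (pullback.fst f g) hAA le_rfl (hW.trans h.le_left) h'.le_left s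
      rw [resO_self] at this
      rw [this, hA']
      have e := D.d_resO hAA s
      rw [e]
      exact resM_resM N _ _ _
    · intro s
      have := appLE_resO (pullback.snd f g) hBB le_rfl (hW.trans h.le_right) h'.le_right s
      rw [resO_self] at this
      rw [this, hB']
  refine ⟨E, hE, ?_, ?_⟩
  · intro U hU s
    apply resM_eq_of_locally
    intro w hw
    obtain ⟨W', A', B', h', hw', hWW, hA', hB'⟩ := exists_isProductSmall (f := f) (g := g) hw
      (U := A ⊓ U) (V := B) (le_inf h.le_left hU) h.le_right
    obtain ⟨E', e1, -, e2⟩ := key h' hWW (hA'.trans inf_le_left) hB'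
    refine ⟨W', hWW, hw', ?_⟩
    rw [e1, appLE_resO (pullback.fst f g) (hA'.trans inf_le_right) hWW hU h'.le_left, e2,
      D.d_resO]
    exact (resM_resM N _ _ _).trans (resM_resM N _ _ _).symm
  · rintro _ ⟨V, hV, t, rfl⟩
    apply resM_eq_of_locally
    intro w hw
    obtain ⟨W', A', B', h', hw', hWW, hA', hB'⟩ := exists_isProductSmall (f := f) (g := g) hw
      (U := A) (V := B ⊓ V) h.le_left (le_inf h.le_right hV)
    obtain ⟨E', e1, e2, -⟩ := key h' hWW hA' (hB'.trans inf_le_left)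
    refine ⟨W', hWW, hw', ?_⟩
    rw [e1, appLE_resO (pullback.snd f g) (hB'.trans inf_le_right) hWW hV h'.le_right, e2, map_zero]

variable (f g) in
/-- The basis of small affine opens of `X ×_k G`. -/
abbrev SmallOpens : Type u := {W : (pullback f g).Opens // ∃ A B, IsProductSmall (f := f) (g := g) W A B}

lemma isBasis_smallOpens :
    TopologicalSpace.Opens.IsBasis (Set.range (fun W : SmallOpens f g => W.1)) := by
  rw [TopologicalSpace.Opens.isBasis_iff_nbhd]
  intro U x hx
  obtain ⟨W', A, B, h, hw, hWU, -, -⟩ := exists_isProductSmall (f := f) (g := g) hx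
    (U := ⊤) (V := ⊤) le_top le_top
  exact ⟨W', ⟨⟨W', A, B, h⟩, rfl⟩, hw, hWU⟩

/-- The extensions on small opens are compatible by uniqueness, so they form a morphism of
presheaves on a basis, which extends to all opens because `N` is a sheaf. The Leibniz rule and the
vanishing on constants are then local checks on the basis. -/
lemma exists_sheafDerivation_extension {N : (pullback f g).Modules}
    (D : SheafDerivation f ((Scheme.Modules.pushforward (pullback.fst f g)).obj N)) :
    ∃ D' : SheafDerivation (pullback.snd f g) N, D'.push pullback.condition = D := by
  choose E hE using fun W : SmallOpens f g => exists_isExtension W.2.choose_spec.choose_spec D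
  have compat : ∀ (W W' : SmallOpens f g) (h : W'.1 ≤ W.1) (x), resM N h (E W x) = E W' (resO h x) := by
    intro W W' h x
    obtain ⟨A, B, hW⟩ := W.2
    exact IsExtension.resM_eq (D := D) hW (hE W).leibniz (hE W').leibniz h
      ((hE W).extends_left A _) ((hE W').extends_left A _)
      (fun s => (hE W).constants_eq_zero _ ⟨B, hW.le_right, s, rfl⟩)
      (fun s => (hE W').constants_eq_zero _ ⟨B, h.trans hW.le_right, s, rfl⟩) x
  let F : TopCat.Presheaf Ab (pullback f g).toTopCat := (structureModule (pullback f g)).presheaf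
  let F' : TopCat.Sheaf Ab (pullback f g).toTopCat := ⟨N.presheaf, N.isSheaf⟩
  let α : (inducedFunctor (fun W : SmallOpens f g => W.1)).op ⋙ F ⟶
      (inducedFunctor (fun W : SmallOpens f g => W.1)).op ⋙ F'.1 :=
    { app := fun W => AddCommGrpCat.ofHom (E W.unop)
      naturality := by
        intro W W' i
        ext x
        exact (compat W.unop W'.unop (leOfHom i.unop.hom) x).symm }
  let β : F ⟶ F'.1 := TopCat.Sheaf.restrictHomEquivHom F F' isBasis_smallOpens α
  obtain ⟨d, hβ, hmap⟩ : ∃ d : ∀ U : (pullback f g).Opens, Γ(pullback f g, U) →+ Γ(N, U),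
      (∀ (U : (pullback f g).Opens) (W : SmallOpens f g) (h : W.1 ≤ U) (x : Γ(pullback f g, U)),
        resM N h (d U x) = E W (resO h x)) ∧
      ∀ {U V : (pullback f g).Opens} (i : V ⟶ U) (a : Γ(pullback f g, U)),
        d V (((pullback f g).presheaf.map i.op).hom a) = (N.presheaf.map i.op).hom (d U a) := by
    refine ⟨fun U => (β.app (.op U)).hom, fun U W h x => ?_, fun i a =>
      congr_arg (fun φ => φ.hom a) (β.naturality i.op)⟩
    have h1 := congr_arg (fun φ => φ.hom x) (β.naturality (homOfLE h).op)
    have h2 := TopCat.Sheaf.extend_hom_app F F' isBasis_smallOpens α W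
    have h3 := congr_arg (fun φ => φ.hom (resO h x)) h2
    exact h1.symm.trans h3
  have loc : ∀ {U : (pullback f g).Opens} {s t : Γ(N, U)},
      (∀ (W : SmallOpens f g) (h : W.1 ≤ U), resM N h s = resM N h t) → s = t := by
    intro U s t H
    apply resM_eq_of_locally
    intro w hw
    obtain ⟨W', A, B, h, hw, hWU, -, -⟩ := exists_isProductSmall (f := f) (g := g) hw
      (U := ⊤) (V := ⊤) le_top le_top
    exact ⟨W', hWU, hw, H ⟨W', A, B, h⟩ hWU⟩
  refine ⟨⟨d, ?_, hmap, ?_⟩, ?_⟩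
  · intro U a b
    apply loc
    intro W h
    rw [hβ, map_add, resM_smul, resM_smul, hβ, hβ, map_mul, (hE W).leibniz]
  · intro U a ha
    apply loc
    intro W h
    rw [hβ, map_zero]
    exact (hE W).constants_eq_zero _ (constants_map _ (homOfLE h) ha)
  · apply SheafDerivation.ext'
    intro U s
    apply loc
    intro W h
    refine (hβ _ W h _).trans ?_
    refine Eq.trans ?_ ((hE W).extends_left U h s)
    congr 1

lemma sheafDerivation_eq_of_push_eq {N : (pullback f g).Modules}
    {D D' : SheafDerivation (pullback.snd f g) N}
    (H : D.push (pullback.condition (f := f) (g := g)) = D'.push pullback.condition) : D = D' := by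
  apply SheafDerivation.ext'
  intro U s
  apply resM_eq_of_locally
  intro w hw
  obtain ⟨W, A, B, h, hw, hWU, -, -⟩ := exists_isProductSmall (f := f) (g := g) hw
    (U := ⊤) (V := ⊤) le_top le_top
  refine ⟨W, hWU, hw, ?_⟩
  rw [← D.d_resO, ← D'.d_resO]
  have := product_derivation_eq_zero h le_rfl (D.d W - D'.d W) ?_ ?_ ?_
  · exact sub_eq_zero.mp (congr_arg (fun φ : Γ(pullback f g, W) →+ Γ(N, W) => φ (resO hWU s)) this)
  · intro x y
    rw [resO_self, resO_self]
    change D.d W (x * y) - D'.d W (x * y) = x • (D.d W y - D'.d W y) + y • (D.d W x - D'.d W x)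
    rw [D.d_mul, D'.d_mul, smul_sub, smul_sub]
    abel
  · intro s
    change D.d W _ - D'.d W _ = 0
    have e : ∀ D : SheafDerivation (pullback.snd f g) N,
        D.d W (((pullback.fst f g).appLE A W h.le_left).hom s) =
          resM N h.le_left ((D.push pullback.condition).d A s) := by
      intro D
      exact D.d_resO h.le_left (((pullback.fst f g).app A).hom s)
    rw [e, e, H, sub_self]
  · intro s
    change D.d W _ - D'.d W _ = 0
    rw [D.d_app ⟨B, h.le_right, s, rfl⟩, D'.d_app ⟨B, h.le_right, s, rfl⟩, sub_self]

instance isIso_baseChange_pullback :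
    IsIso (Differentials.baseChange (pullback.condition (f := f) (g := g))) :=
  Differentials.isIso_baseChange _ (fun _ _ _ h => sheafDerivation_eq_of_push_eq h)
    fun _ D => exists_sheafDerivation_extension D

end ProductDerivation

/-! ### Transposing maps around a commutative square -/

section Transpose

/-- Transposing along two adjunctions in turn agrees with transposing along their composite, up to
the mate `β` of the comparison isomorphism; this is the compatibility of mates with units. -/
lemma homEquiv_conjugateEquiv_comp {C D E : Type*} [Category C] [Category D] [Category E]
    {L₁ : C ⥤ D} {R₁ : D ⥤ C} {L₂ : D ⥤ E} {R₂ : E ⥤ D} {L : C ⥤ E} {R : E ⥤ C}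
    (adj₁ : L₁ ⊣ R₁) (adj₂ : L₂ ⊣ R₂) (adj : L ⊣ R) (α : L₁ ⋙ L₂ ≅ L) (β : R₂ ⋙ R₁ ⟶ R)
    (h : conjugateEquiv (adj₁.comp adj₂) adj α.inv = β) {M : C} {N : E} (κ : L.obj M ⟶ N) :
    adj₁.homEquiv _ _ (adj₂.homEquiv _ _ (α.hom.app M ≫ κ)) ≫ β.app N = adj.homEquiv _ _ κ := by
  have h1 := unit_conjugateEquiv (adj₁.comp adj₂) adj α.inv M
  rw [h] at h1
  have e : adj₁.homEquiv _ _ (adj₂.homEquiv _ _ (α.hom.app M ≫ κ)) =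
      (adj₁.comp adj₂).unit.app M ≫ (R₂ ⋙ R₁).map (α.hom.app M ≫ κ) := by
    refine Eq.trans ?_ ((adj₁.comp adj₂).homEquiv_unit M N (α.hom.app M ≫ κ))
    rw [Adjunction.comp_homEquiv]
    rfl
  rw [e, Category.assoc, NatTrans.naturality, ← Category.assoc, h1, Category.assoc,
    ← Functor.map_comp, Adjunction.homEquiv_unit, Iso.inv_hom_id_app_assoc]

/-- The identification of the two composites around a commutative square of functors. -/
def compSquareIso {C C₁ C₂ C₃ C₄ : Type*} [Category C] [Category C₁] [Category C₂]
    [Category C₃] [Category C₄] {F₁ : C ⥤ C₁} {F₂ : C₁ ⥤ C₂} (F₃ : C₂ ⥤ C₃) {F : C ⥤ C₂}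
    {G G' : C ⥤ C₃} {F₄ : C ⥤ C₄} {F₅ : C₄ ⥤ C₃} (a : F₁ ⋙ F₂ ≅ F) (b : F ⋙ F₃ ≅ G) (c : G ≅ G')
    (d : F₄ ⋙ F₅ ≅ G') (M : C) : F₃.obj (F₂.obj (F₁.obj M)) ≅ F₅.obj (F₄.obj M) :=
  F₃.mapIso (a.app M) ≪≫ b.app M ≪≫ c.app M ≪≫ (d.app M).symm

lemma compSquareIso_hom_comp {C C₁ C₂ C₃ C₄ : Type*} [Category C] [Category C₁] [Category C₂]
    [Category C₃] [Category C₄] {F₁ : C ⥤ C₁} {F₂ : C₁ ⥤ C₂} (F₃ : C₂ ⥤ C₃) {F : C ⥤ C₂}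
    {G G' : C ⥤ C₃} {F₄ : C ⥤ C₄} {F₅ : C₄ ⥤ C₃} (a : F₁ ⋙ F₂ ≅ F) (b : F ⋙ F₃ ≅ G) (c : G ≅ G')
    (d : F₄ ⋙ F₅ ≅ G') (M : C) {N : C₃} (κ : F₅.obj (F₄.obj M) ⟶ N) :
    (compSquareIso F₃ a b c d M).hom ≫ κ =
      F₃.map (a.hom.app M) ≫ (b.hom.app M ≫ (c.hom.app M ≫ (d.inv.app M ≫ κ))) := by
  simp [compSquareIso]

/-- The previous lemma is used once for each of the three composites of functors, and `hc` handles
the passage between the two diagonals `G` and `G'`. -/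
lemma homEquiv_square {C C₁ C₂ C₃ C₄ : Type*} [Category C] [Category C₁] [Category C₂]
    [Category C₃] [Category C₄] {F₁ : C ⥤ C₁} {F₂ : C₁ ⥤ C₂} {F₃ : C₂ ⥤ C₃} {F : C ⥤ C₂}
    {G G' : C ⥤ C₃} {F₄ : C ⥤ C₄} {F₅ : C₄ ⥤ C₃} {R₁ : C₁ ⥤ C} {R₂ : C₂ ⥤ C₁} {R₃ : C₃ ⥤ C₂}
    {R : C₂ ⥤ C} {S S' : C₃ ⥤ C} {R₄ : C₄ ⥤ C} {R₅ : C₃ ⥤ C₄}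
    (adj₁ : F₁ ⊣ R₁) (adj₂ : F₂ ⊣ R₂) (adj₃ : F₃ ⊣ R₃) (adj₄ : F₄ ⊣ R₄) (adj₅ : F₅ ⊣ R₅)
    (adj : F ⊣ R) (adjG : G ⊣ S) (adjG' : G' ⊣ S')
    (a : F₁ ⋙ F₂ ≅ F) (b : F ⋙ F₃ ≅ G) (c : G ≅ G') (d : F₄ ⋙ F₅ ≅ G')
    (a' : R₂ ⋙ R₁ ⟶ R) (b' : R₃ ⋙ R ⟶ S) (c' : S' ⟶ S) (d' : R₅ ⋙ R₄ ⟶ S')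
    (ha : conjugateEquiv (adj₁.comp adj₂) adj a.inv = a')
    (hb : conjugateEquiv (adj.comp adj₃) adjG b.inv = b')
    (hd : conjugateEquiv (adj₄.comp adj₅) adjG' d.inv = d') {M : C} {N : C₃}
    (hc : ∀ κ : G'.obj M ⟶ N,
      adjG.homEquiv _ _ (c.hom.app M ≫ κ) = adjG'.homEquiv _ _ κ ≫ c'.app N)
    (κ : F₅.obj (F₄.obj M) ⟶ N) :
    adj₁.homEquiv _ _ (adj₂.homEquiv _ _ (adj₃.homEquiv _ _
      ((compSquareIso F₃ a b c d M).hom ≫ κ))) ≫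
      a'.app (R₃.obj N) ≫ b'.app N =
    adj₄.homEquiv _ _ (adj₅.homEquiv _ _ κ) ≫ d'.app N ≫ c'.app N := by
  have h₁ := homEquiv_conjugateEquiv_comp adj₁ adj₂ adj a a' ha (adj₃.homEquiv _ _
    (b.hom.app M ≫ (c.hom.app M ≫ (d.inv.app M ≫ κ))))
  have h₂ := homEquiv_conjugateEquiv_comp adj adj₃ adjG b b' hb
    (c.hom.app M ≫ (d.inv.app M ≫ κ))
  have h₄ := homEquiv_conjugateEquiv_comp adj₄ adj₅ adjG' d d' hd (d.inv.app M ≫ κ)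
  rw [hc] at h₂
  have e₁ : d.hom.app M ≫ d.inv.app M ≫ κ = κ := d.hom_inv_id_app_assoc M κ
  rw [e₁] at h₄
  rw [compSquareIso_hom_comp, Adjunction.homEquiv_naturality_left]
  refine (Category.assoc _ _ _).symm.trans ?_
  refine (congr_arg (fun φ => φ ≫ b'.app N) h₁).trans (h₂.trans ?_)
  exact (congr_arg (fun φ => φ ≫ c'.app N) h₄).symm.trans (Category.assoc _ _ _)

variable {X Y Z : Scheme.{u}}

/-- The transpose of a map out of a pullback. -/
abbrev transpose (a : X ⟶ Y) {M : Y.Modules} {N : X.Modules}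
    (κ : (Scheme.Modules.pullback a).obj M ⟶ N) : M ⟶ (Scheme.Modules.pushforward a).obj N :=
  (Scheme.Modules.pullbackPushforwardAdjunction a).homEquiv _ _ κ

lemma transpose_pullbackCongr_hom {a b : X ⟶ Y} (h : a = b) {M : Y.Modules} {N : X.Modules}
    (κ : (Scheme.Modules.pullback b).obj M ⟶ N) :
    transpose a ((Scheme.Modules.pullbackCongr h).hom.app M ≫ κ) =
      transpose b κ ≫ (Scheme.Modules.pushforwardCongr h.symm).hom.app N := by
  subst h
  have e : (Scheme.Modules.pushforwardCongr (rfl : a = a)).hom.app N = 𝟙 _ := by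
    apply Scheme.Modules.hom_ext
    intro U
    exact N.presheaf.map_id _
  rw [e, Category.comp_id]
  exact congr_arg (transpose a) (Category.id_comp κ)

lemma transpose_map_comp (a : X ⟶ Y) {M M' : Y.Modules} {N : X.Modules} (h : M ⟶ M')
    (κ : (Scheme.Modules.pullback a).obj M' ⟶ N) :
    transpose a ((Scheme.Modules.pullback a).map h ≫ κ) = h ≫ transpose a κ :=
  Adjunction.homEquiv_naturality_left _ _ _

lemma transpose_comp (a : X ⟶ Y) {M : Y.Modules} {N N' : X.Modules}
    (κ : (Scheme.Modules.pullback a).obj M ⟶ N) (h : N ⟶ N') :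
    transpose a (κ ≫ h) = transpose a κ ≫ (Scheme.Modules.pushforward a).map h :=
  Adjunction.homEquiv_naturality_right _ _ _

lemma transpose_eq_zero_iff (a : X ⟶ Y) {M : Y.Modules} {N : X.Modules}
    (κ : (Scheme.Modules.pullback a).obj M ⟶ N) : transpose a κ = 0 ↔ κ = 0 := by
  have h0 : transpose a (0 : (Scheme.Modules.pullback a).obj M ⟶ N) = 0 := by
    have := transpose_comp a (0 : (Scheme.Modules.pullback a).obj M ⟶ N) (0 : N ⟶ N)
    rwa [comp_zero, Functor.map_zero, comp_zero] at this
  rw [← h0]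
  exact Equiv.apply_eq_iff_eq _

/-- The identification of the two pullbacks of a sheaf of modules around a commutative square. -/
def squareIso {X Y I H 𝒳 : Scheme.{u}} (pr : Y ⟶ X) (i : I ⟶ Y) (q : H ⟶ I)
    (p : H ⟶ 𝒳) (m : 𝒳 ⟶ X) (h : q ≫ i ≫ pr = p ≫ m) (M : X.Modules) :
    (Scheme.Modules.pullback q).obj
      ((Scheme.Modules.pullback i).obj ((Scheme.Modules.pullback pr).obj M)) ≅
    (Scheme.Modules.pullback p).obj ((Scheme.Modules.pullback m).obj M) :=
  compSquareIso (Scheme.Modules.pullback q) (Scheme.Modules.pullbackComp i pr)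
    (Scheme.Modules.pullbackComp q (i ≫ pr)) (Scheme.Modules.pullbackCongr h)
    (Scheme.Modules.pullbackComp p m) M

/-- After transposition the coherence isomorphism of pullbacks becomes the tautological one of
direct images, which on sections is just a restriction map. -/
lemma transpose_square_app {X Y I H 𝒳 : Scheme.{u}} (pr : Y ⟶ X) (i : I ⟶ Y) (q : H ⟶ I)
    (p : H ⟶ 𝒳) (m : 𝒳 ⟶ X) (h : q ≫ i ≫ pr = p ≫ m) {M : X.Modules} {N : H.Modules}
    (κ : (Scheme.Modules.pullback p).obj ((Scheme.Modules.pullback m).obj M) ⟶ N)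
    (U : X.Opens) (hU : q ⁻¹ᵁ (i ⁻¹ᵁ (pr ⁻¹ᵁ U)) ≤ p ⁻¹ᵁ (m ⁻¹ᵁ U)) (x : Γ(M, U)) :
    (transpose pr (transpose i (transpose q ((squareIso pr i q p m h M).hom ≫ κ)))).app U x =
      resM N hU ((transpose m (transpose p κ)).app U x) := by
  have e := homEquiv_square (Scheme.Modules.pullbackPushforwardAdjunction pr)
    (Scheme.Modules.pullbackPushforwardAdjunction i) (Scheme.Modules.pullbackPushforwardAdjunction q)
    (Scheme.Modules.pullbackPushforwardAdjunction m) (Scheme.Modules.pullbackPushforwardAdjunction p)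
    _ _ _ _ _ (Scheme.Modules.pullbackCongr h) _ _ _
    (Scheme.Modules.pushforwardCongr h.symm).hom _
    (Scheme.Modules.conjugateEquiv_pullbackComp_inv i pr)
    (Scheme.Modules.conjugateEquiv_pullbackComp_inv q (i ≫ pr))
    (Scheme.Modules.conjugateEquiv_pullbackComp_inv p m)
    (fun κ => transpose_pullbackCongr_hom h κ) κ
  exact congr_arg (fun φ => φ.app U x) e

/-- Transposing along `q` and then `i` turns a map out of the pulled-back conormal sheaf into a map
out of the ideal, and that map is the restriction of a derivation of `𝒪_Y`. -/
lemma conormalMap_comp_eq_zero_iff {S Y I H : Scheme.{u}} (g : Y ⟶ S) (i : I ⟶ Y) (q : H ⟶ I)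
    {P : Y.Modules} (h : Differentials g ⟶ P) {N : H.Modules}
    (κ : (Scheme.Modules.pullback q).obj ((Scheme.Modules.pullback i).obj P) ⟶ N) :
    (Scheme.Modules.pullback q).map (conormalMap i g ≫ (Scheme.Modules.pullback i).map h) ≫ κ = 0 ↔
      ∀ (W : Y.Opens) (s : Γ(idealModule i, W)),
        (SheafDerivation.ofHom (h ≫ transpose i (transpose q κ))).d W
          ((idealInclusion i).app W s) = 0 := by
  refine (transpose_eq_zero_iff q _).symm.trans ?_
  have e₁ : transpose q ((Scheme.Modules.pullback q).map
      (conormalMap i g ≫ (Scheme.Modules.pullback i).map h) ≫ κ) =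
      conormalMap i g ≫ ((Scheme.Modules.pullback i).map h ≫ transpose q κ) := by
    rw [transpose_map_comp, Category.assoc]
  refine (Eq.congr_left e₁).trans ?_
  refine (transpose_eq_zero_iff i _).symm.trans ?_
  have e₂ := (transpose_comp i (conormalMap i g)
    ((Scheme.Modules.pullback i).map h ≫ transpose q κ)).trans
    (congr_arg (fun φ => φ ≫ _) (Equiv.apply_symm_apply _ _))
  refine (Eq.congr_left e₂).trans ?_
  have key : ∀ (W : Y.Opens) (s : Γ(idealModule i, W)),
      (conormalAux i g ≫ (Scheme.Modules.pushforward i).map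
        ((Scheme.Modules.pullback i).map h ≫ transpose q κ)).app W s =
      (SheafDerivation.ofHom (h ≫ transpose i (transpose q κ))).d W
        ((idealInclusion i).app W s) := by
    intro W s
    have h := transpose_map_comp i h (transpose q κ)
    rw [transpose, Adjunction.homEquiv_unit] at h
    exact congr_arg (fun φ => φ.app W ((universalDerivation g).d W
      ((idealInclusion i).app W s))) h
  constructor
  · intro h W s
    exact (key W s).symm.trans (congr_arg (fun φ => φ.app W s) h)
  · intro h
    apply Scheme.Modules.hom_ext
    intro W
    ext s
    exact (key W s).trans (h W s)

lemma ofHom_inv_comp_d {X X' S S' : Scheme.{u}} {f : X ⟶ S} {a : X' ⟶ X} {g : X' ⟶ S'} {b : S' ⟶ S}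
    (sq : a ≫ f = g ≫ b) [IsIso (Differentials.baseChange sq)] {N : X'.Modules}
    (θ : (Scheme.Modules.pullback a).obj (Differentials f) ⟶ N) (U : X.Opens) (t : Γ(X, U)) :
    (SheafDerivation.ofHom (inv (Differentials.baseChange sq) ≫ θ)).d (a ⁻¹ᵁ U) ((a.app U).hom t) =
      (transpose a θ).app U ((universalDerivation f).d U t) := by
  refine (Differentials.baseChange_comp_homEquiv sq (inv (Differentials.baseChange sq) ≫ θ)
    U t).symm.trans ?_
  rw [IsIso.hom_inv_id_assoc]

lemma transpose_map_comp_app {X Y Z : Scheme.{u}} (p : X ⟶ Y) (m : Y ⟶ Z) {M : Z.Modules}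
    {E : Y.Modules} {N : X.Modules} (π : (Scheme.Modules.pullback m).obj M ⟶ E)
    (g : (Scheme.Modules.pullback p).obj E ⟶ N) (U : Z.Opens) (x : Γ(M, U)) :
    (transpose m (transpose p ((Scheme.Modules.pullback p).map π ≫ g))).app U x =
      (transpose p g).app (m ⁻¹ᵁ U) ((transpose m π).app U x) := by
  rw [transpose_map_comp, transpose_comp]
  rfl

section Square

variable {X Y I H 𝒳 S S' : Scheme.{u}} {f : X ⟶ S} {g : Y ⟶ S'} {b : S' ⟶ S}
  (pr : Y ⟶ X) (sq : pr ≫ f = g ≫ b) [IsIso (Differentials.baseChange sq)] (i : I ⟶ Y) (q : H ⟶ I)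
  (p : H ⟶ 𝒳) (m : 𝒳 ⟶ X) (h : q ≫ i ≫ pr = p ≫ m) {E : 𝒳.Modules} {N : H.Modules}
  (π : (Scheme.Modules.pullback m).obj (Differentials f) ⟶ E)
  (κ : (Scheme.Modules.pullback p).obj E ⟶ N)

/-- The derivation induced by a map out of the pullback of `E`. -/
def squareDerivation : SheafDerivation g ((Scheme.Modules.pushforward i).obj
      ((Scheme.Modules.pushforward q).obj N)) :=
  SheafDerivation.ofHom (inv (Differentials.baseChange sq) ≫ transpose i (transpose q
    ((squareIso pr i q p m h (Differentials f)).hom ≫ (Scheme.Modules.pullback p).map π ≫ κ)))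

/-- The map from the pullback of the conormal sheaf to the pullback of `E`. -/
def squareConormal : (Scheme.Modules.pullback q).obj (conormalSheaf i) ⟶
    (Scheme.Modules.pullback p).obj E :=
  (Scheme.Modules.pullback q).map (conormalMap i g ≫
      (Scheme.Modules.pullback i).map (inv (Differentials.baseChange sq))) ≫
    (squareIso pr i q p m h (Differentials f)).hom ≫ (Scheme.Modules.pullback p).map π

/-- On functions coming from `X`, the abstractly defined derivation is computed by differentiating
on `X`, mapping to `E` by `π` and then applying `κ`. -/
lemma squareDerivation_d (U : X.Opens) (hU : q ⁻¹ᵁ (i ⁻¹ᵁ (pr ⁻¹ᵁ U)) ≤ p ⁻¹ᵁ (m ⁻¹ᵁ U))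
    (t : Γ(X, U)) :
    (squareDerivation pr sq i q p m h π κ).d (pr ⁻¹ᵁ U) ((pr.app U).hom t) =
    resM N hU ((transpose p κ).app (m ⁻¹ᵁ U) ((SheafDerivation.ofHom (transpose m π)).d U t)) := by
  refine (ofHom_inv_comp_d sq _ U t).trans ?_
  refine (transpose_square_app pr i q p m h _ U hU _).trans ?_
  exact congr_arg (resM N hU) (transpose_map_comp_app p m π κ U _)

lemma squareConormal_comp_eq_zero_iff :
    squareConormal pr sq i q p m h π ≫ κ = 0 ↔
      ∀ (W : Y.Opens) (s : Γ(idealModule i, W)),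
        (squareDerivation pr sq i q p m h π κ).d W ((idealInclusion i).app W s) = 0 := by
  rw [squareConormal, Category.assoc, Category.assoc]
  exact conormalMap_comp_eq_zero_iff g i q _ _

end Square

end Transpose

/-! ### The map `φ` as an instance of the square construction -/

section ConormalToBundle

variable {k : Type u} [Field k] {n : ℕ} {X : Scheme.{u}} (f : X ⟶ ProjectiveSpace k n) (r : ℕ)

instance isIso_differentialsComparison : IsIso (differentialsComparison f r) :=
  isIso_baseChange_pullback

variable {𝒳 : Scheme.{u}} (m : 𝒳 ⟶ X)

lemma overField_condition :
    prX f r ≫ overField f = prG f r ≫ Grassmannian.str k (n + 1) r := pullback.condition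

lemma pullInc_condition :
    pullIncToInc f r m ≫ incι f r ≫ prX f r = pullIncToBase f r m ≫ m := pullback.condition

instance isIso_baseChange_overField : IsIso (Differentials.baseChange (overField_condition f r)) :=
  isIso_differentialsComparison f r

lemma pullbackIso_eq_squareIso (M : X.Modules) :
    pullbackIso f r m M = squareIso (prX f r) (incι f r) (pullIncToInc f r m) (pullIncToBase f r m) m
      (pullInc_condition f r m) M := rfl

lemma inv_differentialsComparison_eq : inv (differentialsComparison f r) =
    inv (Differentials.baseChange (overField_condition f r)) := rfl

/-- Replaces the fibre products by an arbitrary commutative square, in which nothing matters but the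
invertibility of the base change map of differentials. -/
lemma conormalToBundle_eq {ℰ : 𝒳.Modules}
    (π : (Scheme.Modules.pullback m).obj (Differentials (overField f)) ⟶ ℰ) :
    conormalToBundle f r m π =
      squareConormal (prX f r) (overField_condition f r) (incι f r) (pullIncToInc f r m)
        (pullIncToBase f r m) m (pullInc_condition f r m) π := by
  unfold conormalToBundle squareConormal
  rw [pullbackIso_eq_squareIso]
  exact congr_arg (fun a => (Scheme.Modules.pullback (pullIncToInc f r m)).map
    (conormalMap (incι f r) (prG f r) ≫ (Scheme.Modules.pullback (incι f r)).map a) ≫ _)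
    (inv_differentialsComparison_eq f r)

end ConormalToBundle

/-! ### Sections of the ideal sheaf -/

section IdealSections

variable {Y Z : Scheme.{u}}

/-- Taking sections over a fixed open set is left exact. -/
lemma exists_kernel_section {M N : Y.Modules} (φ : M ⟶ N) (U : Y.Opens) (s : Γ(M, U))
    (hs : φ.app U s = 0) : ∃ t : Γ(kernel φ, U), (kernel.ι φ).app U t = s := by
  let F : Y.Modules ⥤ Ab := Scheme.Modules.toPresheaf Y ⋙ (CategoryTheory.evaluation _ _).obj (.op U)
  have : F.Additive := { map_add := rfl }
  have : PreservesLimits ((CategoryTheory.evaluation Y.Opensᵒᵖ Ab.{u}).obj (.op U)) := inferInstance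
  have : PreservesLimits F := comp_preservesLimits _ _
  have h := (ShortComplex.exact_kernel φ).map_of_mono_of_preservesKernel F inferInstance inferInstance
  rw [ShortComplex.ab_exact_iff] at h
  exact h s hs

lemma exists_idealModule_section (i : Z ⟶ Y) (U : Y.Opens) (s : Γ(Y, U))
    (hs : (i.app U).hom s = 0) :
    ∃ t : Γ(idealModule i, U), (idealInclusion i).app U t = s :=
  exists_kernel_section (comorphism i) U s hs

end IdealSections

/-! ### Maps out of the pullback of a locally free sheaf -/

section HomOutOfLocallyFree

variable {V V₀ X H : Scheme.{u}}

/-- The basis sections of a module that is free along an open immersion. -/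
def trivBasis (j : V₀ ⟶ X) [IsOpenImmersion j] {E : X.Modules} {d : ℕ}
    (ψ : E.restrict j ≅ freeModule V₀ d) (l : Fin d) : Γ(E, j ''ᵁ ⊤) :=
  ψ.inv.app ⊤ (freeBasis V₀ d l)

/-- By adjunction a map from `E` to the direct image of `M` is a map from `E` restricted along `j`,
and that restriction is free. -/
lemma restrictHom_bijective (j : V₀ ⟶ X) [IsOpenImmersion j] {E : X.Modules} {d : ℕ}
    (ψ : E.restrict j ≅ freeModule V₀ d) (M : V₀.Modules) :
    Function.Bijective (fun (τ : E ⟶ (Scheme.Modules.pushforward j).obj M) (l : Fin d) =>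
      resM M (U := ⊤) (V := j ⁻¹ᵁ j ''ᵁ ⊤) (j.preimage_image_eq ⊤).ge
        (τ.app (j ''ᵁ ⊤) (trivBasis j ψ l))) := by
  refine (Function.Bijective.of_comp_iff _
    ((Scheme.Modules.restrictAdjunction j).homEquiv E M).bijective).mp ?_
  have key := (freeHom_bijective d M).comp (ψ.homFromEquiv (Z := M)).bijective
  convert key using 1
  funext α l
  have h1 : ((Scheme.Modules.restrictAdjunction j).homEquiv E M α).app (j ''ᵁ ⊤) (trivBasis j ψ l) =
      α.app (j ⁻¹ᵁ j ''ᵁ ⊤) (resM (E.restrict j) le_top (trivBasis j ψ l)) := by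
    rw [Adjunction.homEquiv_unit]
    rfl
  refine (congr_arg _ h1).trans ?_
  refine (congr_arg _ (app_resM α le_top _)).trans ?_
  refine (resM_resM M _ _ _).trans (resM_self M _ _)

/-- The values on a basis of the transpose of a map out of a pullback. -/
def basisValues (v : V ⟶ H) [IsOpenImmersion v] (p : H ⟶ X) (j : V₀ ⟶ X) [IsOpenImmersion j]
    (a : V ⟶ V₀) (h : v ≫ p = a ≫ j) {E : X.Modules} {d : ℕ} (ψ : E.restrict j ≅ freeModule V₀ d)
    {N : V.Modules}
    (κ : (Scheme.Modules.pullback p).obj E ⟶ (Scheme.Modules.pushforward v).obj N) (l : Fin d) :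
    Γ(N, ⊤) :=
  resM N (U := ⊤) (V := v ⁻¹ᵁ p ⁻¹ᵁ j ''ᵁ ⊤) (by
    rw [← Scheme.Hom.comp_preimage, h, Scheme.Hom.comp_preimage, j.preimage_image_eq]
    rfl) ((transpose p κ).app (j ''ᵁ ⊤) (trivBasis j ψ l))

/-- Since `v ≫ p = a ≫ j`, the target transposed to `X` is also a direct image along `j`, so that
`restrictHom_bijective` applies. -/
lemma basisValues_bijective (v : V ⟶ H) [IsOpenImmersion v] (p : H ⟶ X) (j : V₀ ⟶ X)
    [IsOpenImmersion j] (a : V ⟶ V₀) (h : v ≫ p = a ≫ j) {E : X.Modules} {d : ℕ}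
    (ψ : E.restrict j ≅ freeModule V₀ d) (N : V.Modules) :
    Function.Bijective (basisValues v p j a h ψ (N := N)) := by
  let e : (Scheme.Modules.pushforward p).obj ((Scheme.Modules.pushforward v).obj N) ≅
      (Scheme.Modules.pushforward j).obj ((Scheme.Modules.pushforward a).obj N) :=
    (Scheme.Modules.pushforwardComp v p).app N ≪≫ (Scheme.Modules.pushforwardCongr h).app N ≪≫
      ((Scheme.Modules.pushforwardComp a j).app N).symm
  have key := ((restrictHom_bijective j ψ ((Scheme.Modules.pushforward a).obj N)).comp
    (e.homToEquiv (Z := E)).bijective).comp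
    ((Scheme.Modules.pullbackPushforwardAdjunction p).homEquiv E _).bijective
  have key' : Function.Bijective (fun κ l =>
      (show Γ((Scheme.Modules.pushforward a).obj N, ⊤) from basisValues v p j a h ψ κ l)) := by
    convert key using 1
    funext κ l
    exact (resM_resM N _ _ _).symm
  exact key'

lemma basisValues_comp (v : V ⟶ H) [IsOpenImmersion v] (p : H ⟶ X) (j : V₀ ⟶ X)
    [IsOpenImmersion j] (a : V ⟶ V₀) (h : v ≫ p = a ≫ j) {E : X.Modules} {d : ℕ}
    (ψ : E.restrict j ≅ freeModule V₀ d) {N N' : V.Modules}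
    (κ : (Scheme.Modules.pullback p).obj E ⟶ (Scheme.Modules.pushforward v).obj N) (β : N ⟶ N')
    (l : Fin d) :
    basisValues v p j a h ψ (κ ≫ (Scheme.Modules.pushforward v).map β) l =
      β.app ⊤ (basisValues v p j a h ψ κ l) := by
  refine Eq.trans ?_ (app_resM β _ _).symm
  exact congr_arg (fun φ => resM N' _ (φ.app (j ''ᵁ ⊤) (trivBasis j ψ l)))
    (transpose_comp p κ ((Scheme.Modules.pushforward v).map β))

end HomOutOfLocallyFree

/-! ### Freeness of a cokernel cut out by rows of an invertible matrix -/

section Cokernel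

/-- The invertible matrix `C` identifies `M^d` with `M^r × M^s`; the kernel of the first component
is carried isomorphically onto the second factor. -/
lemma kernel_rows_bijective {R M : Type*} [CommRing R] [AddCommGroup M] [Module R M] {r s d : ℕ}
    (C : Matrix (Fin r ⊕ Fin s) (Fin d) R) (C' : Matrix (Fin d) (Fin r ⊕ Fin s) R)
    (h : C * C' = 1) (h' : C' * C = 1) :
    Function.Bijective (fun (g : {g : Fin d → M // ∀ a, ∑ i, C (.inl a) i • g i = 0}) (b : Fin s) =>
      ∑ i, C (.inr b) i • g.1 i) := by
  have key : ∀ g : Fin d → M, ∀ i, ∑ x, C' i x • ∑ l, C x l • g l = g i := by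
    intro g i
    simp_rw [Finset.smul_sum, smul_smul]
    rw [Finset.sum_comm]
    simp_rw [← Finset.sum_smul, ← Matrix.mul_apply, h', Matrix.one_apply, ite_smul, one_smul,
      zero_smul]
    simp
  have key' : ∀ y : Fin r ⊕ Fin s → M, ∀ x, ∑ i, C x i • ∑ z, C' i z • y z = y x := by
    intro y x
    simp_rw [Finset.smul_sum, smul_smul]
    rw [Finset.sum_comm]
    simp_rw [← Finset.sum_smul, ← Matrix.mul_apply, h, Matrix.one_apply, ite_smul, one_smul,
      zero_smul]
    simp
  constructor
  · rintro ⟨g, hg⟩ ⟨g', hg'⟩ e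
    apply Subtype.ext
    funext i
    change g i = g' i
    rw [← key g i, ← key g' i]
    refine Finset.sum_congr rfl fun x _ => ?_
    congr 1
    rcases x with a | b
    · rw [hg, hg']
    · exact congr_fun e b
  · intro y
    refine ⟨⟨fun i => ∑ z, C' i z • (Sum.elim 0 y : Fin r ⊕ Fin s → M) z, fun a => ?_⟩, ?_⟩
    · exact (key' _ _).trans rfl
    · funext b
      exact (key' _ _).trans rfl

variable {V V₀ X H : Scheme.{u}}

/-- A cokernel presented over an open subscheme by rows of an invertible matrix is free there. -/
lemma nonempty_cokernel_restrict_iso_free (v : V ⟶ H) [IsOpenImmersion v] (p : H ⟶ X) (j : V₀ ⟶ X)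
    [IsOpenImmersion j] (a : V ⟶ V₀) (h : v ≫ p = a ≫ j) {E : X.Modules} {r s d : ℕ}
    (ψ : E.restrict j ≅ freeModule V₀ d) {P : H.Modules}
    (φ : P ⟶ (Scheme.Modules.pullback p).obj E)
    (C : Matrix (Fin r ⊕ Fin s) (Fin d) Γ(V, ⊤)) (C' : Matrix (Fin d) (Fin r ⊕ Fin s) Γ(V, ⊤))
    (hC : C * C' = 1) (hC' : C' * C = 1)
    (hφ : ∀ (N : V.Modules)
      (κ : (Scheme.Modules.pullback p).obj E ⟶ (Scheme.Modules.pushforward v).obj N),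
      φ ≫ κ = 0 ↔ ∀ x, ∑ i, C (.inl x) i • basisValues v p j a h ψ κ i = 0) :
    Nonempty ((cokernel φ).restrict v ≅ freeModule V s) := by
  let adj := Scheme.Modules.restrictAdjunction v
  -- A map out of the restricted cokernel is a map `κ` killing the image of `φ`, hence a tuple
  -- solving the `r` equations of `hφ`. The lower rows of `C` provide `s` free coordinates on the
  -- solutions.
  refine nonempty_iso_free _ (fun N g b => ∑ i, C (.inr b) i •
    basisValues v p j a h ψ (cokernel.π φ ≫ adj.homEquiv _ _ g) i) (fun N => ?_) ?_
  · let F : ((cokernel φ).restrict v ⟶ N) →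
        {g : Fin d → Γ(N, ⊤) // ∀ x, ∑ i, C (.inl x) i • g i = 0} := fun g =>
      ⟨basisValues v p j a h ψ (cokernel.π φ ≫ adj.homEquiv _ _ g), by
        rw [← hφ, ← Category.assoc, cokernel.condition, zero_comp]⟩
    have hF : Function.Bijective F := by
      constructor
      · intro g g' e
        apply (adj.homEquiv _ _).injective
        rw [← cancel_epi (cokernel.π φ)]
        exact (basisValues_bijective v p j a h ψ N).1 (congr_arg Subtype.val e)
      · rintro ⟨y, hy⟩
        obtain ⟨κ, rfl⟩ := (basisValues_bijective v p j a h ψ N).2 y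
        refine ⟨(adj.homEquiv _ _).symm (cokernel.desc φ κ ((hφ N κ).mpr hy)), ?_⟩
        apply Subtype.ext
        change basisValues v p j a h ψ (cokernel.π φ ≫ adj.homEquiv _ _ _) = _
        rw [Equiv.apply_symm_apply, cokernel.π_desc]
    exact (kernel_rows_bijective C C' hC hC').comp hF
  · intro N N' g β b
    have e : ∀ i, basisValues v p j a h ψ (cokernel.π φ ≫ adj.homEquiv _ _ (g ≫ β)) i =
        β.app ⊤ (basisValues v p j a h ψ (cokernel.π φ ≫ adj.homEquiv _ _ g) i) := by
      intro i
      rw [Adjunction.homEquiv_naturality_right, ← Category.assoc]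
      exact basisValues_comp v p j a h ψ _ β i
    refine (Finset.sum_congr rfl fun i _ => congr_arg (C (.inr b) i • ·) (e i)).trans ?_
    rw [map_sum]
    exact Finset.sum_congr rfl fun i _ => (β.app_smul _ _).symm

end Cokernel

/-! ### Vanishing on the conormal sheaf as a system of linear equations -/

section LocalEquations

variable {X Y I H 𝒳 S S' V V₀ : Scheme.{u}} {f : X ⟶ S} {g : Y ⟶ S'} {b : S' ⟶ S}
  (pr : Y ⟶ X) (sq : pr ≫ f = g ≫ b) [IsIso (Differentials.baseChange sq)] (i : I ⟶ Y) (q : H ⟶ I)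
  (p : H ⟶ 𝒳) (m : 𝒳 ⟶ X) (h : q ≫ i ≫ pr = p ≫ m) {E : 𝒳.Modules}
  (π : (Scheme.Modules.pullback m).obj (Differentials f) ⟶ E)

/-- Restriction to `V` of a section of a twofold direct image. -/
def resTop₂ (v : V ⟶ H) (N : V.Modules) {W : 𝒳.Opens} (hV : ⊤ ≤ v ⁻¹ᵁ p ⁻¹ᵁ W) :
    Γ((Scheme.Modules.pushforward p).obj ((Scheme.Modules.pushforward v).obj N), W) →+ Γ(N, ⊤) :=
  resM N hV

/-- Restriction to `V` of a section of a threefold direct image. -/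
def resTop₃ (v : V ⟶ H) (N : V.Modules) {W : Y.Opens} (hV : ⊤ ≤ v ⁻¹ᵁ q ⁻¹ᵁ i ⁻¹ᵁ W) :
    Γ((Scheme.Modules.pushforward i).obj ((Scheme.Modules.pushforward q).obj
      ((Scheme.Modules.pushforward v).obj N)), W) →+ Γ(N, ⊤) :=
  resM N hV

lemma resTop₃_smul (v : V ⟶ H) (N : V.Modules) {W : Y.Opens} (hV : ⊤ ≤ v ⁻¹ᵁ q ⁻¹ᵁ i ⁻¹ᵁ W)
    (c : Γ(Y, W)) (y) :
    resTop₃ i q v N hV (c • y) = ((v ≫ q ≫ i).appLE W ⊤ hV).hom c • resTop₃ i q v N hV y := by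
  refine (resM_smul N hV ((v.app _).hom ((q.app _).hom ((i.app _).hom c))) y).trans ?_
  congr 1

lemma resTop₂_smul (v : V ⟶ H) (N : V.Modules) {W : 𝒳.Opens} (hV : ⊤ ≤ v ⁻¹ᵁ p ⁻¹ᵁ W)
    (c : Γ(𝒳, W)) (y) :
    resTop₂ p v N hV (c • y) = ((v ≫ p).appLE W ⊤ hV).hom c • resTop₂ p v N hV y := by
  refine (resM_smul N hV ((v.app _).hom ((p.app _).hom c)) y).trans ?_
  congr 1

lemma resTop₂_resM (v : V ⟶ H) (N : V.Modules) {W W' : 𝒳.Opens} (hV : ⊤ ≤ v ⁻¹ᵁ p ⁻¹ᵁ W)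
    (hW : W ≤ W') (y) :
    resTop₂ p v N hV (resM _ hW y) =
      resTop₂ p v N (hV.trans (v.preimage_mono (p.preimage_mono hW))) y :=
  resM_resM N _ _ _

lemma resTop₃_resM (v : V ⟶ H) (N : V.Modules) {W W' : Y.Opens}
    (hV : ⊤ ≤ v ⁻¹ᵁ q ⁻¹ᵁ i ⁻¹ᵁ W) (hW : W ≤ W') (y) :
    resTop₃ i q v N hV (resM _ hW y) =
      resTop₃ i q v N (hV.trans (v.preimage_mono (q.preimage_mono (i.preimage_mono hW)))) y :=
  resM_resM N _ _ _

variable (v : V ⟶ H) [IsOpenImmersion v] (j : V₀ ⟶ 𝒳) [IsOpenImmersion j] (a : V ⟶ V₀)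
  (hv : v ≫ p = a ≫ j) {r d n : ℕ} (ψ : E.restrict j ≅ freeModule V₀ d)

lemma top_le_preimage_image {V V₀ H 𝒳 : Scheme.{u}} (p : H ⟶ 𝒳) (v : V ⟶ H) (j : V₀ ⟶ 𝒳)
    [IsOpenImmersion j] (a : V ⟶ V₀) (hv : v ≫ p = a ≫ j) : ⊤ ≤ v ⁻¹ᵁ p ⁻¹ᵁ j ''ᵁ ⊤ := by
  rw [← Scheme.Hom.comp_preimage, hv, Scheme.Hom.comp_preimage, j.preimage_image_eq]
  rfl

lemma basisValues_eq {N : V.Modules}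
    (κ : (Scheme.Modules.pullback p).obj E ⟶ (Scheme.Modules.pushforward v).obj N) (l : Fin d) :
    basisValues v p j a hv ψ κ l = resTop₂ p v N (top_le_preimage_image p v j a hv)
      ((transpose p κ).app (j ''ᵁ ⊤) (trivBasis j ψ l)) := rfl

lemma resTop₂_transpose_app {N : V.Modules}
    (κ : (Scheme.Modules.pullback p).obj E ⟶ (Scheme.Modules.pushforward v).obj N) {U : 𝒳.Opens}
    (hU : j ''ᵁ ⊤ ≤ U) (hV : ⊤ ≤ v ⁻¹ᵁ p ⁻¹ᵁ U) (x : Γ(E, U)) (δ : Fin d → Γ(𝒳, j ''ᵁ ⊤))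
    (hδ : resM E hU x = ∑ l, δ l • trivBasis j ψ l) :
    resTop₂ p v N hV ((transpose p κ).app U x) =
      ∑ l, ((v ≫ p).appLE (j ''ᵁ ⊤) ⊤ (top_le_preimage_image p v j a hv)).hom (δ l) •
        basisValues v p j a hv ψ κ l := by
  rw [← resTop₂_resM p v N (top_le_preimage_image p v j a hv) hU, ← app_resM, hδ, map_sum, map_sum]
  refine Finset.sum_congr rfl fun l _ => ?_
  rw [Scheme.Modules.Hom.app_smul, resTop₂_smul, basisValues_eq]

lemma SheafDerivation.d_sum_mul_constants {M : Y.Modules} (D : SheafDerivation g M) {W : Y.Opens}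
    {ι : Type*} (s : Finset ι) (c x : ι → Γ(Y, W)) (hc : ∀ l, c l ∈ constants g W) :
    D.d W (∑ l ∈ s, c l * x l) = ∑ l ∈ s, c l • D.d W (x l) := by
  rw [map_sum]
  refine Finset.sum_congr rfl fun l _ => ?_
  rw [D.d_mul, D.d_app (hc l), smul_zero, add_zero]

variable {W₀ : Y.Opens} {U₀ : X.Opens} (hW : W₀ ≤ pr ⁻¹ᵁ U₀)
  (hV : ⊤ ≤ v ⁻¹ᵁ q ⁻¹ᵁ i ⁻¹ᵁ W₀) (M : Fin r → Fin n → Γ(Y, W₀)) (t : Fin n → Γ(X, U₀))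

/-- The linear combination `∑ M_{xl} t_l`. -/
def linearForm (x : Fin r) : Γ(Y, W₀) := ∑ l, M x l * resO hW ((pr.app U₀).hom (t l))

/-- The coefficients `M` are constants over the base, so only the coordinates are differentiated,
and `δ` records their differentials in the basis of `E`. -/
lemma resTop₃_squareDerivation_linearForm (hU : j ''ᵁ ⊤ ≤ m ⁻¹ᵁ U₀)
    (hM : ∀ x l, M x l ∈ constants g W₀)
    (δ : Fin n → Fin d → Γ(𝒳, j ''ᵁ ⊤))
    (hδ : ∀ l, resM E hU ((SheafDerivation.ofHom (transpose m π)).d U₀ (t l)) =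
      ∑ c, δ l c • trivBasis j ψ c) {N : V.Modules}
    (κ : (Scheme.Modules.pullback p).obj E ⟶ (Scheme.Modules.pushforward v).obj N) (x : Fin r) :
    resTop₃ i q v N hV ((squareDerivation pr sq i q p m h π κ).d W₀ (linearForm pr hW M t x)) =
      ∑ c, (∑ l, ((v ≫ q ≫ i).appLE W₀ ⊤ hV).hom (M x l) *
        ((v ≫ p).appLE (j ''ᵁ ⊤) ⊤ (top_le_preimage_image p v j a hv)).hom (δ l c)) •
        basisValues v p j a hv ψ κ c := by
  have h₀ : q ⁻¹ᵁ (i ⁻¹ᵁ (pr ⁻¹ᵁ U₀)) ≤ p ⁻¹ᵁ (m ⁻¹ᵁ U₀) := by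
    rw [← Scheme.Hom.comp_preimage, ← Scheme.Hom.comp_preimage, ← Scheme.Hom.comp_preimage, ← h,
      Category.assoc]
  have h₁ : ⊤ ≤ v ⁻¹ᵁ p ⁻¹ᵁ m ⁻¹ᵁ U₀ :=
    hV.trans ((v.preimage_mono (q.preimage_mono (i.preimage_mono hW))).trans (v.preimage_mono h₀))
  have e : ∀ l, resTop₃ i q v N hV ((squareDerivation pr sq i q p m h π κ).d W₀
      (resO hW ((pr.app U₀).hom (t l)))) = ∑ c, ((v ≫ p).appLE (j ''ᵁ ⊤) ⊤
        (top_le_preimage_image p v j a hv)).hom (δ l c) • basisValues v p j a hv ψ κ c := by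
    intro l
    rw [SheafDerivation.d_resO, resTop₃_resM]
    refine Eq.trans ?_ (resTop₂_transpose_app p v j a hv ψ κ hU h₁ _ (δ l) (hδ l))
    refine (congr_arg (resM N _) (squareDerivation_d pr sq i q p m h π κ U₀ h₀ (t l))).trans ?_
    exact resM_resM N _ _ _
  rw [linearForm, SheafDerivation.d_sum_mul_constants _ _ _ _ (hM x), map_sum]
  simp_rw [Finset.sum_smul]
  rw [Finset.sum_comm]
  refine Finset.sum_congr rfl fun l _ => ?_
  rw [resTop₃_smul, e, Finset.smul_sum]
  simp_rw [smul_smul]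

/-- Values of the derivation lie in a direct image from `I`, on which the ideal acts as zero. Its
restriction to the ideal is therefore linear over functions, and testing it on local generators is
enough. -/
lemma squareConormal_comp_eq_zero_iff_rows (hU : j ''ᵁ ⊤ ≤ m ⁻¹ᵁ U₀)
    (hM : ∀ x l, M x l ∈ constants g W₀)
    (δ : Fin n → Fin d → Γ(𝒳, j ''ᵁ ⊤))
    (hδ : ∀ l, resM E hU ((SheafDerivation.ofHom (transpose m π)).d U₀ (t l)) =
      ∑ c, δ l c • trivBasis j ψ c)
    (hl : ∀ x, (i.app W₀).hom (linearForm pr hW M t x) = 0)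
    (hgen : ∀ (W : Y.Opens) (s : Γ(Y, W)), (i.app W).hom s = 0 → ∀ w ∈ W, w ∈ W₀ →
      ∃ (W' : Y.Opens) (h : W' ≤ W) (h₀ : W' ≤ W₀), w ∈ W' ∧
        resO h s ∈ Ideal.span (Set.range fun x => resO h₀ (linearForm pr hW M t x)))
    (N : V.Modules)
    (κ : (Scheme.Modules.pullback p).obj E ⟶ (Scheme.Modules.pushforward v).obj N) :
    squareConormal pr sq i q p m h π ≫ κ = 0 ↔ ∀ x,
      ∑ c, (∑ l, ((v ≫ q ≫ i).appLE W₀ ⊤ hV).hom (M x l) *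
        ((v ≫ p).appLE (j ''ᵁ ⊤) ⊤ (top_le_preimage_image p v j a hv)).hom (δ l c)) •
        basisValues v p j a hv ψ κ c = 0 := by
  rw [squareConormal_comp_eq_zero_iff]
  have key := resTop₃_squareDerivation_linearForm pr sq i q p m h π v j a hv ψ hW hV M t hU hM δ hδ κ
  simp_rw [← key]
  set D := squareDerivation pr sq i q p m h π κ
  constructor
  · intro H x
    obtain ⟨s, hs⟩ := exists_idealModule_section i W₀ _ (hl x)
    have := H W₀ s
    rw [hs] at this
    exact (congr_arg (resTop₃ i q v N hV) this).trans (map_zero _)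
  · intro H
    suffices H' : ∀ (W : Y.Opens) (s : Γ(Y, W)), (i.app W).hom s = 0 → D.d W s = 0 from
      fun W s => H' W _ (app_idealInclusion i s)
    intro W s hs
    refine resM_eq_of_locally N (U := v ⁻¹ᵁ q ⁻¹ᵁ i ⁻¹ᵁ W) fun y hy => ?_
    obtain ⟨W', h', h₀, hw, hspan⟩ := hgen W s hs (i (q (v y))) hy (hV trivial)
    refine ⟨v ⁻¹ᵁ q ⁻¹ᵁ i ⁻¹ᵁ W', v.preimage_mono (q.preimage_mono (i.preimage_mono h')), hw, ?_⟩
    refine Eq.trans ?_ (map_zero (resM N (v.preimage_mono (q.preimage_mono (i.preimage_mono h'))))).symm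
    refine (D.d_resO h' s).symm.trans ?_
    obtain ⟨c, hc⟩ := (Ideal.mem_span_range_iff_exists_fun).mp hspan
    rw [← hc, map_sum]
    refine Finset.sum_eq_zero fun x _ => ?_
    have e₁ : D.d W' (resO h₀ (linearForm pr hW M t x)) = 0 := by
      refine (D.d_resO h₀ _).trans ?_
      refine (resM_resM N (le_top : v ⁻¹ᵁ q ⁻¹ᵁ i ⁻¹ᵁ W' ≤ ⊤) hV _).symm.trans ?_
      exact (congr_arg (resM N _) (H x)).trans (map_zero _)
    have e₂ : (i.app W').hom (resO h₀ (linearForm pr hW M t x)) = 0 := by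
      have := congr_arg (fun φ => φ.hom (linearForm pr hW M t x)) (i.naturality (homOfLE h₀).op)
      refine this.trans ?_
      exact (congr_arg (I.presheaf.map ((TopologicalSpace.Opens.map i.base).op.map
        (homOfLE h₀).op)).hom (hl x)).trans (map_zero _)
    -- In `D (c ℓ) = c D ℓ + ℓ D c` the first term vanishes by hypothesis, the second because `ℓ`
    -- lies in the ideal.
    rw [D.d_mul, e₁, smul_zero, zero_add]
    exact pushforward_smul_eq_zero i e₂ _

end LocalEquations

/-! ### Completing independent rows to an invertible matrix -/

section CompleteRows

/-- The images of the unit vectors span the quotient by the row space, so some of them form a basis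
of it. Completing with unit vectors matters: the added rows make sense over any ring and so lift
from a residue field to a neighbourhood. -/
lemma exists_complete_rows {K : Type*} [Field K] {r d : ℕ} (A : Matrix (Fin r) (Fin d) K)
    (hA : LinearIndependent K A) :
    ∃ (s : ℕ) (e : Fin r ⊕ Fin s ≃ Fin d) (b : Fin s → Fin d),
      ((Matrix.of (Sum.elim A fun x => Pi.single (b x) 1)).submatrix id e).det ≠ 0 := by
  let P := Submodule.span K (Set.range A)
  obtain ⟨B, hB, hspan, hind⟩ := exists_linearIndependent K
    (Set.range fun c : Fin d => P.mkQ (Pi.single c 1))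
  have hfin : Finite B := Set.Finite.subset (Set.finite_range _) hB
  have : Fintype B := Fintype.ofFinite B
  let eB : Fin (Fintype.card B) ≃ B := (Fintype.equivFin B).symm
  choose b hb using fun x : Fin (Fintype.card B) => hB (eB x).2
  have hli : LinearIndependent K (Sum.elim A fun x => (Pi.single (b x) 1 : Fin d → K)) := by
    refine LinearIndependent.sumElim_of_quotient (M' := P)
      (f := fun x => ⟨A x, Submodule.subset_span ⟨x, rfl⟩⟩)
      (LinearIndependent.of_comp P.subtype hA) _ ?_
    have : (Submodule.Quotient.mk (p := P) ∘ fun x => (Pi.single (b x) 1 : Fin d → K)) =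
        Subtype.val ∘ eB := by
      funext x
      exact hb x
    rw [this]
    exact hind.comp _ eB.injective
  have htop : Submodule.span K (Set.range fun c : Fin d => P.mkQ (Pi.single c 1)) = ⊤ := by
    have h1 := (Pi.basisFun K (Fin d)).span_eq
    have h2 := congr_arg (Submodule.map P.mkQ) h1
    rw [Submodule.map_span, Submodule.map_top, Submodule.range_mkQ, ← Set.range_comp] at h2
    rw [← h2]
    congr 2
    exact funext fun c => congr_arg P.mkQ (Pi.basisFun_apply K (Fin d) c).symm
  have hs : Fintype.card B = Module.finrank K ((Fin d → K) ⧸ P) := by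
    rw [htop] at hspan
    rw [← finrank_top K ((Fin d → K) ⧸ P), ← hspan, ← finrank_span_eq_card hind, Subtype.range_coe]
  have hr : Module.finrank K P = r := by
    rw [finrank_span_eq_card hA, Fintype.card_fin]
  have hcard : Fintype.card (Fin r ⊕ Fin (Fintype.card B)) = Fintype.card (Fin d) := by
    have := P.finrank_quotient_add_finrank
    rw [← hs, hr, Module.finrank_fin_fun] at this
    simp only [Fintype.card_sum, Fintype.card_fin]
    omega
  refine ⟨Fintype.card B, Fintype.equivOfCardEq hcard, b, ?_⟩
  have hu := (Matrix.linearIndependent_rows_iff_isUnit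
    (A := (Matrix.of (Sum.elim A fun x => Pi.single (b x) 1)).submatrix id
      (Fintype.equivOfCardEq hcard))).mp ?_
  · exact ((Matrix.isUnit_iff_isUnit_det _).mp hu).ne_zero
  · exact hli.map' (LinearMap.funLeft K K (Fintype.equivOfCardEq hcard))
      (LinearMap.ker_eq_bot.mpr (LinearMap.funLeft_injective_of_surjective K K _
        (Equiv.surjective _)))

lemma exists_inverse_of_isUnit_det {R : Type*} [CommRing R] {ι κ : Type*} [Fintype ι] [Fintype κ]
    [DecidableEq ι] [DecidableEq κ]
    (C : Matrix ι κ R) (e : ι ≃ κ) (h : IsUnit (C.submatrix id e).det) :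
    ∃ C' : Matrix κ ι R, C * C' = 1 ∧ C' * C = 1 := by
  refine ⟨(C.submatrix id e)⁻¹.submatrix e.symm id, ?_, ?_⟩
  · have := Matrix.mul_nonsing_inv _ h
    have h2 : C = (C.submatrix id e).submatrix id e.symm := by ext; simp
    refine (congr_arg (· * _) h2).trans ?_
    rw [Matrix.submatrix_mul_equiv, this, Matrix.submatrix_id_id]
  · have := Matrix.nonsing_inv_mul _ h
    have h2 : C = (C.submatrix id e).submatrix id e.symm := by ext; simp
    refine (congr_arg (_ * ·) h2).trans ?_
    have h3 := Matrix.submatrix_mul (C.submatrix id e)⁻¹ (C.submatrix id e) e.symm id e.symm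
      Function.bijective_id
    rw [← h3, this, Matrix.submatrix_one_equiv]

end CompleteRows

/-! ### Values of functions at field-valued points -/

section Value

variable {X Y : Scheme.{u}} {K : CommRingCat.{u}}

/-- The value at a `K`-valued point of a function defined near it. -/
def value (ξ : Spec K ⟶ X) {U : X.Opens} (h : ⊤ ≤ ξ ⁻¹ᵁ U) : Γ(X, U) →+* K :=
  (ξ.appLE U ⊤ h ≫ (Scheme.ΓSpecIso K).hom).hom

lemma value_appLE (ζ : Spec K ⟶ Y) (p : Y ⟶ X) {U : X.Opens} {W : Y.Opens} (hU : W ≤ p ⁻¹ᵁ U)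
    (h : ⊤ ≤ ζ ⁻¹ᵁ W) (h' : ⊤ ≤ (ζ ≫ p) ⁻¹ᵁ U) (s : Γ(X, U)) :
    value ζ h ((p.appLE U W hU).hom s) = value (ζ ≫ p) h' s :=
  congr_arg (fun φ => (Scheme.ΓSpecIso K).hom.hom (φ.hom s))
    (Scheme.Hom.appLE_comp_appLE ζ p U W ⊤ hU h)

lemma value_resO (ξ : Spec K ⟶ X) {U V : X.Opens} (hUV : U ≤ V) (h : ⊤ ≤ ξ ⁻¹ᵁ U)
    (h' : ⊤ ≤ ξ ⁻¹ᵁ V) (s : Γ(X, V)) : value ξ h (resO hUV s) = value ξ h' s :=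
  congr_arg (fun φ => (Scheme.ΓSpecIso K).hom.hom (φ.hom s))
    (Scheme.Hom.map_appLE ξ h (homOfLE hUV).op)

lemma value_specMap {L : CommRingCat.{u}} (φ : K ⟶ L) (ξ : Spec K ⟶ X) {U : X.Opens}
    (h : ⊤ ≤ ξ ⁻¹ᵁ U) (h' : ⊤ ≤ (Spec.map φ ≫ ξ) ⁻¹ᵁ U) (s : Γ(X, U)) :
    value (Spec.map φ ≫ ξ) h' s = φ.hom (value ξ h s) := by
  have h1 := Scheme.Hom.appLE_comp_appLE (Spec.map φ) ξ U ⊤ ⊤ h le_top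
  have h2 := Scheme.ΓSpecIso_naturality φ
  have h3 : (Spec.map φ).appLE ⊤ ⊤ le_top = (Spec.map φ).appTop :=
    (Scheme.Hom.app_eq_appLE _).symm
  replace h1 := (congr_arg (ξ.appLE U ⊤ h ≫ ·) h3).symm.trans h1
  have : (Spec.map φ ≫ ξ).appLE U ⊤ h' ≫ (Scheme.ΓSpecIso L).hom =
      (ξ.appLE U ⊤ h ≫ (Scheme.ΓSpecIso K).hom) ≫ φ := by
    rw [← h1, Category.assoc, Category.assoc, h2]
  exact congr_arg (fun ψ => ψ.hom s) this

lemma mem_basicOpen_of_isUnit_value (ξ : Spec K ⟶ X) {U : X.Opens} (h : ⊤ ≤ ξ ⁻¹ᵁ U)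
    {s : Γ(X, U)} (hs : IsUnit (value ξ h s)) (x : ↥(Spec K)) : ξ x ∈ X.basicOpen s := by
  have h1 : IsUnit ((ξ.appLE U ⊤ h).hom s) := by
    have := hs.map (Scheme.ΓSpecIso K).inv.hom
    have e := congr_arg (fun φ => φ.hom ((ξ.appLE U ⊤ h).hom s)) (Scheme.ΓSpecIso K).hom_inv_id
    exact (congr_arg IsUnit e).mp this
  have h2 := Scheme.Hom.preimage_basicOpen ξ s
  have h3 := Scheme.basicOpen_of_isUnit _ h1
  have h4 := Scheme.basicOpen_res (Spec K) ((ξ.app U).hom s) (homOfLE h).op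
  have h5 : x ∈ (Spec K).basicOpen ((ξ.appLE U ⊤ h).hom s) := by
    rw [h3]
    trivial
  have h6 : x ∈ ξ ⁻¹ᵁ X.basicOpen s := by
    rw [h2]
    exact (h4.le h5).2
  exact h6

end Value

/-! ### From independence at a point to freeness nearby -/

section FreeAtPoint

variable {V₀ X H : Scheme.{u}}

/-- The determinant `Δ` of the completed matrix is a function on `W` with nonzero value at the
point; on its basic open set the matrix is invertible and `nonempty_cokernel_restrict_iso_free`
applies. -/
lemma exists_free_cokernel_of_linearIndependent (p : H ⟶ X) (j : V₀ ⟶ X) [IsOpenImmersion j]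
    {E : X.Modules} {r d : ℕ} (ψ : E.restrict j ≅ freeModule V₀ d) {P : H.Modules}
    (φ : P ⟶ (Scheme.Modules.pullback p).obj E) {W : H.Opens} (hW : W ≤ p ⁻¹ᵁ j ''ᵁ ⊤)
    (A : Matrix (Fin r) (Fin d) Γ(H, W))
    (hφ : ∀ (V : H.Opens) (_ : V ≤ W) (a : V.toScheme ⟶ V₀) (h : V.ι ≫ p = a ≫ j)
      (hV' : ⊤ ≤ V.ι ⁻¹ᵁ W) (N : V.toScheme.Modules)
      (κ : (Scheme.Modules.pullback p).obj E ⟶ (Scheme.Modules.pushforward V.ι).obj N),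
      φ ≫ κ = 0 ↔ ∀ x, ∑ i, (V.ι.appLE W ⊤ hV').hom (A x i) • basisValues V.ι p j a h ψ κ i = 0)
    {K : Type u} [Field K] (ζ : Spec (.of K) ⟶ H) (hζ : ⊤ ≤ ζ ⁻¹ᵁ W)
    (hA : LinearIndependent K (A.map (value ζ hζ))) (z : ↥(Spec (.of K))) :
    ∃ (V : H.Opens) (s : ℕ), ζ z ∈ V ∧ r + s = d ∧
      Nonempty ((cokernel φ).restrict V.ι ≅ freeModule V.toScheme s) := by
  obtain ⟨s, e, b, hdet⟩ := exists_complete_rows _ hA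
  let C : Matrix (Fin r ⊕ Fin s) (Fin d) Γ(H, W) :=
    Matrix.of (Sum.elim A fun x => Pi.single (b x) 1)
  have hmap : ∀ {R : Type u} [CommRing R] (ρ : Γ(H, W) →+* R),
      C.map ρ = Matrix.of (Sum.elim (A.map ρ) fun x => Pi.single (b x) 1) := by
    intro R _ ρ
    ext x i
    rcases x with x | x
    · rfl
    · change ρ ((Pi.single (b x) 1 : Fin d → Γ(H, W)) i) = (Pi.single (b x) 1 : Fin d → R) i
      simp only [Pi.single_apply]
      split_ifs <;> simp
  have hmapdet : ∀ {R : Type u} [CommRing R] (ρ : Γ(H, W) →+* R),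
      ((C.map ρ).submatrix id e).det = ρ (C.submatrix id e).det := by
    intro R _ ρ
    rw [RingHom.map_det]
    rfl
  let Δ := (C.submatrix id e).det
  have hu : IsUnit (value ζ hζ Δ) := by
    rw [← hmapdet, hmap]
    exact isUnit_iff_ne_zero.mpr hdet
  let V := H.basicOpen Δ
  have hVW : V ≤ W := H.basicOpen_le Δ
  have hV' : ⊤ ≤ V.ι ⁻¹ᵁ W := fun y _ => hVW y.2
  have hrange : Set.range (V.ι ≫ p) ⊆ Set.range j := by
    rintro _ ⟨y, rfl⟩
    obtain ⟨w, -, hw⟩ := hW (hVW y.2)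
    exact ⟨w, hw⟩
  let ρ := (V.ι.appLE W ⊤ hV').hom
  have hρ : IsUnit (ρ Δ) := by
    have hV'' : ⊤ ≤ V.ι ⁻¹ᵁ V := fun y _ => y.2
    have h2 := (H.toRingedSpace.isUnit_res_basicOpen Δ).map
      (V.ι.appLE V ⊤ hV'').hom
    exact (congr_arg (fun φ => IsUnit (φ.hom Δ))
      (Scheme.Hom.map_appLE V.ι hV'' (homOfLE (H.basicOpen_le Δ)).op)).mp h2
  obtain ⟨C', h1, h2⟩ := exists_inverse_of_isUnit_det (C.map ρ) e (by rw [hmapdet]; exact hρ)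
  refine ⟨V, s, mem_basicOpen_of_isUnit_value ζ hζ hu z, ?_, ?_⟩
  · simpa using Fintype.card_congr e
  · exact nonempty_cokernel_restrict_iso_free V.ι p j (IsOpenImmersion.lift j (V.ι ≫ p) hrange)
      (IsOpenImmersion.lift_fac _ _ _).symm ψ φ (C.map ρ) C' h1 h2
      fun N κ => (hφ V hVW _ _ hV' N κ)

end FreeAtPoint

/-! ### The transcendence degree count -/

section GenericRows

variable {k F K : Type u} [Field k] [Field F] [Field K] [Algebra k F] [Algebra F K] [Algebra k K]
  [IsScalarTower k F K]

/-- A vector over `K` with values in `F` on `c` independent vectors over `F` of length `N` has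
entries generated over `F` by `N - c` of them. -/
lemma exists_finset_adjoin {N c : ℕ} (R : Fin N → K) (v : Fin c → Fin N → F)
    (hv : LinearIndependent F v) (hR : ∀ i, ∑ j, v i j • R j ∈ (algebraMap F K).range) :
    ∃ S : Finset K, S.card + c ≤ N ∧ ∀ j, R j ∈ Algebra.adjoin F (S : Set K) := by
  classical
  obtain ⟨s, e, b, hdet⟩ := exists_complete_rows v hv
  obtain ⟨C', -, hC⟩ := exists_inverse_of_isUnit_det _ e (isUnit_iff_ne_zero.mpr hdet)
  set C : Matrix (Fin c ⊕ Fin s) (Fin N) F := Matrix.of (Sum.elim v fun x => Pi.single (b x) 1)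
  refine ⟨Finset.univ.image (R ∘ b), ?_, fun j => ?_⟩
  · have h1 : (Finset.univ.image (R ∘ b)).card ≤ s := by
      simpa using Finset.card_image_le (s := Finset.univ) (f := R ∘ b)
    have h2 : c + s = N := by simpa using Fintype.card_congr e
    omega
  -- Inverting the completed matrix recovers `R` from `C R`, whose entries are either in `F` by
  -- hypothesis or among the `N - c` chosen coordinates of `R`.
  · have h1 : R j = ∑ x, C' j x • ∑ l, C x l • R l := by
      simp_rw [Finset.smul_sum, smul_smul]
      rw [Finset.sum_comm]
      simp_rw [← Finset.sum_smul, ← Matrix.mul_apply, hC, Matrix.one_apply, ite_smul, one_smul,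
        zero_smul]
      simp
    rw [h1]
    refine Subalgebra.sum_mem _ fun x _ => Subalgebra.smul_mem _ ?_ _
    rcases x with x | x
    · obtain ⟨y, hy⟩ := hR x
      change ∑ l, v x l • R l ∈ _
      rw [← hy]
      exact Subalgebra.algebraMap_mem _ y
    · have : ∑ l, C (.inr x) l • R l = R (b x) := by
        change ∑ l, (Pi.single (b x) 1 : Fin N → F) l • R l = _
        simp [Pi.single_apply]
      rw [this]
      exact Algebra.subset_adjoin (by simp)

/-- The algebra is a quotient of a polynomial ring in as many variables as `S` has elements. -/
lemma trdeg_adjoin_finset_le (S : Finset K) :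
    Algebra.trdeg F (Algebra.adjoin F (S : Set K)) ≤ S.card := by
  have h := trdeg_le_of_surjective (R := F)
    (AlgHom.rangeRestrict (MvPolynomial.aeval (Subtype.val : {x // x ∈ (S : Set K)} → K) : MvPolynomial {x // x ∈ (S : Set K)} F →ₐ[F] K))
    (AlgHom.rangeRestrict_surjective _)
  rw [← Algebra.adjoin_range_eq_range_aeval, Subtype.range_coe] at h
  refine h.trans ?_
  rw [MvPolynomial.trdeg_of_isDomain]
  simp

variable {N r d : ℕ} (I : Fin r ↪ Fin N) (ρ : ChartRing k N r I →ₐ[k] K)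

lemma map_chartMatrix_apply_embedding (a b : Fin r) :
    ρ (chartMatrix k N r I a (I b)) = if a = b then 1 else 0 := by
  have := congr_fun (congr_fun (chartMatrix_submatrix k I) a) b
  simp only [Matrix.submatrix_apply, id] at this
  rw [this, Matrix.one_apply]
  split_ifs <;> simp

/-- The values of a generic linear system of rank `r` vanishing at `p` on `d` vectors independent of
`p` have rank `r`, provided that these vectors are defined over a field of transcendence degree at
most `d`. -/
theorem linearIndependent_generic_rows (hρ : Function.Injective ρ) (p : Fin N → F)
    (q : Fin d → Fin N → F) (hpq : LinearIndependent F (Fin.cons p q : Fin (d + 1) → Fin N → F))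
    (hp : ∀ a, ∑ j, p j • ρ (chartMatrix k N r I a j) = 0)
    (hF : Algebra.trdeg k F ≤ d) :
    LinearIndependent K (fun (a : Fin r) (c : Fin d) => ∑ j, q c j • ρ (chartMatrix k N r I a j)) := by
  classical
  rw [Fintype.linearIndependent_iff]
  by_contra! H
  obtain ⟨c, hc, a₀, ha₀⟩ := H
  set M : Fin r → Fin N → K := fun a j => ρ (chartMatrix k N r I a j) with hM
  have hMI : ∀ a b, M a (I b) = if a = b then 1 else 0 := map_chartMatrix_apply_embedding I ρ
  -- The dependent combination of rows, scaled so that its entry at `I a₀` is `1`; its other entries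
  -- on the block `I` are the remaining coefficients.
  let R : Fin N → K := fun j => ∑ a, (c a₀)⁻¹ * c a * M a j
  have hRI : ∀ b, R (I b) = (c a₀)⁻¹ * c b := by
    intro b
    simp [R, hMI]
  have hlin : ∀ v : Fin N → F, ∑ j, v j • R j = ∑ a, (c a₀)⁻¹ * c a * ∑ j, v j • M a j := by
    intro v
    simp_rw [R, Finset.smul_sum, Finset.mul_sum]
    rw [Finset.sum_comm]
    refine Finset.sum_congr rfl fun a _ => Finset.sum_congr rfl fun j _ => ?_
    rw [mul_smul_comm]
  have hRp : ∑ j, p j • R j = 0 := by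
    rw [hlin]
    exact Finset.sum_eq_zero fun a _ => by rw [hp a, mul_zero]
  have hRq : ∀ x, ∑ j, q x j • R j = 0 := by
    intro x
    rw [hlin]
    have := congr_fun hc x
    simp only [Finset.sum_apply, Pi.smul_apply, smul_eq_mul, Pi.zero_apply] at this
    simp_rw [mul_assoc]
    rw [← Finset.mul_sum, this, mul_zero]
  have hsingle : ∀ (j : Fin N) (R : Fin N → K), ∑ l, (Pi.single j 1 : Fin N → F) l • R l = R j := by
    intro j R
    simp [Pi.single_apply]
  have hp0 : p ≠ 0 := by simpa using hpq.ne_zero 0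
  -- the rows of the matrix
  have hindep : LinearIndependent F
      (Fin.cons p (fun a => Pi.single (I a) 1) : Fin (r + 1) → Fin N → F) := by
    rw [linearIndependent_finCons]
    constructor
    · have e : (fun a => Pi.single (I a) 1 : Fin r → Fin N → F) = Pi.basisFun F (Fin N) ∘ I :=
        funext fun a => (Pi.basisFun_apply F (Fin N) (I a)).symm
      rw [e]
      exact (Pi.basisFun F (Fin N)).linearIndependent.comp I I.injective
    -- If `p` were supported on the block `I`, its orthogonality to row `b` would make its
    -- coordinate at `I b` vanish, for every `b`.
    · intro hmem
      obtain ⟨l, hl⟩ := (Submodule.mem_span_range_iff_exists_fun F).mp hmem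
      apply hp0
      have : ∀ b, l b = 0 := by
        intro b
        have h1 := hp b
        have h2 : ∑ j, p j • M b j = ∑ a, l a • M b (I a) := by
          rw [← hl]
          simp_rw [Finset.sum_apply, Finset.sum_smul, Pi.smul_apply, smul_assoc]
          rw [Finset.sum_comm]
          refine Finset.sum_congr rfl fun a _ => ?_
          rw [← Finset.smul_sum, hsingle]
        rw [h2] at h1
        simpa [hMI, Algebra.smul_def] using h1
      rw [← hl]
      simp [this]
  -- A row of `M` satisfies `r + 1` independent conditions over `F`: its `I`-block is prescribed and
  -- it is orthogonal to `p`.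
  have hrow : ∀ b, ∃ S : Finset K, S.card + (r + 1) ≤ N ∧
      ∀ j, M b j ∈ Algebra.adjoin F (S : Set K) := by
    intro b
    refine exists_finset_adjoin (M b) _ hindep fun i => ?_
    refine Fin.cases ?_ (fun a => ?_) i
    · simp only [Fin.cons_zero]
      rw [hp b]
      exact zero_mem _
    · simp only [Fin.cons_succ]
      rw [hsingle, hMI]
      split_ifs
      · exact one_mem _
      · exact zero_mem _
  -- the combination
  have hindep' : LinearIndependent F
      (Fin.cons (Pi.single (I a₀) 1) (Fin.cons p q : Fin (d + 1) → Fin N → F) :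
        Fin (d + 1 + 1) → Fin N → F) := by
    rw [linearIndependent_finCons]
    -- `R` annihilates the span of `p` and `q` but takes the value `1` on this unit vector.
    refine ⟨hpq, fun hmem => ?_⟩
    have hle : Submodule.span F (Set.range (Fin.cons p q : Fin (d + 1) → Fin N → F)) ≤
        LinearMap.ker (Fintype.linearCombination F R) := by
      rw [Submodule.span_le]
      rintro _ ⟨i, rfl⟩
      refine Fin.cases ?_ (fun a => ?_) i
      · exact hRp
      · exact hRq a
    have h1 : ∑ l, (Pi.single (I a₀) 1 : Fin N → F) l • R l = 0 := hle hmem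
    rw [hsingle, hRI, inv_mul_cancel₀ ha₀] at h1
    exact one_ne_zero h1
  -- `R` satisfies `d + 2` independent conditions: orthogonality to `p` and to the `d` vectors `q`,
  -- and the normalised entry.
  obtain ⟨S₀, hS₀, hRS⟩ := exists_finset_adjoin R _ hindep' (by
    intro i
    refine Fin.cases ?_ (fun i => Fin.cases ?_ (fun a => ?_) i) i
    · simp only [Fin.cons_zero]
      rw [hsingle, hRI, inv_mul_cancel₀ ha₀]
      exact one_mem _
    · simp only [Fin.cons_succ, Fin.cons_zero]
      rw [hRp]
      exact zero_mem _
    · simp only [Fin.cons_succ]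
      rw [hRq]
      exact zero_mem _)
  choose S hS hMS using hrow
  -- Generators for `R` and for all rows except `a₀`; that row is recovered from `R`, whose
  -- coefficients are themselves entries of `R`.
  let T : Finset K := S₀ ∪ (Finset.univ.erase a₀).biUnion S
  have hRT : ∀ j, R j ∈ Algebra.adjoin F (T : Set K) := fun j =>
    Algebra.adjoin_mono (by simp [T]) (hRS j)
  have hMT : ∀ a j, M a j ∈ Algebra.adjoin F (T : Set K) := by
    have h1 : ∀ a, a ≠ a₀ → ∀ j, M a j ∈ Algebra.adjoin F (T : Set K) := by
      intro a ha j
      refine Algebra.adjoin_mono ?_ (hMS a j)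
      have : S a ⊆ T := (Finset.subset_biUnion_of_mem S (by simpa using ha)).trans
        Finset.subset_union_right
      exact_mod_cast this
    intro a j
    by_cases ha : a = a₀
    · subst ha
      have e : M a j = R j - ∑ b ∈ Finset.univ.erase a, R (I b) * M b j := by
        have : R j = R (I a) * M a j + ∑ b ∈ Finset.univ.erase a, R (I b) * M b j := by
          rw [Finset.add_sum_erase _ (fun b => R (I b) * M b j) (Finset.mem_univ a)]
          simp_rw [hRI]
          rfl
        rw [this, hRI, inv_mul_cancel₀ ha₀]
        ring
      rw [e]
      exact sub_mem (hRT j) (sum_mem fun b hb => mul_mem (hRT _) (h1 b (Finset.ne_of_mem_erase hb) j))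
    · exact h1 a ha j
  have hai : AlgebraicIndependent k (fun x : Fin r × {j : Fin N // j ∉ Set.range I} =>
      (⟨M x.1 x.2, hMT _ _⟩ : Algebra.adjoin F (T : Set K))) := by
    refine AlgebraicIndependent.of_comp (((Algebra.adjoin F (T : Set K)).val).restrictScalars k) ?_
    have : ((((Algebra.adjoin F (T : Set K)).val).restrictScalars k) ∘
        fun x : Fin r × {j : Fin N // j ∉ Set.range I} =>
          (⟨M x.1 x.2, hMT _ _⟩ : Algebra.adjoin F (T : Set K))) =
        ρ ∘ MvPolynomial.X := by
      funext x
      obtain ⟨a, j, hj⟩ := x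
      change ρ (chartMatrix k N r I a j) = _
      rw [chartMatrix, dif_neg hj]
      rfl
    rw [this]
    exact (MvPolynomial.algebraicIndependent_X _ _).map' hρ
  -- The `r (N - r)` free entries are algebraically independent over `k`, yet lie in an algebra
  -- generated over `F` by `T`.
  have hcard := hai.lift_cardinalMk_le_trdeg
  rw [Cardinal.lift_id'.{0, u}] at hcard
  rw [← trdeg_add_eq k F] at hcard
  have hle := hcard.trans (add_le_add hF (trdeg_adjoin_finset_le T))
  have hcompl : Fintype.card {j : Fin N // j ∉ Set.range I} = N - r := by
    rw [Fintype.card_subtype_compl, Fintype.card_fin]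
    congr 1
    exact (Fintype.card_congr (Equiv.ofInjective I I.injective).symm).trans (Fintype.card_fin r)
  rw [Cardinal.mk_fintype, Cardinal.lift_natCast, Fintype.card_prod, hcompl, Fintype.card_fin] at hle
  have hle' : r * (N - r) ≤ d + T.card := by exact_mod_cast hle
  have hT : T.card ≤ S₀.card + (r - 1) * (N - r - 1) := by
    refine (Finset.card_union_le _ _).trans (Nat.add_le_add_left ?_ _)
    refine (Finset.card_biUnion_le_card_mul _ _ (N - r - 1) fun b _ => ?_).trans ?_
    · have := hS b
      omega
    · rw [Finset.card_erase_of_mem (Finset.mem_univ a₀), Finset.card_univ, Fintype.card_fin]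
  have hr := a₀.pos
  have hN := hS a₀
  obtain ⟨w, rfl⟩ : ∃ w, N = r + 1 + w := ⟨N - (r + 1), by omega⟩
  obtain ⟨r', rfl⟩ : ∃ r', r = r' + 1 := ⟨r - 1, by omega⟩
  have e1 : r' + 1 + 1 + w - (r' + 1) = w + 1 := by omega
  rw [e1] at hle' hT
  simp only [Nat.add_sub_cancel] at hT
  -- The count fails by one: `r (N - r) = (r - 1)(N - r - 1) + N - 1`, whereas the bounds allow at
  -- most `d + (N - d - 2) + (r - 1)(N - r - 1)`.
  nlinarith

end GenericRows

/-! ### Transcendence degrees of residue fields -/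

section Dimension

/-- By Noether normalisation `R` is integral over a polynomial ring in `s` variables. A chain of
primes of length `s` in that ring lifts to `R` by lying over and going up. -/
lemma exists_trdeg_eq_le_ringKrullDim (k R : Type u) [Field k] [CommRing R] [IsDomain R]
    [Algebra k R] [Algebra.FiniteType k R] :
    ∃ s : ℕ, Algebra.trdeg k R = s ∧ (s : WithBot ℕ∞) ≤ ringKrullDim R := by
  obtain ⟨s, g, hg, hint⟩ := exists_integral_inj_algHom_of_fg k R
  let : Algebra (MvPolynomial (Fin s) k) R := g.toRingHom.toAlgebra
  have : IsScalarTower k (MvPolynomial (Fin s) k) R := IsScalarTower.of_algHom g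
  have : Algebra.IsIntegral (MvPolynomial (Fin s) k) R := ⟨hint⟩
  have : FaithfulSMul (MvPolynomial (Fin s) k) R := (faithfulSMul_iff_algebraMap_injective _ _).mpr hg
  refine ⟨s, ?_, ?_⟩
  · rw [← trdeg_add_eq k (MvPolynomial (Fin s) k), MvPolynomial.trdeg_of_isDomain,
      trdeg_eq_zero]
    simp
  · have h1 : ringKrullDim (MvPolynomial (Fin s) k) = s := by
      simp [MvPolynomial.ringKrullDim_of_isNoetherianRing]
    obtain ⟨l, hl⟩ := Order.le_krullDim_iff.mp h1.ge
    obtain ⟨Q, hQp, hQ⟩ := Ideal.exists_ideal_over_prime_of_isIntegral_of_isDomain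
      (S := R) (RelSeries.head l).asIdeal (((RingHom.injective_iff_ker_eq_bot _).mp hg).le.trans bot_le)
    have : Q.LiesOver (RelSeries.head l).asIdeal := ⟨hQ.symm⟩
    obtain ⟨L, hL, -⟩ := Ideal.exists_ltSeries_of_hasGoingUp l Q
    exact Order.le_krullDim_iff.mpr ⟨L, hL.trans hl⟩

variable {X : Scheme.{u}}

lemma value_fromSpecResidueField (x : X) {U : X.Opens} (hx : x ∈ U)
    (h : ⊤ ≤ X.fromSpecResidueField x ⁻¹ᵁ U) (s : Γ(X, U)) :
    value (X.fromSpecResidueField x) h s = (X.evaluation U x hx).hom s := by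
  have e : ⊤ ≤ X.fromSpecStalk x ⁻¹ᵁ U := by
    rintro y -
    have : X.fromSpecStalk x y ⤳ x := by
      rw [← Set.mem_ofPred_eq (p := fun z => z ⤳ x) , ← Scheme.range_fromSpecStalk]
      exact ⟨y, rfl⟩
    exact this.mem_open U.2 hx
  have h1 := value_specMap (X.residue x) (X.fromSpecStalk x) e h s
  refine h1.trans (congr_arg (X.residue x).hom ?_)
  have h2 := Scheme.fromSpecStalk_app (X := X) (x := x) hx
  have h3 : (X.fromSpecStalk x).appLE U ⊤ e = X.presheaf.germ U x hx ≫ (Scheme.ΓSpecIso _).inv := by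
    rw [Scheme.Hom.appLE, h2, Category.assoc, Category.assoc, ← Functor.map_comp]
    have : (homOfLE (le_top : X.fromSpecStalk x ⁻¹ᵁ U ≤ ⊤)).op ≫ (homOfLE e).op = 𝟙 _ := rfl
    rw [this, CategoryTheory.Functor.map_id, Category.comp_id]
  have h4 : (X.fromSpecStalk x).appLE U ⊤ e ≫ (Scheme.ΓSpecIso _).hom = X.presheaf.germ U x hx := by
    rw [h3, Category.assoc, Iso.inv_hom_id, Category.comp_id]
  exact congr_arg (fun φ => φ.hom s) h4

/-- The residue field is a quotient of the stalk, which is a localisation of the ring of the affine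
open; its elements are thus fractions of values. -/
lemma exists_value_mul_eq (x : X) {U : X.Opens} (hU : IsAffineOpen U) (hx : x ∈ U)
    (h : ⊤ ≤ X.fromSpecResidueField x ⁻¹ᵁ U) (y : X.residueField x) :
    ∃ a s, value (X.fromSpecResidueField x) h s ≠ 0 ∧
      y * value (X.fromSpecResidueField x) h s = value (X.fromSpecResidueField x) h a := by
  let := X.presheaf.algebra_section_stalk ⟨x, hx⟩
  have := hU.isLocalization_stalk ⟨x, hx⟩
  obtain ⟨z, rfl⟩ := X.residue_surjective x y
  obtain ⟨⟨a, s⟩, e⟩ := IsLocalization.surj (hU.primeIdealOf ⟨x, hx⟩).asIdeal.primeCompl z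
  refine ⟨a, s, ?_, ?_⟩
  · rw [value_fromSpecResidueField x hx]
    have := IsLocalization.map_units (X.presheaf.stalk x) s
    exact (this.map (X.residue x).hom).ne_zero
  · rw [value_fromSpecResidueField x hx, value_fromSpecResidueField x hx]
    exact (map_mul (X.residue x).hom z _).symm.trans (congr_arg (X.residue x).hom e)

lemma ringKrullDim_section_le {U : X.Opens} (hU : IsAffineOpen U) :
    ringKrullDim Γ(X, U) ≤ topologicalKrullDim X := by
  rw [← PrimeSpectrum.topologicalKrullDim_eq_ringKrullDim]
  exact (hU.fromSpec.isOpenEmbedding.isInducing).topologicalKrullDim_le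

variable {k : Type u} [Field k]

lemma resO_structureMap (g : X ⟶ Spec (.of k)) {U V : X.Opens} (h : U ≤ V) (c : k) :
    resO h (structureMap g V c) = structureMap g U c :=
  congr_arg (fun φ => φ.hom ((Scheme.ΓSpecIso (.of k)).inv.hom c))
    (Scheme.Hom.appLE_map g (U := ⊤) le_top (homOfLE h).op)

lemma value_structureMap {K : CommRingCat.{u}} (ξ : Spec K ⟶ X) (g : X ⟶ Spec (.of k))
    {U : X.Opens} (h : ⊤ ≤ ξ ⁻¹ᵁ U) (c : k) :
    value ξ h (structureMap g U c) = value ξ le_top (structureMap g ⊤ c) := by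
  rw [← resO_structureMap g (le_top : U ≤ ⊤)]
  exact value_resO ξ _ h le_top _

/-- The transcendence degree of a residue field of a scheme locally of finite type over a field is
at most the dimension of the scheme. -/
lemma trdeg_residueField_le (g : X ⟶ Spec (.of k)) [LocallyOfFiniteType g] {d : ℕ}
    (hd : topologicalKrullDim X ≤ d) (x : X) [Algebra k (X.residueField x)]
    (hk : ∀ c, algebraMap k (X.residueField x) c =
      value (X.fromSpecResidueField x) le_top (structureMap g ⊤ c)) :
    Algebra.trdeg k (X.residueField x) ≤ d := by
  obtain ⟨U, hU, hx, -⟩ := exists_isAffineOpen_mem_and_subset (U := ⊤) (x := x) trivial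
  have h : ⊤ ≤ X.fromSpecResidueField x ⁻¹ᵁ U := by
    rintro y -
    change X.fromSpecResidueField x y ∈ U
    rw [Scheme.fromSpecResidueField_apply]
    exact hx
  let : Algebra k Γ(X, U) := (structureMap g U).toAlgebra
  have hft : Algebra.FiniteType k Γ(X, U) := by
    have h1 := g.finiteType_appLE (isAffineOpen_top _) hU (le_top : U ≤ g ⁻¹ᵁ ⊤)
    have h2 : (Scheme.ΓSpecIso (.of k)).inv.hom.FiniteType := RingHom.FiniteType.of_surjective _
      (Scheme.ΓSpecIso (.of k)).symm.commRingCatIsoToRingEquiv.surjective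
    exact h1.comp h2
  let v := value (X.fromSpecResidueField x) h
  have hv : ∀ c, v (structureMap g U c) = algebraMap k (X.residueField x) c := by
    intro c
    rw [hk]
    exact value_structureMap _ g h c
  let φ : Γ(X, U) →ₐ[k] X.residueField x := { v with commutes' := hv }
  -- The coordinate ring of the closure of `x` in `U`. The residue field is algebraic over it, so
  -- both have the same transcendence degree.
  let B := Γ(X, U) ⧸ RingHom.ker φ
  let ψ : B →ₐ[k] X.residueField x := Ideal.kerLiftAlg φ
  have hψ : Function.Injective ψ := Ideal.kerLiftAlg_injective φ
  have : IsDomain B := hψ.isDomain ψ.toRingHom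
  let : Algebra B (X.residueField x) := ψ.toRingHom.toAlgebra
  have : IsScalarTower k B (X.residueField x) := IsScalarTower.of_algHom ψ
  have : FaithfulSMul B (X.residueField x) := (faithfulSMul_iff_algebraMap_injective _ _).mpr hψ
  have : FaithfulSMul k B := (faithfulSMul_iff_algebraMap_injective _ _).mpr
    (algebraMap k B).injective
  have : Algebra.IsAlgebraic B (X.residueField x) := by
    constructor
    intro y
    obtain ⟨a, s, hs, e⟩ := exists_value_mul_eq x hU hx h y
    let s' : B := Ideal.Quotient.mk _ s
    let a' : B := Ideal.Quotient.mk _ a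
    refine ⟨Polynomial.C s' * Polynomial.X - Polynomial.C a', ?_, ?_⟩
    · intro h0
      have := congr_arg (fun p => p.coeff 1) h0
      simp only [Polynomial.coeff_sub, Polynomial.coeff_C_mul_X, Polynomial.coeff_C,
        Polynomial.coeff_zero] at this
      apply hs
      have h2 : s' = 0 := by simpa using this
      exact (congr_arg ψ h2).trans (map_zero ψ)
    · have h1 : algebraMap B (X.residueField x) s' = v s := rfl
      have h2 : algebraMap B (X.residueField x) a' = v a := rfl
      simp only [map_sub, map_mul, Polynomial.aeval_C, Polynomial.aeval_X, h1, h2]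
      rw [mul_comm]
      exact sub_eq_zero.mpr e
  obtain ⟨s, hs, hs'⟩ := exists_trdeg_eq_le_ringKrullDim k B
  rw [← trdeg_add_eq k B, trdeg_eq_zero (R := B), add_zero, hs]
  have h1 : (s : WithBot ℕ∞) ≤ d := hs'.trans ((ringKrullDim_quotient_le _).trans
    ((ringKrullDim_section_le hU).trans hd))
  exact_mod_cast h1

end Dimension

/-! ### Functions on the image of an affine chart -/

section ChartFunctions

variable {A : CommRingCat.{u}} {S T : Scheme.{u}} (j : Spec A ⟶ S) [IsOpenImmersion j]

/-- The functions on the image of an affine chart. -/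
def chartFun : A →+* Γ(S, j ''ᵁ ⊤) := ((Scheme.ΓSpecIso A).inv ≫ (j.appIso ⊤).inv).hom

lemma appLE_chartFun (a : T ⟶ S) (a' : T ⟶ Spec A) (h : a = a' ≫ j) {W : T.Opens}
    (hW : W ≤ a ⁻¹ᵁ j ''ᵁ ⊤) (s : A) :
    (a.appLE (j ''ᵁ ⊤) W hW).hom (chartFun j s) =
      (a'.appLE ⊤ W le_top).hom ((Scheme.ΓSpecIso A).inv.hom s) := by
  subst h
  have h1 := Scheme.Hom.appLE_comp_appLE a' j (j ''ᵁ ⊤) ⊤ W (j.preimage_image_eq ⊤).ge le_top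
  have h2 : (j.appIso ⊤).inv ≫ j.appLE (j ''ᵁ ⊤) ⊤ (j.preimage_image_eq ⊤).ge = 𝟙 _ := by
    rw [← Scheme.Hom.appIso_hom', Iso.inv_hom_id]
  have h3 : (j.appIso ⊤).inv ≫ (a' ≫ j).appLE (j ''ᵁ ⊤) W hW = a'.appLE ⊤ W le_top := by
    rw [← h1, reassoc_of% h2]
  exact congr_arg (fun φ => φ.hom ((Scheme.ΓSpecIso A).inv.hom s)) h3

lemma chartFun_surjective : Function.Surjective (chartFun j) :=
  ((Scheme.ΓSpecIso A).symm ≪≫ (j.appIso ⊤).symm).commRingCatIsoToRingEquiv.surjective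

lemma isAffineOpen_image_top : IsAffineOpen (j ''ᵁ ⊤) := by
  rw [Scheme.Hom.image_top_eq_opensRange]
  exact isAffineOpen_opensRange j

lemma chartFun_eq_structureMap {k : Type u} [Field k] (g : S ⟶ Spec (.of k))
    (φ : CommRingCat.of k ⟶ A) (h : j ≫ g = Spec.map φ) (c : k) :
    chartFun j (φ.hom c) = structureMap g (j ''ᵁ ⊤) c := by
  have h0 : (j ≫ g).appLE ⊤ ⊤ le_top = (Spec.map φ).appTop := by
    simp only [h]
    exact (Scheme.Hom.app_eq_appLE _).symm
  have h1 : (j.appIso ⊤).hom.hom (structureMap g (j ''ᵁ ⊤) c) =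
      (Scheme.ΓSpecIso A).inv.hom (φ.hom c) := by
    rw [Scheme.Hom.appIso_hom', appLE_structureMap, structureMap, h0]
    exact congr_arg (fun ψ => ψ.hom c) (Scheme.ΓSpecIso_inv_naturality φ).symm
  have h2 := congr_arg (j.appIso ⊤).inv.hom h1
  refine h2.symm.trans ?_
  exact congr_arg (fun ψ => ψ.hom (structureMap g (j ''ᵁ ⊤) c)) (j.appIso ⊤).hom_inv_id

end ChartFunctions

/-! ### Coordinates on projective space and derivations of an unramified scheme over it -/

section Coordinates

attribute [local instance] MvPolynomial.gradedAlgebra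

variable {k : Type u} [Field k] {n : ℕ}

instance (i : Fin (n + 1)) : IsOpenImmersion (ProjectiveSpace.ι k n i) :=
  Proj.instIsOpenImmersionAwayι _ _ (MvPolynomial.isHomogeneous_X k i) one_pos

/-- The structure map of the coordinate ring of `{Xᵢ ≠ 0}`. -/
def ProjectiveSpace.strMap (i : Fin (n + 1)) : k →+* ProjectiveSpace.ChartRing k n i :=
  (HomogeneousLocalization.fromZeroRingHom (MvPolynomial.homogeneousSubmodule (Fin (n + 1)) k)
    (Submonoid.powers (MvPolynomial.X i))).comp
    (algebraMap k (MvPolynomial.homogeneousSubmodule (Fin (n + 1)) k 0))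

lemma ProjectiveSpace.ι_str (i : Fin (n + 1)) :
    ProjectiveSpace.ι k n i ≫ ProjectiveSpace.str k n =
      Spec.map (CommRingCat.ofHom (ProjectiveSpace.strMap i)) := by
  have h := Proj.awayι_toSpecZero (MvPolynomial.homogeneousSubmodule (Fin (n + 1)) k)
    (f_deg := MvPolynomial.isHomogeneous_X k i) (hm := one_pos)
  refine (Category.assoc _ _ _).symm.trans ?_
  refine (congr_arg (· ≫ _) h).trans ?_
  exact (Spec.map_comp _ _).symm

/-- The ring of `{Xᵢ ≠ 0}` is generated over `k` by the `Xⱼ / Xᵢ`, the degree-zero polynomials being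
constants. Stated for subrings because it is applied to the functions killed by a derivation. -/
lemma ProjectiveSpace.eq_top_of_coord_mem (i : Fin (n + 1))
    (T : Subring (ProjectiveSpace.ChartRing k n i)) (h₀ : ∀ c, ProjectiveSpace.strMap i c ∈ T)
    (h : ∀ j, ProjectiveSpace.coord k n i j ∈ T) : T = ⊤ := by
  let T' : Subalgebra (MvPolynomial.homogeneousSubmodule (Fin (n + 1)) k 0)
      (ProjectiveSpace.ChartRing k n i) :=
    { T with
      algebraMap_mem' := by
        rintro ⟨a, ha⟩
        have h1 : MvPolynomial.C (MvPolynomial.coeff 0 a) = a := by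
          have := MvPolynomial.totalDegree_eq_zero_iff_eq_C.mp
            (Nat.le_zero.mp (MvPolynomial.IsHomogeneous.totalDegree_le ha))
          exact this.symm
        have h2 := h₀ (MvPolynomial.coeff 0 a)
        convert h2 using 1
        have : (⟨a, ha⟩ : MvPolynomial.homogeneousSubmodule (Fin (n + 1)) k 0) =
            algebraMap k _ (MvPolynomial.coeff 0 a) := Subtype.ext h1.symm
        rw [this]
        rfl }
  have htop : T' = ⊤ := by
    rw [eq_top_iff, ← HomogeneousLocalization.Away.adjoin_mk_prod_pow_eq_top
      (MvPolynomial.isHomogeneous_X k i) (Fin (n + 1)) MvPolynomial.X ?_ (fun _ => 1)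
      (fun j => MvPolynomial.isHomogeneous_X k j)]
    · rw [Algebra.adjoin_le_iff]
      rintro _ ⟨a, ai, hai, -, rfl⟩
      have : HomogeneousLocalization.Away.mk _ (MvPolynomial.isHomogeneous_X k i) a
          (∏ j, MvPolynomial.X j ^ ai j) (hai ▸ SetLike.prod_pow_mem_graded _ _ _ _
            fun j _ => MvPolynomial.isHomogeneous_X k j) =
          ∏ j, ProjectiveSpace.coord k n i j ^ ai j := by
        apply HomogeneousLocalization.val_injective
        have hc : ∀ j, (ProjectiveSpace.coord k n i j).val = Localization.mk (MvPolynomial.X j)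
          (⟨MvPolynomial.X i ^ 1, 1, rfl⟩ : Submonoid.powers (MvPolynomial.X i)) :=
          fun j => HomogeneousLocalization.Away.val_mk _ _ _ _ _
        refine (HomogeneousLocalization.Away.val_mk _ _ _ _ _).trans ?_
        have h3 := map_prod (algebraMap (ProjectiveSpace.ChartRing k n i)
          (Localization.Away (MvPolynomial.X i : MvPolynomial (Fin (n + 1)) k)))
          (fun j => ProjectiveSpace.coord k n i j ^ ai j) Finset.univ
        refine Eq.trans ?_ h3.symm
        simp only [map_pow]
        have h4 : ∀ j, algebraMap (ProjectiveSpace.ChartRing k n i)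
          (Localization.Away (MvPolynomial.X i : MvPolynomial (Fin (n + 1)) k))
          (ProjectiveSpace.coord k n i j) = Localization.mk (MvPolynomial.X j)
          (⟨MvPolynomial.X i ^ 1, 1, rfl⟩ : Submonoid.powers (MvPolynomial.X i)) := hc
        simp only [h4, Localization.mk_pow, Localization.mk_prod]
        congr 1
        apply Subtype.ext
        have h5 : ∑ j, ai j = a := by simpa using hai
        simp only [pow_one, SubmonoidClass.mk_pow]
        rw [← h5, ← Finset.prod_pow_eq_pow_sum]
        simp
      rw [this]
      exact Subalgebra.prod_mem _ fun j _ => Subalgebra.pow_mem _ (h j) _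
    · rw [eq_top_iff]
      intro x _
      induction x using MvPolynomial.induction_on with
      | C c =>
        exact Subalgebra.algebraMap_mem (Algebra.adjoin _ _)
          (algebraMap k (MvPolynomial.homogeneousSubmodule (Fin (n + 1)) k 0) c)
      | add p q hp hq => exact add_mem (hp trivial) (hq trivial)
      | mul_X p j hp => exact mul_mem (hp trivial) (Algebra.subset_adjoin ⟨j, rfl⟩)
  rw [eq_top_iff]
  intro x _
  have : x ∈ T' := htop ▸ trivial
  exact this

/-- The function `X_l / X_i` on `{X_i ≠ 0}`. -/
def coordFun (i l : Fin (n + 1)) : Γ(ProjectiveSpace k n, ProjectiveSpace.ι k n i ''ᵁ ⊤) :=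
  chartFun (ProjectiveSpace.ι k n i) (ProjectiveSpace.coord k n i l)

lemma ProjectiveSpace.coord_self (i : Fin (n + 1)) : ProjectiveSpace.coord k n i i = 1 := by
  apply HomogeneousLocalization.val_injective
  refine (HomogeneousLocalization.Away.val_mk _ _ _ _ _).trans ?_
  rw [HomogeneousLocalization.val_one]
  simp only [pow_one]
  exact Localization.mk_self (⟨MvPolynomial.X i, 1, pow_one _⟩ : Submonoid.powers
    (MvPolynomial.X i : MvPolynomial (Fin (n + 1)) k))

lemma coordFun_self (i : Fin (n + 1)) : coordFun (k := k) i i = 1 :=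
  (congr_arg (chartFun (ProjectiveSpace.ι k n i)) (ProjectiveSpace.coord_self i)).trans
    (map_one (chartFun (ProjectiveSpace.ι k n i)))

variable {X : Scheme.{u}} (f : X ⟶ ProjectiveSpace k n) [FormallyUnramified f]

/-- A derivation killing the coordinates kills all functions pulled back from the chart, and `f`
being unramified it then kills everything on `X` over that chart. -/
lemma SheafDerivation.d_eq_zero_of_coord {N : X.Modules} (D : SheafDerivation (overField f) N)
    (i : Fin (n + 1))
    (hD : ∀ l, D.d (f ⁻¹ᵁ (ProjectiveSpace.ι k n i ''ᵁ ⊤)) ((f.app _).hom (coordFun i l)) = 0)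
    {U : X.Opens} (hU : U ≤ f ⁻¹ᵁ (ProjectiveSpace.ι k n i ''ᵁ ⊤)) (s : Γ(X, U)) :
    D.d U s = 0 := by
  have key : ∀ (V : X.Opens) (hV : IsAffineOpen V)
      (hVU : V ≤ f ⁻¹ᵁ (ProjectiveSpace.ι k n i ''ᵁ ⊤)) (s : Γ(X, V)), D.d V s = 0 := by
    intro V hV hVU s
    let φ := (f.appLE (ProjectiveSpace.ι k n i ''ᵁ ⊤) V hVU).hom
    have hφ : φ.FormallyUnramified :=
      f.formallyUnramified_appLE (isAffineOpen_image_top (ProjectiveSpace.ι k n i)) hV hVU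
    have : D.d V = 0 := by
      refine derivation_eq_zero φ hφ (D.d V) (D.d_mul V) fun a => ?_
      obtain ⟨x, rfl⟩ := chartFun_surjective (ProjectiveSpace.ι k n i) a
      let T : Subring (ProjectiveSpace.ChartRing k n i) :=
        { carrier := {x | D.d V (φ (chartFun (ProjectiveSpace.ι k n i) x)) = 0}
          zero_mem' := by simp only [Set.mem_ofPred_eq, map_zero]
          one_mem' := by
            simp only [Set.mem_ofPred_eq, map_one]
            exact D.d_app (one_mem _)
          add_mem' := fun {a b} ha hb => by
            simp only [Set.mem_ofPred_eq, map_add] at ha hb ⊢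
            rw [ha, hb, add_zero]
          neg_mem' := fun {a} ha => by
            simp only [Set.mem_ofPred_eq, map_neg] at ha ⊢
            rw [ha, neg_zero]
          mul_mem' := fun {a b} ha hb => by
            simp only [Set.mem_ofPred_eq, map_mul] at ha hb ⊢
            rw [D.d_mul, ha, hb, smul_zero, smul_zero, add_zero] }
      have hT : T = ⊤ := by
        refine ProjectiveSpace.eq_top_of_coord_mem i T (fun c => ?_) fun l => ?_
        · change D.d V (φ (chartFun (ProjectiveSpace.ι k n i) _)) = 0
          have h1 := chartFun_eq_structureMap (ProjectiveSpace.ι k n i) (ProjectiveSpace.str k n) _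
            (ProjectiveSpace.ι_str i) c
          have h2 : φ (chartFun (ProjectiveSpace.ι k n i) (ProjectiveSpace.strMap i c)) =
              structureMap (overField f) V c :=
            (congr_arg φ h1).trans (appLE_structureMap (ProjectiveSpace.str k n) f _ V hVU c)
          rw [h2]
          exact D.d_app (structureMap_mem_constants V c)
        · change D.d V (φ (coordFun i l)) = 0
          have h1 : φ (coordFun i l) = resO hVU ((f.app _).hom (coordFun i l)) := rfl
          rw [h1, D.d_resO, hD l, map_zero]
      have : x ∈ T := hT ▸ trivial
      exact this
    rw [this]
    rfl
  refine resM_eq_of_locally N fun x hx => ?_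
  obtain ⟨V, hV, hxV, hVU⟩ := exists_isAffineOpen_mem_and_subset (U := U) (x := x) hx
  have hVU' : V ≤ U := hVU
  refine ⟨V, hVU', hxV, ?_⟩
  rw [map_zero, ← D.d_resO]
  exact key V hV (hVU'.trans hU) _

end Coordinates

/-! ### Fibres of `ℰ` are spanned by the differentials of the coordinates -/

section PointValues

variable {K : Type u} [Field K]

lemma ΓSpec_inv_hom {A : CommRingCat.{u}} (x : Γ(Spec A, ⊤)) :
    (Scheme.ΓSpecIso A).inv.hom ((Scheme.ΓSpecIso A).hom.hom x) = x :=
  congr_arg (fun φ => φ.hom x) (Scheme.ΓSpecIso A).hom_inv_id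

/-- The structure sheaf of the spectrum of a field, pushed forward. -/
abbrev pointModule (K : Type u) [Field K] : (Spec (.of K)).Modules := structureModule _

variable {k : Type u} [Field k] {n : ℕ} {X 𝒳 V₀ : Scheme.{u}} (f : X ⟶ ProjectiveSpace k n)
  (m : 𝒳 ⟶ X) {E : 𝒳.Modules} (π : (Scheme.Modules.pullback m).obj (Differentials (overField f)) ⟶ E)
  (j : V₀ ⟶ 𝒳) {d : ℕ} (ξ : Spec (.of K) ⟶ V₀)

/-- Restriction to the point of a section of the direct image of its structure sheaf. -/
def pointValue (N : (Spec (.of K)).Modules) {W : 𝒳.Opens} (h : ⊤ ≤ ξ ⁻¹ᵁ j ⁻¹ᵁ W) :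
    Γ((Scheme.Modules.pushforward j).obj ((Scheme.Modules.pushforward ξ).obj N), W) →+ Γ(N, ⊤) :=
  resM N h

lemma pointValue_smul (N : (Spec (.of K)).Modules) {W : 𝒳.Opens} (h : ⊤ ≤ ξ ⁻¹ᵁ j ⁻¹ᵁ W)
    (c : Γ(𝒳, W)) (y) :
    pointValue j ξ N h (c • y) = ((ξ ≫ j).appLE W ⊤ h).hom c • pointValue j ξ N h y := by
  refine (resM_smul N h ((ξ.app _).hom ((j.app _).hom c)) y).trans ?_
  congr 1

variable [IsOpenImmersion j] (ψ : E.restrict j ≅ freeModule V₀ d)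

lemma top_le_preimage_image_top : ⊤ ≤ ξ ⁻¹ᵁ j ⁻¹ᵁ j ''ᵁ ⊤ := by
  rw [j.preimage_image_eq]
  rfl

/-- Linear functionals on the fibre of a locally free sheaf at a point. -/
lemma exists_functional (g : Fin d → K) :
    ∃ τ : E ⟶ (Scheme.Modules.pushforward j).obj ((Scheme.Modules.pushforward ξ).obj (pointModule K)),
      ∀ l, (pointValue j ξ (pointModule K) (top_le_preimage_image_top j ξ)
        (τ.app (j ''ᵁ ⊤) (trivBasis j ψ l)) : Γ(Spec (.of K), ⊤)) =
          (Scheme.ΓSpecIso (.of K)).inv.hom (g l) := by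
  obtain ⟨τ, hτ⟩ := (restrictHom_bijective j ψ ((Scheme.Modules.pushforward ξ).obj
    (pointModule K))).2 (fun l => (Scheme.ΓSpecIso (.of K)).inv.hom (g l))
  refine ⟨τ, fun l => ?_⟩
  exact congr_fun hτ l

lemma pointValue_eq_sum (τ : E ⟶ (Scheme.Modules.pushforward j).obj
      ((Scheme.Modules.pushforward ξ).obj (pointModule K))) (g : Fin d → K)
    (hτ : ∀ l, (pointValue j ξ (pointModule K) (top_le_preimage_image_top j ξ)
      (τ.app (j ''ᵁ ⊤) (trivBasis j ψ l)) : Γ(Spec (.of K), ⊤)) =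
        (Scheme.ΓSpecIso (.of K)).inv.hom (g l))
    {W : 𝒳.Opens} (hW : j ''ᵁ ⊤ ≤ W) (h : ⊤ ≤ ξ ⁻¹ᵁ j ⁻¹ᵁ W)
    (y : Γ(E, W)) (δ : Fin d → Γ(𝒳, j ''ᵁ ⊤))
    (hy : resM E hW y = ∑ c, δ c • trivBasis j ψ c) :
    (Scheme.ΓSpecIso (.of K)).hom.hom (pointValue j ξ (pointModule K) h (τ.app W y)) =
      ∑ c, value (ξ ≫ j) (U := j ''ᵁ ⊤) (top_le_preimage_image_top j ξ) (δ c) * g c := by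
  have e1 : pointValue j ξ (pointModule K) h (τ.app W y) =
      pointValue j ξ (pointModule K) (top_le_preimage_image_top j ξ)
        (τ.app (j ''ᵁ ⊤) (resM E hW y)) := by
    rw [app_resM]
    exact (resM_resM (pointModule K) _ _ _).symm
  rw [e1, hy, map_sum, map_sum]
  have e2 : ∀ c, pointValue j ξ (pointModule K) (top_le_preimage_image_top j ξ)
      (τ.app (j ''ᵁ ⊤) (δ c • trivBasis j ψ c)) =
      (((ξ ≫ j).appLE (j ''ᵁ ⊤) ⊤ (top_le_preimage_image_top j ξ)).hom (δ c) *
        (Scheme.ΓSpecIso (.of K)).inv.hom (g c) : Γ(Spec (.of K), ⊤)) := by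
    intro c
    rw [Scheme.Modules.Hom.app_smul, pointValue_smul, hτ]
    rfl
  have e3 : ∑ c, pointValue j ξ (pointModule K) (top_le_preimage_image_top j ξ)
      (τ.app (j ''ᵁ ⊤) (δ c • trivBasis j ψ c)) =
      (∑ c, (((ξ ≫ j).appLE (j ''ᵁ ⊤) ⊤ (top_le_preimage_image_top j ξ)).hom (δ c) *
        (Scheme.ΓSpecIso (.of K)).inv.hom (g c)) : Γ(Spec (.of K), ⊤)) :=
    Finset.sum_congr rfl fun c _ => e2 c
  rw [e3, map_sum]
  refine Finset.sum_congr rfl fun c _ => ?_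
  rw [map_mul]
  congr 1
  exact congr_arg (fun φ => φ.hom (g c)) (Scheme.ΓSpecIso (.of K)).inv_hom_id

/-- The differentials of the coordinates span the fibres of a quotient of the cotangent sheaf of an
unramified scheme over projective space. -/
lemma eq_zero_of_sum_value_mul_eq_zero [FormallyUnramified f] [Epi π] (i : Fin (n + 1))
    (hU : j ''ᵁ ⊤ ≤ m ⁻¹ᵁ f ⁻¹ᵁ (ProjectiveSpace.ι k n i ''ᵁ ⊤))
    (δ : Fin (n + 1) → Fin d → Γ(𝒳, j ''ᵁ ⊤))
    (hδ : ∀ l, resM E hU ((SheafDerivation.ofHom (transpose m π)).d _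
      ((f.app (ProjectiveSpace.ι k n i ''ᵁ ⊤)).hom (coordFun i l))) = ∑ c, δ l c • trivBasis j ψ c)
    (g : Fin d → K)
    (hg : ∀ l, ∑ c, value (ξ ≫ j) (U := j ''ᵁ ⊤) (top_le_preimage_image_top j ξ) (δ l c) * g c = 0) : g = 0 := by
  -- Realise `g` as a map from `E` to a module at the point. It kills all `dt_l`, so the derivation
  -- induced by `π ≫ τ` vanishes, and `τ = 0` because `π` is epi.
  obtain ⟨τ, hτ⟩ := exists_functional j ξ ψ g
  let N := (Scheme.Modules.pushforward j).obj ((Scheme.Modules.pushforward ξ).obj (pointModule K))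
  let U₀ := f ⁻¹ᵁ (ProjectiveSpace.ι k n i ''ᵁ ⊤)
  have hU' : ⊤ ≤ ξ ⁻¹ᵁ j ⁻¹ᵁ (m ⁻¹ᵁ U₀) :=
    (top_le_preimage_image_top j ξ).trans (ξ.preimage_mono (j.preimage_mono hU))
  let D : SheafDerivation (overField f) ((Scheme.Modules.pushforward m).obj N) :=
    SheafDerivation.ofHom (transpose m (π ≫ τ))
  have hDapp : ∀ (U : X.Opens) (s : Γ(X, U)), D.d U s =
      τ.app (m ⁻¹ᵁ U) ((SheafDerivation.ofHom (transpose m π)).d U s) := by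
    intro U s
    change (transpose m (π ≫ τ)).app U _ = _
    rw [transpose_comp]
    rfl
  have hinj : ∀ (W : 𝒳.Opens) (h : ⊤ ≤ ξ ⁻¹ᵁ j ⁻¹ᵁ W) (y : Γ(N, W)),
      pointValue j ξ (pointModule K) h y = 0 → y = 0 := by
    intro W h y hy
    have e := congr_arg (resM (pointModule K) (le_top : ξ ⁻¹ᵁ j ⁻¹ᵁ W ≤ ⊤)) hy
    rw [map_zero] at e
    refine Eq.trans ?_ e
    refine Eq.trans ?_ (resM_resM (pointModule K) _ h y).symm
    exact (resM_self (pointModule K) le_rfl y).symm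
  have hD : ∀ l, D.d U₀ ((f.app _).hom (coordFun i l)) = 0 := by
    intro l
    rw [hDapp]
    refine hinj _ hU' _ ?_
    have := (pointValue_eq_sum j ξ ψ τ g hτ hU hU' _ (δ l) (hδ l)).trans (hg l)
    have h2 := congr_arg (Scheme.ΓSpecIso (.of K)).inv.hom this
    rw [map_zero] at h2
    refine Eq.trans ?_ h2
    exact (ΓSpec_inv_hom _).symm
  -- Vanishing over the chart suffices on any open set, since the target is a direct image from a
  -- point lying over the chart.
  have hD0 : ∀ (U : X.Opens) (s : Γ(X, U)), D.d U s = 0 := by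
    intro U s
    refine resM_eq_of_locally (pointModule K) (U := ξ ⁻¹ᵁ j ⁻¹ᵁ m ⁻¹ᵁ U) fun y hy => ?_
    have hle : ξ ⁻¹ᵁ j ⁻¹ᵁ m ⁻¹ᵁ (U ⊓ U₀) ≤ ξ ⁻¹ᵁ j ⁻¹ᵁ m ⁻¹ᵁ U :=
      ξ.preimage_mono (j.preimage_mono (m.preimage_mono inf_le_left))
    refine ⟨ξ ⁻¹ᵁ j ⁻¹ᵁ m ⁻¹ᵁ (U ⊓ U₀), hle, ⟨hy, hU' (x := y) trivial⟩, ?_⟩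
    refine ((D.d_resO (inf_le_left : U ⊓ U₀ ≤ U) s).symm.trans ?_).trans
      (map_zero (resM (pointModule K) hle)).symm
    exact D.d_eq_zero_of_coord f i hD inf_le_right _
  have h1 : transpose m (π ≫ τ) = 0 := by
    apply Differentials.hom_ext
    intro U s
    exact (hD0 U s).trans rfl
  have h2 : τ = 0 := by
    rw [← cancel_epi π, comp_zero]
    exact (transpose_eq_zero_iff m _).mp h1
  funext c
  have h3 := hτ c
  rw [h2] at h3
  have h4 := congr_arg (Scheme.ΓSpecIso (.of K)).hom.hom h3
  have h5 : (Scheme.ΓSpecIso (.of K)).hom.hom ((Scheme.ΓSpecIso (.of K)).inv.hom (g c)) = g c :=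
    congr_arg (fun φ => φ.hom (g c)) (Scheme.ΓSpecIso (.of K)).inv_hom_id
  rw [h5] at h4
  exact h4.symm.trans ((congr_arg _ (map_zero (pointValue j ξ (pointModule K) _))).trans
    (map_zero _))

/-- The coordinates and their differentials are linearly independent at every point. -/
theorem linearIndependent_coordinates [FormallyUnramified f] [Epi π] (i : Fin (n + 1))
    (hU : j ''ᵁ ⊤ ≤ m ⁻¹ᵁ f ⁻¹ᵁ (ProjectiveSpace.ι k n i ''ᵁ ⊤))
    (δ : Fin (n + 1) → Fin d → Γ(𝒳, j ''ᵁ ⊤))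
    (hδ : ∀ l, resM E hU ((SheafDerivation.ofHom (transpose m π)).d _
      ((f.app (ProjectiveSpace.ι k n i ''ᵁ ⊤)).hom (coordFun i l))) = ∑ c, δ l c • trivBasis j ψ c)
    (p : Fin (n + 1) → K) (hp : p i = 1) :
    LinearIndependent K (Fin.cons p (fun c l =>
      value (ξ ≫ j) (U := j ''ᵁ ⊤) (top_le_preimage_image_top j ξ) (δ l c)) : Fin (d + 1) → Fin (n + 1) → K) := by
  rw [linearIndependent_finCons]
  constructor
  · rw [Fintype.linearIndependent_iff]
    intro g hg
    refine congr_fun (eq_zero_of_sum_value_mul_eq_zero f m π j ξ ψ i hU δ hδ g fun l => ?_)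
    have := congr_fun hg l
    simpa [mul_comm] using this
  -- The coordinate `Xᵢ / Xᵢ` is `1` and has zero differential, so all the other vectors vanish in
  -- position `i`, where `p` is `1`.
  · have h0 : ∀ c, value (ξ ≫ j) (U := j ''ᵁ ⊤) (top_le_preimage_image_top j ξ) (δ i c) = 0 := by
      intro c
      obtain ⟨τ, hτ⟩ := exists_functional j ξ ψ (Pi.single c (1 : K))
      have hU' : ⊤ ≤ ξ ⁻¹ᵁ j ⁻¹ᵁ (m ⁻¹ᵁ f ⁻¹ᵁ (ProjectiveSpace.ι k n i ''ᵁ ⊤)) :=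
        (top_le_preimage_image_top j ξ).trans (ξ.preimage_mono (j.preimage_mono hU))
      have h1 := pointValue_eq_sum j ξ ψ τ _ hτ hU hU' _ (δ i) (hδ i)
      have h2 : (SheafDerivation.ofHom (transpose m π)).d _
          ((f.app (ProjectiveSpace.ι k n i ''ᵁ ⊤)).hom (coordFun i i)) = 0 := by
        rw [coordFun_self, map_one]
        exact (SheafDerivation.ofHom (transpose m π)).d_app (one_mem _)
      have h3 : (Scheme.ΓSpecIso (.of K)).hom.hom (pointValue j ξ (pointModule K) hU' (τ.app _
          (0 : Γ(E, m ⁻¹ᵁ f ⁻¹ᵁ (ProjectiveSpace.ι k n i ''ᵁ ⊤))))) = 0 :=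
        (congr_arg _ ((congr_arg _ (map_zero _)).trans (map_zero _))).trans (map_zero _)
      replace h1 := ((congr_arg (fun y => (Scheme.ΓSpecIso (.of K)).hom.hom
        (pointValue j ξ (pointModule K) hU' (τ.app _ y))) h2).trans h3).symm.trans h1
      simpa [Pi.single_apply] using h1.symm
    intro hmem
    obtain ⟨g, hg⟩ := (Submodule.mem_span_range_iff_exists_fun K).mp hmem
    have h1 := congr_fun hg i
    rw [hp] at h1
    simp [h0] at h1

end PointValues

/-! ### Ideal sheaves given by compatible equations on charts -/

section IdealSheaves

variable {Y Z D T H : Scheme.{u}}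

lemma comap_ofIdealTop [IsAffine T] [IsAffine D] (a : T ⟶ D) (I : Ideal Γ(D, ⊤)) :
    (Scheme.IdealSheafData.ofIdealTop I).comap a =
      Scheme.IdealSheafData.ofIdealTop (I.map a.appTop.hom) := by
  apply le_antisymm
  · rw [← Scheme.IdealSheafData.le_map_iff_comap_le]
    apply Scheme.IdealSheafData.le_of_isAffine
    rw [Scheme.IdealSheafData.ideal_map_of_isAffineHom]
    simp only [Scheme.IdealSheafData.ofIdealTop_ideal]
    intro x hx
    have e : (D.presheaf.map (homOfLE (le_top : (⊤ : D.Opens) ≤ ⊤)).op).hom = RingHom.id _ :=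
      congr_arg CommRingCat.Hom.hom (D.presheaf.map_id _)
    have e' : (T.presheaf.map (homOfLE (le_top : (⊤ : T.Opens) ≤ ⊤)).op).hom = RingHom.id _ :=
      congr_arg CommRingCat.Hom.hom (T.presheaf.map_id _)
    rw [Ideal.mem_comap]
    have hx' : x ∈ I := by
      have : x ∈ I.map (RingHom.id _) := e ▸ hx
      rwa [Ideal.map_id] at this
    have h1 := Ideal.mem_map_of_mem a.appTop.hom hx'
    have h2 : a.appTop.hom x ∈ (I.map a.appTop.hom).map (RingHom.id _) := by rwa [Ideal.map_id]
    rw [← e'] at h2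
    exact h2
  · apply Scheme.IdealSheafData.le_of_isAffine
    simp only [Scheme.IdealSheafData.ofIdealTop_ideal]
    have e' : (T.presheaf.map (homOfLE (le_top : (⊤ : T.Opens) ≤ ⊤)).op).hom = RingHom.id _ :=
      congr_arg CommRingCat.Hom.hom (T.presheaf.map_id _)
    rw [show Ideal.map (T.presheaf.map (homOfLE (le_top : (⊤ : T.Opens) ≤ ⊤)).op).hom
      (I.map a.appTop.hom) = I.map a.appTop.hom from (congr_arg (fun φ => Ideal.map φ _) e').trans
        (Ideal.map_id _), Ideal.map_le_iff_le_comap]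
    have h := Scheme.IdealSheafData.le_map_comap (Scheme.IdealSheafData.ofIdealTop I) a
      ⟨⊤, isAffineOpen_top D⟩
    rw [Scheme.IdealSheafData.ideal_map_of_isAffineHom] at h
    simp only [Scheme.IdealSheafData.ofIdealTop_ideal] at h
    have e : (D.presheaf.map (homOfLE (le_top : (⊤ : D.Opens) ≤ ⊤)).op).hom = RingHom.id _ :=
      congr_arg CommRingCat.Hom.hom (D.presheaf.map_id _)
    rw [show Ideal.map (D.presheaf.map (homOfLE (le_top : (⊤ : D.Opens) ≤ ⊤)).op).hom I = I from
      (congr_arg (fun φ => Ideal.map φ _) e).trans (Ideal.map_id _)] at h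
    exact h

lemma mem_ideal_ofIdealTop_top [IsAffine T] (I : Ideal Γ(T, ⊤)) :
    (Scheme.IdealSheafData.ofIdealTop I).ideal ⟨⊤, isAffineOpen_top T⟩ = I := by
  rw [Scheme.IdealSheafData.ofIdealTop_ideal]
  have e : (T.presheaf.map (homOfLE (le_top : (⊤ : T.Opens) ≤ ⊤)).op).hom = RingHom.id _ :=
    congr_arg CommRingCat.Hom.hom (T.presheaf.map_id _)
  exact (congr_arg (fun φ => Ideal.map φ I) e).trans (Ideal.map_id _)

/-- An ideal sheaf that is given by compatible equations on affine charts restricts to the ideal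
generated by these equations. -/
lemma comap_iInf_map {ι : Type*} [Finite ι] {D : ι → Scheme.{u}} [∀ α, IsAffine (D α)]
    (c : ∀ α, D α ⟶ Z) [∀ α, IsOpenImmersion (c α)] [∀ α, QuasiCompact (c α)] {r : ℕ}
    (e : ∀ α, Fin r → Γ(D α, ⊤))
    (he : ∀ (α β : ι) (T : Scheme.{u}) (a : T ⟶ D α) (b : T ⟶ D β), a ≫ c α = b ≫ c β →
      (∀ x, b.appTop.hom (e β x) = 0) → ∀ x, a.appTop.hom (e α x) = 0) (α : ι) :
    (⨅ β, (Scheme.IdealSheafData.ofIdealTop (Ideal.span (Set.range (e β)))).map (c β)).comap (c α) =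
      Scheme.IdealSheafData.ofIdealTop (Ideal.span (Set.range (e α))) := by
  apply le_antisymm
  · rw [← Scheme.IdealSheafData.le_map_iff_comap_le]
    exact iInf_le _ α
  · apply Scheme.IdealSheafData.le_of_isAffine
    rw [mem_ideal_ofIdealTop_top, Scheme.IdealSheafData.ideal_comap_of_isOpenImmersion,
      Scheme.IdealSheafData.ideal_iInf, Ideal.span_le]
    rintro _ ⟨x, rfl⟩
    rw [SetLike.mem_coe, Ideal.mem_comap, iInf_apply, Ideal.mem_iInf]
    intro β
    -- The direct image ideal consists of the functions vanishing on the closed subscheme `K` of `D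
    -- β`. On the part `W` of it lying over `D α` the equations `e β` vanish, hence by compatibility
    -- so do the `e α`.
    let K := Scheme.IdealSheafData.ofIdealTop (Ideal.span (Set.range (e β)))
    change _ ∈ (K.subschemeι ≫ c β).ker.ideal _
    rw [Scheme.Hom.ker_apply, RingHom.mem_ker]
    let V := c α ''ᵁ ⊤
    let q := K.subschemeι ≫ c β
    let W := q ⁻¹ᵁ V
    have hr : Set.range (W.ι ≫ q) ⊆ Set.range (c α) := by
      rintro _ ⟨w, rfl⟩
      have : q w.1 ∈ V := w.2
      obtain ⟨y, -, hy⟩ := this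
      exact ⟨y, hy⟩
    let a : W.toScheme ⟶ D α := IsOpenImmersion.lift (c α) (W.ι ≫ q) hr
    have ha : a ≫ c α = (W.ι ≫ K.subschemeι) ≫ c β :=
      (IsOpenImmersion.lift_fac _ _ _).trans (Category.assoc _ _ _).symm
    have h0 : ∀ y, (W.ι ≫ K.subschemeι).appTop.hom (e β y) = 0 := by
      intro y
      have h1 : K.subschemeι.appTop.hom (e β y) = 0 := by
        have h2 : e β y ∈ RingHom.ker (K.subschemeι.app
            (⟨⊤, isAffineOpen_top (D β)⟩ : (D β).affineOpens)).hom := by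
          rw [Scheme.IdealSheafData.ker_subschemeι_app, mem_ideal_ofIdealTop_top]
          exact Ideal.subset_span ⟨y, rfl⟩
        exact h2
      rw [Scheme.Hom.comp_appTop]
      exact (congr_arg W.ι.appTop.hom h1).trans (map_zero _)
    have h1 := he α β W.toScheme a (W.ι ≫ K.subschemeι) ha h0 x
    have hV : ⊤ ≤ (W.ι ≫ q) ⁻¹ᵁ V := by
      rintro w -
      exact w.2
    have h2 : (c α).appLE V ⊤ ((c α).preimage_image_eq ⊤).ge = ((c α).appIso ⊤).hom := by
      rw [Scheme.Hom.appIso_hom']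
    have h3 : ∀ s : Γ(Z, V), (W.ι.appLE W ⊤ (Scheme.Opens.ι_preimage_self W).ge).hom ((q.app V).hom s) =
        a.appTop.hom (((c α).appIso ⊤).hom.hom s) := by
      intro s
      have e1 : q.app V ≫ W.ι.appLE W ⊤ (Scheme.Opens.ι_preimage_self W).ge =
          (W.ι ≫ q).appLE V ⊤ hV := by
        rw [Scheme.Hom.app_eq_appLE, Scheme.Hom.appLE_comp_appLE]
      have e2 : ((c α).appIso ⊤).hom ≫ a.appTop = (W.ι ≫ q).appLE V ⊤ hV := by
        have e3 : a.appTop = a.appLE ⊤ ⊤ le_top := Scheme.Hom.app_eq_appLE _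
        rw [← h2, e3]
        refine (Scheme.Hom.appLE_comp_appLE _ _ _ _ _ _ _).trans ?_
        congr 1
      exact congr_arg (fun φ => φ.hom s) (e1.trans e2.symm)
    have h4 : Function.Injective (W.ι.appLE W ⊤ (Scheme.Opens.ι_preimage_self W).ge).hom := by
      have : IsIso (W.ι.appLE W ⊤ (Scheme.Opens.ι_preimage_self W).ge) := by
        have := Scheme.Opens.ι_appIso W
        have h5 : W.ι.appLE (W.ι ''ᵁ ⊤) ⊤ (W.ι.preimage_image_eq ⊤).ge = (W.ι.appIso ⊤).hom := by
          rw [Scheme.Hom.appIso_hom']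
        have h7 : W = W.ι ''ᵁ ⊤ := by rw [Scheme.Hom.image_top_eq_opensRange, Scheme.Opens.opensRange_ι]
        have h8 : ∀ (W' : K.subscheme.Opens) (hW : W' = W.ι ''ᵁ ⊤) (hle : ⊤ ≤ W.ι ⁻¹ᵁ W'),
            IsIso (W.ι.appLE W' ⊤ hle) := by
          rintro _ rfl hle
          rw [h5]
          infer_instance
        exact h8 W h7 _
      exact (ConcreteCategory.bijective_of_isIso _).1
    apply h4
    refine (h3 _).trans ?_
    rw [map_zero]
    refine Eq.trans (congr_arg a.appTop.hom ?_) h1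
    exact congr_arg (fun φ => φ.hom (e α x)) ((c α).appIso ⊤).inv_hom_id

/-- Sections of the ideal of a closed subscheme, in terms of equations on an affine chart. -/
lemma app_eq_zero_iff_mem_span {i : H ⟶ Y} [IsClosedImmersion i] {J : Z.IdealSheafData} {g : Y ⟶ Z}
    (hi : i.ker = J.comap g) [IsAffine D] [IsAffine T] (c : D ⟶ Z) {r : ℕ} (e : Fin r → Γ(D, ⊤))
    (hc : J.comap c = Scheme.IdealSheafData.ofIdealTop (Ideal.span (Set.range e)))
    (v : T ⟶ Y) [IsOpenImmersion v] (a : T ⟶ D) (h : a ≫ c = v ≫ g) (s : Γ(Y, v ''ᵁ ⊤)) :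
    (i.app (v ''ᵁ ⊤)).hom s = 0 ↔
      (v.appIso ⊤).hom.hom s ∈ Ideal.span (Set.range fun x => a.appTop.hom (e x)) := by
  have h1 : i.ker.comap v = Scheme.IdealSheafData.ofIdealTop
      (Ideal.span (Set.range fun x => a.appTop.hom (e x))) := by
    rw [hi, ← Scheme.IdealSheafData.comap_comp, ← h, Scheme.IdealSheafData.comap_comp, hc,
      comap_ofIdealTop, Ideal.map_span, ← Set.range_comp]
    rfl
  have h2 := congr_arg (fun J => J.ideal ⟨⊤, isAffineOpen_top T⟩) h1
  simp only [mem_ideal_ofIdealTop_top] at h2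
  rw [Scheme.IdealSheafData.ideal_comap_of_isOpenImmersion, Scheme.Hom.ker_apply] at h2
  rw [← h2, Ideal.mem_comap, RingHom.mem_ker]
  have h3 : (v.appIso ⊤).inv.hom ((v.appIso ⊤).hom.hom s) = s :=
    congr_arg (fun φ => φ.hom s) (v.appIso ⊤).hom_inv_id
  exact Eq.congr (congr_arg (i.app (v ''ᵁ ⊤)).hom h3.symm) rfl

end IdealSheaves

/-! ### Change of charts for the incidence equations -/

section Transitions

attribute [local instance] MvPolynomial.gradedAlgebra

variable {k : Type u} [Field k] {n r N : ℕ} {S : Scheme.{u}}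

/-- The vector of coordinates of a morphism to the standard open `{Xᵢ ≠ 0}`. -/
def pointVector {i : Fin (n + 1)} (h : S ⟶ Spec (.of (ProjectiveSpace.ChartRing k n i)))
    (j : Fin (n + 1)) : Γ(S, ⊤) :=
  h.appTop.hom ((Scheme.ΓSpecIso (.of (ProjectiveSpace.ChartRing k n i))).inv.hom
    (ProjectiveSpace.coord k n i j))

lemma pointVector_comp_specMap {i : Fin (n + 1)} {A : CommRingCat.{u}}
    (φ : CommRingCat.of (ProjectiveSpace.ChartRing k n i) ⟶ A) (g : S ⟶ Spec A)
    (j : Fin (n + 1)) : pointVector (g ≫ Spec.map φ) j =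
      g.appTop.hom ((Scheme.ΓSpecIso A).inv.hom (φ.hom (ProjectiveSpace.coord k n i j))) := by
  have := congr_arg (fun ψ => g.appTop.hom (ψ.hom (ProjectiveSpace.coord k n i j)))
    (Scheme.ΓSpecIso_inv_naturality φ)
  exact this.symm

lemma awayMap_coord (i i' : Fin (n + 1)) (x : MvPolynomial (Fin (n + 1)) k)
    (hx : x = MvPolynomial.X i * MvPolynomial.X i') (l : Fin (n + 1)) :
    (HomogeneousLocalization.awayMap (MvPolynomial.homogeneousSubmodule (Fin (n + 1)) k)
      (MvPolynomial.isHomogeneous_X k i') hx (ProjectiveSpace.coord k n i l)).val =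
        Localization.mk (MvPolynomial.X l * MvPolynomial.X i')
          (⟨x, 1, pow_one _⟩ : Submonoid.powers x) := by
  refine (congr_arg HomogeneousLocalization.val
    (HomogeneousLocalization.awayMap_mk _ _ _ _ _ _ _)).trans ?_
  refine (HomogeneousLocalization.Away.val_mk _ _ _ _ _).trans ?_
  simp only [pow_one]

lemma awayMap_coord_mul (i i' : Fin (n + 1)) (x : MvPolynomial (Fin (n + 1)) k)
    (hx : x = MvPolynomial.X i * MvPolynomial.X i')
    (hx' : x = MvPolynomial.X i' * MvPolynomial.X i) (j : Fin (n + 1)) :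
    HomogeneousLocalization.awayMap (MvPolynomial.homogeneousSubmodule (Fin (n + 1)) k)
      (MvPolynomial.isHomogeneous_X k i') hx (ProjectiveSpace.coord k n i j) =
    HomogeneousLocalization.awayMap (MvPolynomial.homogeneousSubmodule (Fin (n + 1)) k)
      (MvPolynomial.isHomogeneous_X k i') hx (ProjectiveSpace.coord k n i i') *
    HomogeneousLocalization.awayMap (MvPolynomial.homogeneousSubmodule (Fin (n + 1)) k)
      (MvPolynomial.isHomogeneous_X k i) hx' (ProjectiveSpace.coord k n i' j) := by
  apply HomogeneousLocalization.val_injective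
  rw [HomogeneousLocalization.val_mul, awayMap_coord, awayMap_coord, awayMap_coord,
    Localization.mk_mul, Localization.mk_eq_mk_iff, Localization.r_iff_exists]
  refine ⟨1, ?_⟩
  simp only [OneMemClass.coe_one, one_mul, Submonoid.coe_mul]
  rw [hx]
  ring

/-- The fibre product of the two standard opens over projective space is the standard open of `Xᵢ
Xᵢ'`. -/
lemma exists_factorisation_awayMap {i i' : Fin (n + 1)}
    (h : S ⟶ Spec (.of (ProjectiveSpace.ChartRing k n i)))
    (h' : S ⟶ Spec (.of (ProjectiveSpace.ChartRing k n i')))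
    (e : h ≫ ProjectiveSpace.ι k n i = h' ≫ ProjectiveSpace.ι k n i')
    (x : MvPolynomial (Fin (n + 1)) k) (hx : x = MvPolynomial.X i * MvPolynomial.X i')
    (hx' : x = MvPolynomial.X i' * MvPolynomial.X i) :
    ∃ g : S ⟶ Spec (.of (HomogeneousLocalization.Away
        (MvPolynomial.homogeneousSubmodule (Fin (n + 1)) k) x)),
      g ≫ Spec.map (CommRingCat.ofHom (HomogeneousLocalization.awayMap
        (MvPolynomial.homogeneousSubmodule (Fin (n + 1)) k)
        (MvPolynomial.isHomogeneous_X k i') hx)) = h ∧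
      g ≫ Spec.map (CommRingCat.ofHom (HomogeneousLocalization.awayMap
        (MvPolynomial.homogeneousSubmodule (Fin (n + 1)) k)
        (MvPolynomial.isHomogeneous_X k i) hx')) = h' := by
  refine ⟨pullback.lift h h' e ≫ (Proj.pullbackAwayιIso
    (MvPolynomial.homogeneousSubmodule (Fin (n + 1)) k) (MvPolynomial.isHomogeneous_X k i) one_pos
    (MvPolynomial.isHomogeneous_X k i') one_pos hx).hom, ?_, ?_⟩
  · refine (Category.assoc _ _ _).trans ((congr_arg (pullback.lift h h' e ≫ ·)
      (Proj.pullbackAwayιIso_hom_SpecMap_awayMap_left _ _ _ _ _ _)).trans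
      (pullback.lift_fst _ _ _))
  · refine (Category.assoc _ _ _).trans ((congr_arg (pullback.lift h h' e ≫ ·)
      (Proj.pullbackAwayιIso_hom_SpecMap_awayMap_right _ _ _ _ _ _)).trans
      (pullback.lift_snd _ _ _))

lemma pointVector_transition {i i' : Fin (n + 1)}
    (h : S ⟶ Spec (.of (ProjectiveSpace.ChartRing k n i)))
    (h' : S ⟶ Spec (.of (ProjectiveSpace.ChartRing k n i')))
    (e : h ≫ ProjectiveSpace.ι k n i = h' ≫ ProjectiveSpace.ι k n i') (j : Fin (n + 1)) :
    pointVector h j = pointVector h i' * pointVector h' j := by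
  obtain ⟨x, hx, hx'⟩ : ∃ x : MvPolynomial (Fin (n + 1)) k,
      x = MvPolynomial.X i * MvPolynomial.X i' ∧ x = MvPolynomial.X i' * MvPolynomial.X i :=
    ⟨_, rfl, mul_comm _ _⟩
  obtain ⟨g, h1, h2⟩ := exists_factorisation_awayMap h h' e x hx hx'
  rw [← h1, ← h2, pointVector_comp_specMap, pointVector_comp_specMap, pointVector_comp_specMap,
    ← map_mul, ← map_mul]
  exact congr_arg (fun y => g.appTop.hom ((Scheme.ΓSpecIso _).inv.hom y))
    (awayMap_coord_mul i i' x hx hx' j)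

/-- Two charts of glued data meet exactly in the overlap, where the transition renormalises the
matrix by left multiplication. -/
lemma exists_pointMatrix_eq_mul {I J : Fin r ↪ Fin N} (h : S ⟶ chart k I) (h' : S ⟶ chart k J)
    (e : h ≫ Grassmannian.ι k N r I = h' ≫ Grassmannian.ι k N r J) :
    ∃ P : Matrix (Fin r) (Fin r) Γ(S, ⊤), pointMatrix h = P * pointMatrix h' := by
  obtain ⟨g, hg, hg'⟩ := PullbackCone.IsLimit.lift' ((grassmannianGlueData k N r).vPullbackConeIsLimit
    ⟨J⟩ ⟨I⟩) h' h e.symm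
  have h1 : g ≫ overlapι k J I = h' := hg
  have h2 : g ≫ overlapTransition k J I ≫ overlapι k I J = h := hg'
  have := pointMatrix_transition g
  exact ⟨_, by rw [← h1, ← h2]; exact this⟩

lemma appTop_incidenceEquation {i : Fin (n + 1)} {I : Fin r ↪ Fin (n + 1)}
    (a : S ⟶ ProductChart k n r i I) (x : Fin r) :
    a.appTop.hom (incidenceEquation k n r i I x) =
      ∑ j, pointMatrix (a ≫ pullback.snd _ _) x j * pointVector (a ≫ pullback.fst _ _) j := by
  rw [incidenceEquation, map_sum]
  refine Finset.sum_congr rfl fun j _ => ?_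
  rw [map_mul]
  rfl

lemma productChartι_fst (i : Fin (n + 1)) (I : Fin r ↪ Fin (n + 1)) :
    productChartι k n r i I ≫ pullback.fst _ _ = pullback.fst _ _ ≫ ProjectiveSpace.ι k n i :=
  pullback.lift_fst _ _ _

lemma productChartι_snd (i : Fin (n + 1)) (I : Fin r ↪ Fin (n + 1)) :
    productChartι k n r i I ≫ pullback.snd _ _ =
      pullback.snd _ _ ≫ Grassmannian.ι k (n + 1) r I :=
  pullback.lift_snd _ _ _

/-- The equations of the incidence variety on different charts agree. -/
lemma incidenceEquation_compatible {i i' : Fin (n + 1)} {I I' : Fin r ↪ Fin (n + 1)}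
    (a : S ⟶ ProductChart k n r i I) (b : S ⟶ ProductChart k n r i' I')
    (e : a ≫ productChartι k n r i I = b ≫ productChartι k n r i' I')
    (h : ∀ x, b.appTop.hom (incidenceEquation k n r i' I' x) = 0) (x : Fin r) :
    a.appTop.hom (incidenceEquation k n r i I x) = 0 := by
  have e1 : (a ≫ pullback.fst _ _) ≫ ProjectiveSpace.ι k n i =
      (b ≫ pullback.fst _ _) ≫ ProjectiveSpace.ι k n i' := by
    rw [Category.assoc, Category.assoc, ← productChartι_fst, ← productChartι_fst,
      reassoc_of% e]
  have e2 : (a ≫ pullback.snd _ _) ≫ Grassmannian.ι k (n + 1) r I =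
      (b ≫ pullback.snd _ _) ≫ Grassmannian.ι k (n + 1) r I' := by
    rw [Category.assoc, Category.assoc, ← productChartι_snd, ← productChartι_snd,
      reassoc_of% e]
  obtain ⟨P, hP⟩ := exists_pointMatrix_eq_mul _ _ e2
  rw [appTop_incidenceEquation]
  simp only [appTop_incidenceEquation] at h
  -- The vector changes by the scalar `Xᵢ' / Xᵢ` and the matrix by `P` on the left, so the first
  -- equations are combinations of the second.
  have h3 : ∑ j, pointMatrix (a ≫ pullback.snd _ _) x j * pointVector (a ≫ pullback.fst _ _) j =
      pointVector (a ≫ pullback.fst _ _) i' * ∑ y, P x y *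
        ∑ j, pointMatrix (b ≫ pullback.snd _ _) y j * pointVector (b ≫ pullback.fst _ _) j := by
    simp only [Finset.mul_sum]
    rw [Finset.sum_comm]
    refine Finset.sum_congr rfl fun j _ => ?_
    rw [hP, Matrix.mul_apply, pointVector_transition _ _ e1, Finset.sum_mul]
    refine Finset.sum_congr rfl fun y _ => ?_
    ring
  rw [h3]
  simp only [h, mul_zero, Finset.sum_const_zero]

end Transitions

lemma comap_iInf_iInf_map {ι κ : Type*} [Finite ι] [Finite κ] {Z : Scheme.{u}}
    {D : ι → κ → Scheme.{u}} [∀ i j, IsAffine (D i j)]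
    (c : ∀ i j, D i j ⟶ Z) [∀ i j, IsOpenImmersion (c i j)] [∀ i j, QuasiCompact (c i j)] {r : ℕ}
    (e : ∀ i j, Fin r → Γ(D i j, ⊤))
    (he : ∀ (i i' : ι) (j j' : κ) (T : Scheme.{u}) (a : T ⟶ D i j) (b : T ⟶ D i' j'),
      a ≫ c i j = b ≫ c i' j' →
      (∀ x, b.appTop.hom (e i' j' x) = 0) → ∀ x, a.appTop.hom (e i j x) = 0) (i : ι) (j : κ) :
    (⨅ (i') (j'), (Scheme.IdealSheafData.ofIdealTop
      (Ideal.span (Set.range (e i' j')))).map (c i' j')).comap (c i j) =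
      Scheme.IdealSheafData.ofIdealTop (Ideal.span (Set.range (e i j))) := by
  have h := comap_iInf_map (fun α : ι × κ => c α.1 α.2) (fun α => e α.1 α.2)
    (fun α β T a b => he α.1 β.1 α.2 β.2 T a b) (i, j)
  rwa [iInf_prod] at h

/-! ### Finiteness conditions on charts and the incidence ideal on them -/

section Finiteness

attribute [local instance] MvPolynomial.gradedAlgebra

variable (k : Type u) [Field k] (n r : ℕ)

instance finiteType_degreeZero :
    Algebra.FiniteType (MvPolynomial.homogeneousSubmodule (Fin (n + 1)) k 0)
      (MvPolynomial (Fin (n + 1)) k) := by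
  classical
  refine ⟨⟨Finset.univ.image MvPolynomial.X, ?_⟩⟩
  rw [eq_top_iff]
  intro x _
  induction x using MvPolynomial.induction_on with
  | C c =>
    exact Subalgebra.algebraMap_mem (Algebra.adjoin _ _)
      (algebraMap k (MvPolynomial.homogeneousSubmodule (Fin (n + 1)) k 0) c)
  | add p q hp hq => exact add_mem (hp trivial) (hq trivial)
  | mul_X p j hp => exact mul_mem (hp trivial) (Algebra.subset_adjoin (by simp))

lemma surjective_algebraMap_degreeZero :
    Function.Surjective (algebraMap k (MvPolynomial.homogeneousSubmodule (Fin (n + 1)) k 0)) := by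
  rintro ⟨a, ha⟩
  refine ⟨MvPolynomial.coeff 0 a, Subtype.ext ?_⟩
  exact (MvPolynomial.totalDegree_eq_zero_iff_eq_C.mp
    (Nat.le_zero.mp (MvPolynomial.IsHomogeneous.totalDegree_le ha))).symm

instance : LocallyOfFiniteType (ProjectiveSpace.str k n) := by
  have h1 : LocallyOfFiniteType (Proj.toSpecZero (MvPolynomial.homogeneousSubmodule (Fin (n + 1)) k)) :=
    inferInstance
  have h2 : LocallyOfFiniteType (Spec.map (CommRingCat.ofHom
      (algebraMap k (MvPolynomial.homogeneousSubmodule (Fin (n + 1)) k 0)))) :=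
    (HasRingHomProperty.Spec_iff (P := @LocallyOfFiniteType)).mpr
      (RingHom.FiniteType.of_surjective _ (surjective_algebraMap_degreeZero k n))
  exact MorphismProperty.comp_mem @LocallyOfFiniteType _ _ h1 h2

instance : QuasiCompact (ProjectiveSpace.str k n) := by
  have h1 : QuasiCompact (Proj.toSpecZero (MvPolynomial.homogeneousSubmodule (Fin (n + 1)) k)) :=
    inferInstance
  have h2 : QuasiCompact (Spec.map (CommRingCat.ofHom
      (algebraMap k (MvPolynomial.homogeneousSubmodule (Fin (n + 1)) k 0)))) := inferInstance
  exact MorphismProperty.comp_mem @QuasiCompact _ _ h1 h2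

instance (I : Fin r ↪ Fin (n + 1)) : LocallyOfFiniteType (chartStr k I) :=
  (HasRingHomProperty.Spec_iff (P := @LocallyOfFiniteType)).mpr
    (RingHom.finiteType_algebraMap.mpr inferInstance)

variable (i : Fin (n + 1)) (I : Fin r ↪ Fin (n + 1))

instance : LocallyOfFiniteType (ProjectiveSpace.ι k n i ≫ ProjectiveSpace.str k n) :=
  MorphismProperty.comp_mem @LocallyOfFiniteType _ _ inferInstance inferInstance

instance : LocallyOfFiniteType (Grassmannian.ι k (n + 1) r I ≫ Grassmannian.str k (n + 1) r) := by
  rw [Grassmannian.ι_str]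
  infer_instance

instance : IsAffine (chart k I) := inferInstanceAs (IsAffine (Spec _))

instance : IsAffine (ProductChart k n r i I) := inferInstance

/-- A Noetherian source makes the inclusion of the product of charts quasi-compact, as
`comap_iInf_iInf_map` asks. -/
instance : IsNoetherian (ProductChart k n r i I) := by
  have : IsLocallyNoetherian (Spec (.of (ProjectiveSpace.ChartRing k n i))) :=
    LocallyOfFiniteType.isLocallyNoetherian (ProjectiveSpace.ι k n i ≫ ProjectiveSpace.str k n)
  have : IsLocallyNoetherian (ProductChart k n r i I) := inferInstance
  exact { }

instance : IsOpenImmersion (productChartι k n r i I) :=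
  Scheme.pullback_map_isOpenImmersion (ProjectiveSpace.ι k n i ≫ ProjectiveSpace.str k n)
    (Grassmannian.ι k (n + 1) r I ≫ Grassmannian.str k (n + 1) r) (ProjectiveSpace.str k n)
    (Grassmannian.str k (n + 1) r) (ProjectiveSpace.ι k n i) (Grassmannian.ι k (n + 1) r I) (𝟙 _)
    (Category.comp_id _) (Category.comp_id _)

/-- On a product of charts the ideal of the incidence variety is generated by the linear forms. -/
lemma comap_incidenceIdeal : (incidenceIdeal k n r).comap (productChartι k n r i I) =
    Scheme.IdealSheafData.ofIdealTop (Ideal.span (Set.range (incidenceEquation k n r i I))) := by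
  exact comap_iInf_iInf_map (fun i I => productChartι k n r i I) (fun i I => incidenceEquation k n r i I)
    (fun _ _ _ _ _ a b h h0 x => incidenceEquation_compatible a b h h0 x) i I

end Finiteness

/-! ### Pulling equations of a closed subscheme back to local generators -/

section LocalEquations

variable {Y Z X P G D T H : Scheme.{u}}

lemma isIso_appLE_of_eq_image (v : T ⟶ Y) [IsOpenImmersion v] {W : Y.Opens} (hW : W = v ''ᵁ ⊤)
    (h : ⊤ ≤ v ⁻¹ᵁ W) : IsIso (v.appLE W ⊤ h) := by
  subst hW
  have : v.appLE (v ''ᵁ ⊤) ⊤ (v.preimage_image_eq ⊤).ge = (v.appIso ⊤).hom := by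
    rw [Scheme.Hom.appIso_hom']
  rw [this]
  infer_instance

lemma app_eq_zero_iff_appLE_mem_span {i : H ⟶ Y} [IsClosedImmersion i] {J : Z.IdealSheafData}
    {g : Y ⟶ Z} (hi : i.ker = J.comap g) [IsAffine D] [IsAffine T] (c : D ⟶ Z) {r : ℕ}
    (e : Fin r → Γ(D, ⊤))
    (hc : J.comap c = Scheme.IdealSheafData.ofIdealTop (Ideal.span (Set.range e)))
    (v : T ⟶ Y) [IsOpenImmersion v] (a : T ⟶ D) (h : a ≫ c = v ≫ g) {W : Y.Opens}
    (hW : W = v ''ᵁ ⊤) (hv : ⊤ ≤ v ⁻¹ᵁ W) (s : Γ(Y, W)) :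
    (i.app W).hom s = 0 ↔
      (v.appLE W ⊤ hv).hom s ∈ Ideal.span (Set.range fun x => a.appTop.hom (e x)) := by
  subst hW
  have : v.appLE (v ''ᵁ ⊤) ⊤ hv = (v.appIso ⊤).hom := by
    rw [Scheme.Hom.appIso_hom']
  rw [this]
  exact app_eq_zero_iff_mem_span hi c e hc v a h s

lemma appLE_linearForm {A B : CommRingCat.{u}} (pr : Y ⟶ X) (g : Y ⟶ G) (f : X ⟶ P)
    (j : Spec A ⟶ P) [IsOpenImmersion j] (j' : Spec B ⟶ G) [IsOpenImmersion j'] {W₀ : Y.Opens}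
    (hW : W₀ ≤ pr ⁻¹ᵁ f ⁻¹ᵁ j ''ᵁ ⊤) (hG : W₀ ≤ g ⁻¹ᵁ j' ''ᵁ ⊤) {r m : ℕ}
    (M : Fin r → Fin m → B) (u : Fin m → A) (v : T ⟶ Y) (hv : ⊤ ≤ v ⁻¹ᵁ W₀) (a₁ : T ⟶ Spec A)
    (a₂ : T ⟶ Spec B) (h₁ : v ≫ pr ≫ f = a₁ ≫ j) (h₂ : v ≫ g = a₂ ≫ j') (x : Fin r) :
    (v.appLE W₀ ⊤ hv).hom (linearForm pr hW
      (fun x l => (g.appLE (j' ''ᵁ ⊤) W₀ hG).hom (chartFun j' (M x l)))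
      (fun l => (f.app _).hom (chartFun j (u l))) x) =
    ∑ l, a₂.appTop.hom ((Scheme.ΓSpecIso B).inv.hom (M x l)) *
      a₁.appTop.hom ((Scheme.ΓSpecIso A).inv.hom (u l)) := by
  rw [linearForm, map_sum]
  refine Finset.sum_congr rfl fun l _ => ?_
  rw [map_mul]
  congr 1
  · have h3 : g.appLE (j' ''ᵁ ⊤) W₀ hG ≫ v.appLE W₀ ⊤ hv = (v ≫ g).appLE (j' ''ᵁ ⊤) ⊤
        (hv.trans (v.preimage_mono hG)) := Scheme.Hom.appLE_comp_appLE _ _ _ _ _ _ _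
    refine (congr_arg (fun φ => φ.hom (chartFun j' (M x l))) h3).trans ?_
    refine (appLE_chartFun j' (v ≫ g) a₂ h₂ _ (M x l)).trans ?_
    exact congr_arg (fun φ => φ.hom ((Scheme.ΓSpecIso B).inv.hom (M x l)))
      (Scheme.Hom.app_eq_appLE (f := a₂) (U := ⊤)).symm
  · have h3 : f.app (j ''ᵁ ⊤) ≫ pr.app (f ⁻¹ᵁ j ''ᵁ ⊤) ≫ Y.presheaf.map (homOfLE hW).op ≫
        v.appLE W₀ ⊤ hv = (v ≫ pr ≫ f).appLE (j ''ᵁ ⊤) ⊤ (hv.trans (v.preimage_mono hW)) := by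
      rw [Scheme.Hom.map_appLE, Scheme.Hom.app_eq_appLE, Scheme.Hom.app_eq_appLE,
        Scheme.Hom.appLE_comp_appLE, Scheme.Hom.appLE_comp_appLE]
      simp only [Category.assoc]
    refine (congr_arg (fun φ => φ.hom (chartFun j (u l))) h3).trans ?_
    refine (appLE_chartFun j (v ≫ pr ≫ f) a₁ h₁ _ (u l)).trans ?_
    exact congr_arg (fun φ => φ.hom ((Scheme.ΓSpecIso A).inv.hom (u l)))
      (Scheme.Hom.app_eq_appLE (f := a₁) (U := ⊤)).symm

variable {i : H ⟶ Y} [IsClosedImmersion i] {J : Z.IdealSheafData} {g : Y ⟶ Z}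

lemma image_ι_top (W : Y.Opens) : W = W.ι ''ᵁ ⊤ := by
  rw [Scheme.Hom.image_top_eq_opensRange, Scheme.Opens.opensRange_ι]

lemma top_le_ι_preimage {W W' : Y.Opens} (h : W ≤ W') : ⊤ ≤ W.ι ⁻¹ᵁ W' :=
  fun w _ => h w.2

/-- Hypothesis `hL` expresses that `L` is the pullback of the equations `e`, tested on all `T`
mapping to `W₀`. On affine opens inside `W₀` the ideal is the span of these pullbacks, and vanishing
is local. -/
lemma app_localEquation_eq_zero
    (hi : i.ker = J.comap g) [IsAffine D] (c : D ⟶ Z) {r : ℕ} (e : Fin r → Γ(D, ⊤))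
    (hc : J.comap c = Scheme.IdealSheafData.ofIdealTop (Ideal.span (Set.range e))) {W₀ : Y.Opens}
    (L : Fin r → Γ(Y, W₀))
    (hL : ∀ (T : Scheme.{u}) (v : T ⟶ Y) (hv : ⊤ ≤ v ⁻¹ᵁ W₀), ∃ a : T ⟶ D, a ≫ c = v ≫ g ∧
      ∀ x, (v.appLE W₀ ⊤ hv).hom (L x) = a.appTop.hom (e x))
    (x : Fin r) : (i.app W₀).hom (L x) = 0 := by
  refine resM_eq_of_locally (structureModule H) (U := i ⁻¹ᵁ W₀) fun z hz => ?_
  obtain ⟨W, hW, hzW, hWW₀⟩ := exists_isAffineOpen_mem_and_subset (U := W₀) (x := i z) hz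
  have hWW₀ : W ≤ W₀ := hWW₀
  refine ⟨i ⁻¹ᵁ W, i.preimage_mono hWW₀, hzW, ?_⟩
  refine Eq.trans ?_ (map_zero (resM (structureModule H) (i.preimage_mono hWW₀))).symm
  have : IsAffine W.toScheme := hW
  obtain ⟨a, ha, hax⟩ := hL W.toScheme W.ι (top_le_ι_preimage hWW₀)
  have h1 := (app_eq_zero_iff_appLE_mem_span hi c e hc W.ι a ha (image_ι_top W)
    (top_le_ι_preimage le_rfl) (resO hWW₀ (L x))).mpr ?_
  · refine Eq.trans ?_ h1
    exact congr_arg (fun φ => φ.hom (L x)) (i.naturality (homOfLE hWW₀).op).symm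
  · refine Ideal.subset_span ⟨x, ?_⟩
    refine (hax x).symm.trans ?_
    exact congr_arg (fun φ => φ.hom (L x))
      (Scheme.Hom.map_appLE W.ι (top_le_ι_preimage le_rfl) (homOfLE hWW₀).op).symm

/-- Converse of the preceding vanishing: near any point of `W₀`, on an affine neighbourhood, the
forms `L` generate the ideal. -/
lemma exists_mem_span_localEquation
    (hi : i.ker = J.comap g) [IsAffine D] (c : D ⟶ Z) {r : ℕ} (e : Fin r → Γ(D, ⊤))
    (hc : J.comap c = Scheme.IdealSheafData.ofIdealTop (Ideal.span (Set.range e))) {W₀ : Y.Opens}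
    (L : Fin r → Γ(Y, W₀))
    (hL : ∀ (T : Scheme.{u}) (v : T ⟶ Y) (hv : ⊤ ≤ v ⁻¹ᵁ W₀), ∃ a : T ⟶ D, a ≫ c = v ≫ g ∧
      ∀ x, (v.appLE W₀ ⊤ hv).hom (L x) = a.appTop.hom (e x))
    (W : Y.Opens) (s : Γ(Y, W)) (hs : (i.app W).hom s = 0) (w : Y)
    (hw : w ∈ W) (hw₀ : w ∈ W₀) : ∃ (W' : Y.Opens) (h : W' ≤ W) (h₀ : W' ≤ W₀), w ∈ W' ∧
      resO h s ∈ Ideal.span (Set.range fun x => resO h₀ (L x)) := by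
  obtain ⟨W', hW', hwW', hle⟩ := exists_isAffineOpen_mem_and_subset (U := W ⊓ W₀) (x := w) ⟨hw, hw₀⟩
  have h : W' ≤ W := fun y hy => (hle hy).1
  have h₀ : W' ≤ W₀ := fun y hy => (hle hy).2
  refine ⟨W', h, h₀, hwW', ?_⟩
  have : IsAffine W'.toScheme := hW'
  obtain ⟨a, ha, hax⟩ := hL W'.toScheme W'.ι (top_le_ι_preimage h₀)
  have h1 := (app_eq_zero_iff_appLE_mem_span hi c e hc W'.ι a ha (image_ι_top W')
    (top_le_ι_preimage le_rfl) (resO h s)).mp ?_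
  · have hiso := isIso_appLE_of_eq_image W'.ι (image_ι_top W') (top_le_ι_preimage le_rfl)
    have hbij := ConcreteCategory.bijective_of_isIso (W'.ι.appLE W' ⊤ (top_le_ι_preimage le_rfl))
    have h2 : ∀ x, a.appTop.hom (e x) =
        (W'.ι.appLE W' ⊤ (top_le_ι_preimage le_rfl)).hom (resO h₀ (L x)) := by
      intro x
      refine (hax x).symm.trans ?_
      exact congr_arg (fun φ => φ.hom (L x))
        (Scheme.Hom.map_appLE W'.ι (top_le_ι_preimage le_rfl) (homOfLE h₀).op).symm
    simp only [h2] at h1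
    obtain ⟨b, hb⟩ := (Ideal.mem_span_range_iff_exists_fun).mp h1
    choose b' hb' using fun x => hbij.2 (b x)
    refine (Ideal.mem_span_range_iff_exists_fun).mpr ⟨b', hbij.1 ?_⟩
    refine Eq.trans ?_ hb
    refine (map_sum (W'.ι.appLE W' ⊤ (top_le_ι_preimage le_rfl)).hom _ _).trans ?_
    refine Finset.sum_congr rfl fun x _ => ?_
    refine (map_mul (W'.ι.appLE W' ⊤ (top_le_ι_preimage le_rfl)).hom _ _).trans ?_
    exact congr_arg (· * _) (hb' x)
  · refine (congr_arg (fun φ => φ.hom s) (i.naturality (homOfLE h).op)).trans ?_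
    exact (congr_arg ((H.presheaf.map _).hom) hs).trans (map_zero _)

end LocalEquations

/-! ### The linear forms cutting out the incidence scheme in `X ×_k G` -/

section IncidenceEquations

variable {k : Type u} [Field k] {n : ℕ} {X : Scheme.{u}} (f : X ⟶ ProjectiveSpace k n) (r : ℕ)

/-- Definitional, because the pullback of an ideal sheaf is defined as the kernel of the
base-changed closed immersion. -/
lemma ker_incι : (incι f r).ker = (incidenceIdeal k n r).comap (timesGrassMap f r) := rfl

instance : IsClosedImmersion (incι f r) := inferInstance

variable {r} (i : Fin (n + 1)) (I : Fin r ↪ Fin (n + 1))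

/-- The open subset of `X ×_k G` over the standard open `{Xᵢ ≠ 0}` and the chart `U_I`. -/
def chartOpen : (TimesGrass f r).Opens :=
  prX f r ⁻¹ᵁ f ⁻¹ᵁ (ProjectiveSpace.ι k n i ''ᵁ ⊤) ⊓
    prG f r ⁻¹ᵁ (Grassmannian.ι k (n + 1) r I ''ᵁ ⊤)

/-- The entries of the universal matrix, as functions on `X ×_k G`. -/
def chartCoefficient (x : Fin r) (l : Fin (n + 1)) : Γ(TimesGrass f r, chartOpen f i I) :=
  ((prG f r).appLE (Grassmannian.ι k (n + 1) r I ''ᵁ ⊤) (chartOpen f i I) inf_le_right).hom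
    (chartFun (Grassmannian.ι k (n + 1) r I) (chartMatrix k (n + 1) r I x l))

/-- The linear forms that define the incidence variety, as functions on `X ×_k G`. -/
def incidenceForm (x : Fin r) : Γ(TimesGrass f r, chartOpen f i I) :=
  linearForm (prX f r) (U₀ := f ⁻¹ᵁ (ProjectiveSpace.ι k n i ''ᵁ ⊤)) (W₀ := chartOpen f i I)
    inf_le_left (chartCoefficient f i I) (fun l => (f.app _).hom (coordFun i l)) x

lemma exists_lift_opens {S T : Scheme.{u}} {A : CommRingCat.{u}} (j : Spec A ⟶ S)
    [IsOpenImmersion j] (a : T ⟶ S) (h : ⊤ ≤ a ⁻¹ᵁ j ''ᵁ ⊤) : ∃ a', a' ≫ j = a := by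
  have : Set.range a ⊆ Set.range j := by
    rintro _ ⟨t, rfl⟩
    obtain ⟨y, -, hy⟩ := h (x := t) trivial
    exact ⟨y, hy⟩
  exact ⟨IsOpenImmersion.lift j a this, IsOpenImmersion.lift_fac _ _ _⟩

lemma exists_lift_productChart (T : Scheme.{u}) (v : T ⟶ TimesGrass f r)
    (hv : ⊤ ≤ v ⁻¹ᵁ chartOpen f i I) : ∃ a : T ⟶ ProductChart k n r i I,
      a ≫ productChartι k n r i I = v ≫ timesGrassMap f r ∧
      ∀ x, (v.appLE (chartOpen f i I) ⊤ hv).hom (incidenceForm f i I x) =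
        a.appTop.hom (incidenceEquation k n r i I x) := by
  obtain ⟨a₁, h₁⟩ := exists_lift_opens (ProjectiveSpace.ι k n i) (v ≫ prX f r ≫ f)
    (hv.trans (v.preimage_mono inf_le_left))
  obtain ⟨a₂, h₂⟩ := exists_lift_opens (Grassmannian.ι k (n + 1) r I) (v ≫ prG f r)
    (hv.trans (v.preimage_mono inf_le_right))
  let a : T ⟶ ProductChart k n r i I := pullback.lift a₁ a₂ (by
    rw [reassoc_of% h₁, reassoc_of% h₂, ← pullback.condition])
  have ha₁ : a ≫ pullback.fst _ _ = a₁ := pullback.lift_fst _ _ _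
  have ha₂ : a ≫ pullback.snd _ _ = a₂ := pullback.lift_snd _ _ _
  refine ⟨a, ?_, fun x => ?_⟩
  · have e1 : timesGrassMap f r ≫ pullback.fst _ _ = prX f r ≫ f := pullback.lift_fst _ _ _
    have e2 : timesGrassMap f r ≫ pullback.snd _ _ = prG f r := pullback.lift_snd _ _ _
    apply pullback.hom_ext
    · rw [Category.assoc, productChartι_fst, reassoc_of% ha₁, h₁, Category.assoc, e1]
    · rw [Category.assoc, productChartι_snd, reassoc_of% ha₂, h₂, Category.assoc, e2]
  · rw [appTop_incidenceEquation, ha₁, ha₂]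
    exact appLE_linearForm (prX f r) (prG f r) f (ProjectiveSpace.ι k n i)
      (Grassmannian.ι k (n + 1) r I) _ _ (fun x l => chartMatrix k (n + 1) r I x l)
      (fun l => ProjectiveSpace.coord k n i l) v hv a₁ a₂ h₁.symm h₂.symm x

lemma app_incidenceForm (x : Fin r) :
    ((incι f r).app (chartOpen f i I)).hom (incidenceForm f i I x) = 0 :=
  app_localEquation_eq_zero (ker_incι f r) (productChartι k n r i I) (incidenceEquation k n r i I)
    (comap_incidenceIdeal k n r i I) (incidenceForm f i I) (exists_lift_productChart f i I) x

lemma exists_mem_span_incidenceForm (W : (TimesGrass f r).Opens) (s : Γ(TimesGrass f r, W))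
    (hs : ((incι f r).app W).hom s = 0) (w : ↥(TimesGrass f r))
    (hw : w ∈ W) (hw₀ : w ∈ chartOpen f i I) :
    ∃ (W' : (TimesGrass f r).Opens) (h : W' ≤ W) (h₀ : W' ≤ chartOpen f i I), w ∈ W' ∧
      resO h s ∈ Ideal.span (Set.range fun x => resO h₀ (incidenceForm f i I x)) :=
  exists_mem_span_localEquation (ker_incι f r) (productChartι k n r i I)
    (incidenceEquation k n r i I) (comap_incidenceIdeal k n r i I) (incidenceForm f i I)
    (exists_lift_productChart f i I) W s hs w hw hw₀

end IncidenceEquations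

/-! ### Sections of a free sheaf in terms of its basis -/

section FreeSections

variable {V : Scheme.{u}}

lemma exists_hom_of_section {M : V.Modules} (y : Γ(M, ⊤)) :
    ∃ α : structureModule V ⟶ M, ∀ a : Γ(V, ⊤), α.app ⊤ a = a • y := by
  obtain ⟨t, ht⟩ := (sections_bijective M).2 y
  refine ⟨(SheafOfModules.unitHomEquiv (R := V.ringCatSheaf) M).symm t, fun a => ?_⟩
  let α : structureModule V ⟶ M := (SheafOfModules.unitHomEquiv (R := V.ringCatSheaf) M).symm t
  have h1 : α.app ⊤ (1 : Γ(V, ⊤)) = y := by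
    refine Eq.trans ?_ ht
    have := (SheafOfModules.unitHomEquiv (R := V.ringCatSheaf) M).apply_symm_apply t
    exact congr_arg (fun t => (show Γ(M, ⊤) from t.val (.op ⊤))) this
  have h2 : (a : Γ(structureModule V, ⊤)) = a • (1 : Γ(V, ⊤)) := (mul_one a).symm
  refine (congr_arg (α.app ⊤) h2).trans ?_
  refine (α.app_smul a _).trans ?_
  rw [← h1]

/-- The identity is the sum of the composites of coordinate projections `β c` with the inclusions `α
c`, as one sees on basis sections; it is then applied to `y`. -/
lemma exists_eq_sum_freeBasis (s : ℕ) (y : Γ(freeModule V s, ⊤)) :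
    ∃ a : Fin s → Γ(V, ⊤), y = ∑ c, a c • freeBasis V s c := by
  choose α hα using fun c : Fin s => exists_hom_of_section (freeBasis V s c)
  choose β hβ using fun c : Fin s => (freeHom_bijective s (structureModule V)).2
    (Pi.single c (1 : Γ(V, ⊤)))
  have happ : ∀ z, (∑ c, β c ≫ α c).app ⊤ z = ∑ c, (α c).app ⊤ ((β c).app ⊤ z) := by
    intro z
    let φ : (freeModule V s ⟶ freeModule V s) →+ Γ(freeModule V s, ⊤) :=
      { toFun g := g.app ⊤ z
        map_zero' := rfl
        map_add' _ _ := rfl }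
    exact map_sum φ _ _
  have hid : ∑ c, β c ≫ α c = 𝟙 _ := by
    apply (freeHom_bijective s _).1
    funext l
    refine (happ _).trans ?_
    refine Eq.trans ?_ (rfl : freeBasis V s l = _)
    have : ∀ c, (α c).app ⊤ ((β c).app ⊤ (freeBasis V s l)) =
        (Pi.single c (1 : Γ(V, ⊤)) : Fin s → Γ(V, ⊤)) l • freeBasis V s c := by
      intro c
      refine (congr_arg _ (congr_fun (hβ c) l)).trans (hα c _)
    rw [Finset.sum_congr rfl fun c _ => this c]
    rw [Finset.sum_eq_single l]
    · rw [Pi.single_eq_same, one_smul]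
    · intro c _ hc
      rw [Pi.single_eq_of_ne hc.symm, zero_smul]
    · exact fun h => absurd (Finset.mem_univ l) h
  refine ⟨fun c => (β c).app ⊤ y, ?_⟩
  have := happ y
  rw [hid] at this
  refine Eq.trans (rfl : y = (𝟙 (freeModule V s) : _ ⟶ _).app ⊤ y) (this.trans ?_)
  exact Finset.sum_congr rfl fun c _ => hα c _

lemma exists_eq_sum_trivBasis {V₀ X : Scheme.{u}} (j : V₀ ⟶ X) [IsOpenImmersion j] {E : X.Modules}
    {d : ℕ} (ψ : E.restrict j ≅ freeModule V₀ d) (y : Γ(E, j ''ᵁ ⊤)) :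
    ∃ δ : Fin d → Γ(X, j ''ᵁ ⊤), y = ∑ c, δ c • trivBasis j ψ c := by
  obtain ⟨a, ha⟩ := exists_eq_sum_freeBasis d (ψ.hom.app ⊤ y)
  refine ⟨fun c => (j.appIso ⊤).inv.hom (a c), ?_⟩
  have h1 : ψ.inv.app ⊤ (ψ.hom.app ⊤ y) = y :=
    congr_arg (fun φ => φ.app ⊤ y) ψ.hom_inv_id
  rw [← h1, ha, map_sum]
  refine Finset.sum_congr rfl fun c _ => ?_
  refine (ψ.inv.app_smul (a c) _).trans ?_
  rfl

end FreeSections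

/-! ### Restriction of free sheaves to smaller opens -/

section RestrictFree

variable {V₁ V₀ X : Scheme.{u}}

lemma nonempty_restrict_freeModule_iso (a : V₁ ⟶ V₀) [IsOpenImmersion a] (d : ℕ) :
    Nonempty ((freeModule V₀ d).restrict a ≅ freeModule V₁ d) := by
  refine nonempty_iso_free _ (fun M g i => (show Γ(M, ⊤) from
    ((Scheme.Modules.restrictAdjunction a).homEquiv _ M g).app ⊤ (freeBasis V₀ d i))) ?_ ?_
  · intro M
    exact (freeHom_bijective d ((Scheme.Modules.pushforward a).obj M)).comp
      ((Scheme.Modules.restrictAdjunction a).homEquiv _ M).bijective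
  · intro M M' g h i
    exact congr_arg (fun φ => φ.app ⊤ (freeBasis V₀ d i))
      ((Scheme.Modules.restrictAdjunction a).homEquiv_naturality_right g h)

lemma nonempty_restrict_iso_free_of_comp {a : V₁ ⟶ V₀} [IsOpenImmersion a] {j : V₀ ⟶ X}
    [IsOpenImmersion j] {b : V₁ ⟶ X} [IsOpenImmersion b] (h : b = a ≫ j) {E : X.Modules} {d : ℕ}
    (ψ : E.restrict j ≅ freeModule V₀ d) : Nonempty (E.restrict b ≅ freeModule V₁ d) := by
  obtain ⟨e⟩ := nonempty_restrict_freeModule_iso a d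
  exact ⟨(Scheme.Modules.restrictFunctorCongr h).app E ≪≫
    (Scheme.Modules.restrictFunctorComp a j).app E ≪≫ (Scheme.Modules.restrictFunctor a).mapIso ψ ≪≫ e⟩

end RestrictFree

/-! ### Points over the generic point of a chart -/

section GenericPoint

variable {k : Type u} [Field k] {N r d : ℕ}

/-- `linearIndependent_generic_rows` in terms of ring homomorphisms. -/
lemma linearIndependent_generic_rows_of_ringHom {F K : Type u} [Field F] [Field K] [Algebra k F]
    (I : Fin r ↪ Fin N) (τ : F →+* K) (ρ : ChartRing k N r I →+* K)
    (hρτ : ∀ c, ρ (algebraMap k _ c) = τ (algebraMap k F c)) (hρ : Function.Injective ρ)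
    (p : Fin N → F) (q : Fin d → Fin N → F)
    (hpq : LinearIndependent F (Fin.cons p q : Fin (d + 1) → Fin N → F))
    (hp : ∀ a, ∑ j, ρ (chartMatrix k N r I a j) * τ (p j) = 0) (hF : Algebra.trdeg k F ≤ d) :
    LinearIndependent K
      (fun (a : Fin r) (c : Fin d) => ∑ j, ρ (chartMatrix k N r I a j) * τ (q c j)) := by
  let : Algebra F K := τ.toAlgebra
  let : Algebra k K := (τ.comp (algebraMap k F)).toAlgebra
  have : IsScalarTower k F K := IsScalarTower.of_algebraMap_eq fun _ => rfl
  let ρ' : ChartRing k N r I →ₐ[k] K := { ρ with commutes' := hρτ }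
  have h1 : ∀ (x : F) (y : K), x • y = y * τ x := fun x y => mul_comm _ _
  have := linearIndependent_generic_rows I ρ' hρ p q hpq (fun a => by
    simp only [h1]
    exact hp a) hF
  simp only [h1] at this
  exact this

/-- The values of the functions on a chart at a point over the generic point of the chart. -/
lemma injective_value_chartFun {A : Type u} [CommRing A] [IsDomain A] {K : Type u} [Field K]
    {G : Scheme.{u}} (j : Spec (.of A) ⟶ G) [IsOpenImmersion j] (ξ : Spec (.of K) ⟶ G)
    (h : ⊤ ≤ ξ ⁻¹ᵁ j ''ᵁ ⊤) (z : ↥(Spec (.of K))) (y : PrimeSpectrum A) (hy : y.asIdeal = ⊥)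
    (hz : ξ z = j (show ↥(Spec (.of A)) from y)) :
    Function.Injective ((value ξ h).comp (chartFun j)) := by
  obtain ⟨ξ', rfl⟩ := exists_lift_opens j ξ h
  obtain ⟨φ, rfl⟩ := Spec.map_surjective ξ'
  have h1 : ∀ s : A, value (Spec.map φ ≫ j) h (chartFun j s) = φ.hom s := by
    intro s
    have e1 := appLE_chartFun j (Spec.map φ ≫ j) (Spec.map φ) rfl h s
    have e2 : (Spec.map φ).appLE ⊤ ⊤ le_top = (Spec.map φ).appTop :=
      (Scheme.Hom.app_eq_appLE _).symm
    have e3 : (Scheme.ΓSpecIso (.of A)).inv ≫ (Spec.map φ).appLE ⊤ ⊤ le_top ≫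
        (Scheme.ΓSpecIso (.of K)).hom = φ := by
      rw [e2, Scheme.ΓSpecIso_naturality, Iso.inv_hom_id_assoc]
    refine (congr_arg (Scheme.ΓSpecIso (.of K)).hom.hom e1).trans ?_
    exact congr_arg (fun ψ => ψ.hom s) e3
  have h2 : Spec.map φ z = (show ↥(Spec (.of A)) from y) :=
    j.isOpenEmbedding.injective hz
  have h3 : Function.Injective φ.hom := by
    rw [RingHom.injective_iff_ker_eq_bot, eq_bot_iff, ← hy, ← h2]
    intro s hs
    change φ.hom s ∈ PrimeSpectrum.asIdeal z
    rw [RingHom.mem_ker.mp hs]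
    exact Ideal.zero_mem _
  intro s t hst
  exact h3 ((h1 s).symm.trans (hst.trans (h1 t)))

end GenericPoint

/-! ### Compatibility of values with morphisms and residue fields -/

section ValueLemmas

variable {X Y Z : Scheme.{u}} {K : CommRingCat.{u}}

lemma value_congr {ξ ξ' : Spec K ⟶ X} (e : ξ = ξ') {U : X.Opens} (h : ⊤ ≤ ξ ⁻¹ᵁ U)
    (h' : ⊤ ≤ ξ' ⁻¹ᵁ U) (s : Γ(X, U)) : value ξ h s = value ξ' h' s := by
  subst e
  rfl

lemma value_app (ζ : Spec K ⟶ Y) (p : Y ⟶ X) {U : X.Opens} (h : ⊤ ≤ ζ ⁻¹ᵁ p ⁻¹ᵁ U)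
    (h' : ⊤ ≤ (ζ ≫ p) ⁻¹ᵁ U) (s : Γ(X, U)) :
    value ζ h ((p.app U).hom s) = value (ζ ≫ p) h' s := by
  rw [Scheme.Hom.app_eq_appLE]
  exact value_appLE ζ p le_rfl h h' s

lemma value_resO_app_app (ξ : Spec K ⟶ X) (p : X ⟶ Y) (f : Y ⟶ Z) {U : Z.Opens} {W : X.Opens}
    (hW : W ≤ p ⁻¹ᵁ f ⁻¹ᵁ U) (h : ⊤ ≤ ξ ⁻¹ᵁ W) {ξ' : Spec K ⟶ Z} (e : ξ ≫ p ≫ f = ξ')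
    (h' : ⊤ ≤ ξ' ⁻¹ᵁ U) (s : Γ(Z, U)) :
    value ξ h (resO hW ((p.app _).hom ((f.app U).hom s))) = value ξ' h' s := by
  subst e
  have h3 : f.app U ≫ p.app (f ⁻¹ᵁ U) ≫ X.presheaf.map (homOfLE hW).op =
      (p ≫ f).appLE U W hW := by
    rw [Scheme.Hom.app_eq_appLE, Scheme.Hom.app_eq_appLE, Scheme.Hom.appLE_map,
      Scheme.Hom.appLE_comp_appLE]
  refine (congr_arg (fun φ => value ξ h (φ.hom s)) h3).trans ?_
  exact value_appLE ξ (p ≫ f) hW h h' s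

lemma value_residueFieldMap (p : Y ⟶ X) (z : Y) {U : X.Opens}
    (h : ⊤ ≤ X.fromSpecResidueField (p z) ⁻¹ᵁ U) (h' : ⊤ ≤ (Y.fromSpecResidueField z ≫ p) ⁻¹ᵁ U)
    (s : Γ(X, U)) : value (Y.fromSpecResidueField z ≫ p) h' s =
      (p.residueFieldMap z).hom (value (X.fromSpecResidueField (p z)) h s) := by
  have e := (Scheme.Hom.SpecMap_residueFieldMap_fromSpecResidueField p z).symm
  have h'' : ⊤ ≤ (Spec.map (p.residueFieldMap z) ≫ X.fromSpecResidueField (p z)) ⁻¹ᵁ U :=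
    fun w _ => h (x := Spec.map (p.residueFieldMap z) w) trivial
  exact (value_congr e h' h'' s).trans (value_specMap _ _ h h'' s)

variable {k : Type u} [Field k]

lemma value_structureMap_eq (ξ : Spec K ⟶ X) (g : X ⟶ Spec (.of k)) {U : X.Opens}
    (h : ⊤ ≤ ξ ⁻¹ᵁ U) (c : k) : value ξ h (structureMap g U c) =
      value (ξ ≫ g) (U := ⊤) le_top ((Scheme.ΓSpecIso (.of k)).inv.hom c) :=
  value_appLE ξ g le_top h le_top _

end ValueLemmas

/-! ### Independence of the rows at a point over a generic point -/

section CokernelAtPoint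

variable {k : Type u} [Field k] {n r d : ℕ} {X 𝒳 Y Z H V₀ : Scheme.{u}}
  (f : X ⟶ ProjectiveSpace k n) [FormallyUnramified f] [LocallyOfFiniteType f]
  (m : 𝒳 ⟶ X) [LocallyOfFiniteType m] (pr : Y ⟶ X) (g : Y ⟶ Grassmannian k (n + 1) r)
  (i : Z ⟶ Y) (q : H ⟶ Z) (p : H ⟶ 𝒳) {E : 𝒳.Modules}
  (π : (Scheme.Modules.pullback m).obj (Differentials (overField f)) ⟶ E) [Epi π]
  (j : V₀ ⟶ 𝒳) [IsOpenImmersion j] (ψ : E.restrict j ≅ freeModule V₀ d)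

/-- An application of `linearIndependent_generic_rows_of_ringHom`: `F` and `K` are the residue
fields at `p z` and `z`, injectivity comes from the generic point `η`, the relation `M P = 0` from
`hl`, independence from `linearIndependent_coordinates`, and the transcendence bound from the
dimension of `𝒳`. -/
lemma linearIndependent_value_rows (sq : pr ≫ overField f = g ≫ Grassmannian.str k (n + 1) r)
    (h : q ≫ i ≫ pr = p ≫ m) (hd : topologicalKrullDim 𝒳 ≤ d)
    (i₀ : Fin (n + 1)) (I : Fin r ↪ Fin (n + 1)) {W₀ : Y.Opens}
    (hW : W₀ ≤ pr ⁻¹ᵁ f ⁻¹ᵁ (ProjectiveSpace.ι k n i₀ ''ᵁ ⊤))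
    (hG : W₀ ≤ g ⁻¹ᵁ (Grassmannian.ι k (n + 1) r I ''ᵁ ⊤))
    (hl : ∀ x, (i.app W₀).hom (linearForm pr hW
      (fun x l => (g.appLE (Grassmannian.ι k (n + 1) r I ''ᵁ ⊤) W₀ hG).hom
        (chartFun (Grassmannian.ι k (n + 1) r I) (chartMatrix k (n + 1) r I x l)))
      (fun l => (f.app _).hom (coordFun i₀ l)) x) = 0)
    (hU : j ''ᵁ ⊤ ≤ m ⁻¹ᵁ f ⁻¹ᵁ (ProjectiveSpace.ι k n i₀ ''ᵁ ⊤))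
    (δ : Fin (n + 1) → Fin d → Γ(𝒳, j ''ᵁ ⊤))
    (hδ : ∀ l, resM E hU ((SheafDerivation.ofHom (transpose m π)).d _
      ((f.app (ProjectiveSpace.ι k n i₀ ''ᵁ ⊤)).hom (coordFun i₀ l))) = ∑ c, δ l c • trivBasis j ψ c)
    (z : H) (hz : p z ∈ j ''ᵁ ⊤) (η : PrimeSpectrum (ChartRing k (n + 1) r I))
    (hη : η.asIdeal = ⊥)
    (hzη : g (i (q z)) = Grassmannian.ι k (n + 1) r I (show ↥(chart k I) from η))
    (hζ₁ : ⊤ ≤ (H.fromSpecResidueField z ≫ q ≫ i) ⁻¹ᵁ W₀)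
    (hζ₂ : ⊤ ≤ (H.fromSpecResidueField z ≫ p) ⁻¹ᵁ j ''ᵁ ⊤) :
    LinearIndependent (H.residueField z) (fun (x : Fin r) (c : Fin d) => ∑ l,
      value (H.fromSpecResidueField z ≫ q ≫ i) hζ₁
        ((g.appLE (Grassmannian.ι k (n + 1) r I ''ᵁ ⊤) W₀ hG).hom
          (chartFun (Grassmannian.ι k (n + 1) r I) (chartMatrix k (n + 1) r I x l))) *
      value (H.fromSpecResidueField z ≫ p) hζ₂ (δ l c)) := by
  let ζ := H.fromSpecResidueField z
  let F := 𝒳.residueField (p z)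
  let θ := 𝒳.fromSpecResidueField (p z)
  let τ : F →+* H.residueField z := (p.residueFieldMap z).hom
  have hθ : ⊤ ≤ θ ⁻¹ᵁ j ''ᵁ ⊤ := by
    intro w _
    have : θ w = p z := Scheme.fromSpecResidueField_apply (X := 𝒳) (p z) w
    change θ w ∈ j ''ᵁ ⊤
    rwa [this]
  obtain ⟨ξ, hξ⟩ : ∃ ξ : Spec (.of F) ⟶ V₀, ξ ≫ j = θ := by
    have : Set.range θ ⊆ Set.range j := by
      rintro _ ⟨t, rfl⟩
      obtain ⟨y, -, hy⟩ := hθ (x := t) trivial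
      exact ⟨y, hy⟩
    exact ⟨IsOpenImmersion.lift j θ this, IsOpenImmersion.lift_fac _ _ _⟩
  let alg : k →+* F := (value θ (U := ⊤) le_top).comp (structureMap (m ≫ overField f) ⊤)
  let : Algebra k F := alg.toAlgebra
  have htr : Algebra.trdeg k F ≤ d := by
    have : LocallyOfFiniteType (overField f) :=
      MorphismProperty.comp_mem @LocallyOfFiniteType _ _ inferInstance inferInstance
    have : LocallyOfFiniteType (m ≫ overField f) :=
      MorphismProperty.comp_mem @LocallyOfFiniteType _ _ inferInstance inferInstance
    exact trdeg_residueField_le (m ≫ overField f) hd (p z) (fun c => rfl)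
  have hG' : ⊤ ≤ ((ζ ≫ q ≫ i) ≫ g) ⁻¹ᵁ (Grassmannian.ι k (n + 1) r I ''ᵁ ⊤) :=
    fun w _ => hG (hζ₁ (x := w) trivial)
  let ρ : ChartRing k (n + 1) r I →+* H.residueField z :=
    (value ((ζ ≫ q ≫ i) ≫ g) hG').comp (chartFun (Grassmannian.ι k (n + 1) r I))
  have hρval : ∀ s, value (ζ ≫ q ≫ i) hζ₁
      ((g.appLE (Grassmannian.ι k (n + 1) r I ''ᵁ ⊤) W₀ hG).hom
        (chartFun (Grassmannian.ι k (n + 1) r I) s)) = ρ s :=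
    fun s => value_appLE (ζ ≫ q ≫ i) g hG hζ₁ hG' _
  have hτval : ∀ {U : 𝒳.Opens} (h₁ : ⊤ ≤ θ ⁻¹ᵁ U) (h₂ : ⊤ ≤ (ζ ≫ p) ⁻¹ᵁ U) (s : Γ(𝒳, U)),
      value (ζ ≫ p) h₂ s = τ (value θ h₁ s) := fun h₁ h₂ s => value_residueFieldMap p z h₁ h₂ s
  have hsq : ((ζ ≫ q ≫ i) ≫ g) ≫ Grassmannian.str k (n + 1) r = (ζ ≫ p) ≫ m ≫ overField f := by
    simp only [Category.assoc]
    rw [← sq, reassoc_of% h]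
  let P : Fin (n + 1) → F := fun l => value θ hθ
    (((m ≫ f).appLE (ProjectiveSpace.ι k n i₀ ''ᵁ ⊤) (j ''ᵁ ⊤) hU).hom (coordFun i₀ l))
  let Q : Fin d → Fin (n + 1) → F := fun c l => value θ hθ (δ l c)
  have hmain := linearIndependent_generic_rows_of_ringHom I τ ρ ?_ ?_ P Q ?_ ?_ htr
  · refine Eq.mp ?_ hmain
    congr 1
    funext x c
    refine Finset.sum_congr rfl fun l _ => ?_
    exact congr_arg₂ (· * ·) (hρval _).symm (hτval hθ hζ₂ _).symm
  · intro c
    have e1 : ρ (algebraMap k _ c) = value ((ζ ≫ q ≫ i) ≫ g) hG'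
        (structureMap (Grassmannian.str k (n + 1) r) _ c) :=
      congr_arg (value ((ζ ≫ q ≫ i) ≫ g) hG') (chartFun_eq_structureMap
        (Grassmannian.ι k (n + 1) r I) (Grassmannian.str k (n + 1) r) _
        (Grassmannian.ι_str k (n + 1) r I) c)
    have e2 : τ (algebraMap k F c) = value (ζ ≫ p) le_top (structureMap (m ≫ overField f) ⊤ c) :=
      (hτval le_top le_top _).symm
    refine e1.trans (Eq.trans ?_ e2.symm)
    refine (value_structureMap_eq _ _ _ _).trans (Eq.trans ?_ (value_structureMap_eq _ _ _ _).symm)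
    exact value_congr hsq _ _ _
  · refine injective_value_chartFun (Grassmannian.ι k (n + 1) r I) ((ζ ≫ q ≫ i) ≫ g) hG'
      (default : ↥(Spec (H.residueField z))) η hη ?_
    refine Eq.trans ?_ hzη
    exact congr_arg (fun w => g (i (q w))) (Scheme.fromSpecResidueField_apply (X := H) z _)
  · have := linearIndependent_coordinates f m π j ξ ψ i₀ hU δ hδ P ?_
    · refine Eq.mp ?_ this
      congr 2
      funext c l
      exact value_congr hξ _ _ _
    · change value θ hθ (((m ≫ f).appLE _ _ hU).hom (coordFun i₀ i₀)) = 1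
      rw [coordFun_self, map_one, map_one]
  · intro x
    have h0 : value (ζ ≫ q ≫ i) hζ₁ (linearForm pr hW
      (fun x l => (g.appLE (Grassmannian.ι k (n + 1) r I ''ᵁ ⊤) W₀ hG).hom
        (chartFun (Grassmannian.ι k (n + 1) r I) (chartMatrix k (n + 1) r I x l)))
      (fun l => (f.app _).hom (coordFun i₀ l)) x) = 0 := by
      have e := value_app (ζ ≫ q) i (U := W₀) hζ₁ hζ₁ (linearForm pr hW
        (fun x l => (g.appLE (Grassmannian.ι k (n + 1) r I ''ᵁ ⊤) W₀ hG).hom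
          (chartFun (Grassmannian.ι k (n + 1) r I) (chartMatrix k (n + 1) r I x l)))
        (fun l => (f.app _).hom (coordFun i₀ l)) x)
      rw [hl x, map_zero] at e
      exact (value_congr (Category.assoc ζ q i).symm _ _ _).trans e.symm
    rw [linearForm, map_sum] at h0
    refine Eq.trans (Finset.sum_congr rfl fun l _ => ?_) h0
    rw [map_mul]
    refine congr_arg₂ (· * ·) (hρval _).symm ?_
    have h2 : ⊤ ≤ ((ζ ≫ p) ≫ m ≫ f) ⁻¹ᵁ (ProjectiveSpace.ι k n i₀ ''ᵁ ⊤) :=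
      fun w _ => hU (hζ₂ (x := w) trivial)
    have e : (ζ ≫ q ≫ i) ≫ pr ≫ f = (ζ ≫ p) ≫ m ≫ f := by
      simp only [Category.assoc]
      rw [reassoc_of% h]
    refine Eq.trans ?_ (value_resO_app_app (ζ ≫ q ≫ i) pr f hW hζ₁ e h2 (coordFun i₀ l)).symm
    exact (hτval hθ hζ₂ _).symm.trans (value_appLE (ζ ≫ p) (m ≫ f) hU hζ₂ h2 _)

end CokernelAtPoint

/-! ### Local freeness of the cokernel near such a point -/

section CokernelNearPoint

variable {k : Type u} [Field k] {n r d : ℕ} {X 𝒳 Y Z H V₀ : Scheme.{u}}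
  (f : X ⟶ ProjectiveSpace k n) [FormallyUnramified f] [LocallyOfFiniteType f]
  (m : 𝒳 ⟶ X) [LocallyOfFiniteType m] (pr : Y ⟶ X) (g : Y ⟶ Grassmannian k (n + 1) r)
  (sq : pr ≫ overField f = g ≫ Grassmannian.str k (n + 1) r) [IsIso (Differentials.baseChange sq)]
  (i : Z ⟶ Y) (q : H ⟶ Z) (p : H ⟶ 𝒳) (h : q ≫ i ≫ pr = p ≫ m) {E : 𝒳.Modules}
  (π : (Scheme.Modules.pullback m).obj (Differentials (overField f)) ⟶ E) [Epi π]

lemma appLE_sum_mul {V : Scheme.{u}} (v : V ⟶ H) (b : H ⟶ Y) (p : H ⟶ 𝒳) {W : H.Opens}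
    {W₀ : Y.Opens} {U : 𝒳.Opens} (h₁ : W ≤ b ⁻¹ᵁ W₀) (h₂ : W ≤ p ⁻¹ᵁ U) (hv : ⊤ ≤ v ⁻¹ᵁ W)
    (h₁' : ⊤ ≤ (v ≫ b) ⁻¹ᵁ W₀) (h₂' : ⊤ ≤ (v ≫ p) ⁻¹ᵁ U) {ι : Type*} [Fintype ι]
    (M : ι → Γ(Y, W₀)) (δ : ι → Γ(𝒳, U)) :
    (v.appLE W ⊤ hv).hom (∑ l, (b.appLE W₀ W h₁).hom (M l) * (p.appLE U W h₂).hom (δ l)) =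
      ∑ l, ((v ≫ b).appLE W₀ ⊤ h₁').hom (M l) * ((v ≫ p).appLE U ⊤ h₂').hom (δ l) := by
  rw [map_sum]
  refine Finset.sum_congr rfl fun l _ => ?_
  rw [map_mul]
  refine congr_arg₂ (· * ·) ?_ ?_
  · exact congr_arg (fun φ => φ.hom (M l)) (Scheme.Hom.appLE_comp_appLE v b W₀ W ⊤ h₁ hv)
  · exact congr_arg (fun φ => φ.hom (δ l)) (Scheme.Hom.appLE_comp_appLE v p U W ⊤ h₂ hv)

lemma value_sum_mul {K : CommRingCat.{u}} (ζ : Spec K ⟶ H) (b : H ⟶ Y) (p : H ⟶ 𝒳) {W : H.Opens}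
    {W₀ : Y.Opens} {U : 𝒳.Opens} (h₁ : W ≤ b ⁻¹ᵁ W₀) (h₂ : W ≤ p ⁻¹ᵁ U) (hv : ⊤ ≤ ζ ⁻¹ᵁ W)
    (h₁' : ⊤ ≤ (ζ ≫ b) ⁻¹ᵁ W₀) (h₂' : ⊤ ≤ (ζ ≫ p) ⁻¹ᵁ U) {ι : Type*} [Fintype ι]
    (M : ι → Γ(Y, W₀)) (δ : ι → Γ(𝒳, U)) :
    value ζ hv (∑ l, (b.appLE W₀ W h₁).hom (M l) * (p.appLE U W h₂).hom (δ l)) =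
      ∑ l, value (ζ ≫ b) h₁' (M l) * value (ζ ≫ p) h₂' (δ l) := by
  rw [map_sum]
  refine Finset.sum_congr rfl fun l _ => ?_
  rw [map_mul]
  exact congr_arg₂ (· * ·) (value_appLE ζ b h₁ hv h₁' (M l)) (value_appLE ζ p h₂ hv h₂' (δ l))

lemma top_le_preimage_fromSpecResidueField (z : H) {W : H.Opens} (hz : z ∈ W) :
    ⊤ ≤ H.fromSpecResidueField z ⁻¹ᵁ W := by
  intro w _
  have : H.fromSpecResidueField z w = z := Scheme.fromSpecResidueField_apply (X := H) z w
  change H.fromSpecResidueField z w ∈ W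
  rwa [this]

/-- Near a point over the generic point of a chart of the Grassmannian, the cokernel is locally
free of the expected rank. -/
theorem exists_free_cokernel_of_chart (j : V₀ ⟶ 𝒳) [IsOpenImmersion j]
    (ψ : E.restrict j ≅ freeModule V₀ d) (hd : topologicalKrullDim 𝒳 ≤ d)
    (i₀ : Fin (n + 1)) (I : Fin r ↪ Fin (n + 1)) {W₀ : Y.Opens}
    (hW : W₀ ≤ pr ⁻¹ᵁ f ⁻¹ᵁ (ProjectiveSpace.ι k n i₀ ''ᵁ ⊤))
    (hG : W₀ ≤ g ⁻¹ᵁ (Grassmannian.ι k (n + 1) r I ''ᵁ ⊤))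
    (L : Fin r → Γ(Y, W₀))
    (hL : ∀ x, L x = linearForm pr hW
      (fun x l => (g.appLE (Grassmannian.ι k (n + 1) r I ''ᵁ ⊤) W₀ hG).hom
        (chartFun (Grassmannian.ι k (n + 1) r I) (chartMatrix k (n + 1) r I x l)))
      (fun l => (f.app _).hom (coordFun i₀ l)) x)
    (hl : ∀ x, (i.app W₀).hom (L x) = 0)
    (hgen : ∀ (W : Y.Opens) (s : Γ(Y, W)), (i.app W).hom s = 0 → ∀ w ∈ W, w ∈ W₀ →
      ∃ (W' : Y.Opens) (h : W' ≤ W) (h₀ : W' ≤ W₀), w ∈ W' ∧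
        resO h s ∈ Ideal.span (Set.range fun x => resO h₀ (L x)))
    (hU : j ''ᵁ ⊤ ≤ m ⁻¹ᵁ f ⁻¹ᵁ (ProjectiveSpace.ι k n i₀ ''ᵁ ⊤))
    (z : H) (hz : p z ∈ j ''ᵁ ⊤) (hzW : i (q z) ∈ W₀)
    (η : PrimeSpectrum (ChartRing k (n + 1) r I)) (hη : η.asIdeal = ⊥)
    (hzη : g (i (q z)) = Grassmannian.ι k (n + 1) r I (show ↥(chart k I) from η)) :
    ∃ (V : H.Opens) (s : ℕ), z ∈ V ∧ r + s = d ∧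
      Nonempty ((cokernel (squareConormal pr sq i q p m h π)).restrict V.ι ≅
        freeModule V.toScheme s) := by
  obtain rfl : L = _ := funext hL
  let M : Fin r → Fin (n + 1) → Γ(Y, W₀) := fun x l =>
    (g.appLE (Grassmannian.ι k (n + 1) r I ''ᵁ ⊤) W₀ hG).hom
      (chartFun (Grassmannian.ι k (n + 1) r I) (chartMatrix k (n + 1) r I x l))
  choose δ hδ using fun l => exists_eq_sum_trivBasis j ψ (resM E hU
    ((SheafDerivation.ofHom (transpose m π)).d _
      ((f.app (ProjectiveSpace.ι k n i₀ ''ᵁ ⊤)).hom (coordFun i₀ l))))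
  let W : H.Opens := (q ≫ i) ⁻¹ᵁ W₀ ⊓ p ⁻¹ᵁ j ''ᵁ ⊤
  -- The matrix of `φ` in the generators of the ideal and the basis of `E`: the universal matrix
  -- times the matrix `δ` of differentials of coordinates.
  let A : Matrix (Fin r) (Fin d) Γ(H, W) := fun x c =>
    ∑ l, ((q ≫ i).appLE W₀ W inf_le_left).hom (M x l) *
      (p.appLE (j ''ᵁ ⊤) W inf_le_right).hom (δ l c)
  have hζ : ⊤ ≤ H.fromSpecResidueField z ⁻¹ᵁ W :=
    top_le_preimage_fromSpecResidueField z ⟨hzW, hz⟩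
  have hζ₁ : ⊤ ≤ (H.fromSpecResidueField z ≫ q ≫ i) ⁻¹ᵁ W₀ := fun w _ => (hζ (x := w) trivial).1
  have hζ₂ : ⊤ ≤ (H.fromSpecResidueField z ≫ p) ⁻¹ᵁ j ''ᵁ ⊤ := fun w _ => (hζ (x := w) trivial).2
  have rows (V : H.Opens) (_ : V ≤ W) (a : V.toScheme ⟶ V₀) (ha : V.ι ≫ p = a ≫ j)
      (hV' : ⊤ ≤ V.ι ⁻¹ᵁ W) (N : V.toScheme.Modules)
      (κ : (Scheme.Modules.pullback p).obj E ⟶ (Scheme.Modules.pushforward V.ι).obj N) :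
      squareConormal pr sq i q p m h π ≫ κ = 0 ↔
        ∀ x, ∑ c, (V.ι.appLE W ⊤ hV').hom (A x c) • basisValues V.ι p j a ha ψ κ c = 0 := by
    have hV₁ : ⊤ ≤ (V.ι ≫ q ≫ i) ⁻¹ᵁ W₀ := fun w _ => (hV' (x := w) trivial).1
    refine (squareConormal_comp_eq_zero_iff_rows pr sq i q p m h π V.ι j a ha ψ hW hV₁ M
      (fun l => (f.app _).hom (coordFun i₀ l)) hU (fun x l => ⟨_, hG, _, rfl⟩) δ hδ hl hgen N κ).trans ?_
    refine forall_congr' fun x => Eq.congr_left ?_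
    refine Finset.sum_congr rfl fun c _ => congr_arg (· • _) ?_
    exact (appLE_sum_mul V.ι (q ≫ i) p inf_le_left inf_le_right hV' hV₁ _ (M x) fun l => δ l c).symm
  have indep : LinearIndependent (H.residueField z)
      (A.map (value (H.fromSpecResidueField z) hζ)) := by
    have := linearIndependent_value_rows f m pr g i q p π j ψ sq h hd i₀ I hW hG hl hU δ
      (fun l => hδ l) z hz η hη hzη hζ₁ hζ₂
    refine Eq.mp ?_ this
    congr 1
    funext x c
    exact (value_sum_mul (H.fromSpecResidueField z) (q ≫ i) p inf_le_left inf_le_right hζ hζ₁ hζ₂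
      (M x) fun l => δ l c).symm
  obtain ⟨V, s, hzV, hs, hV⟩ := exists_free_cokernel_of_linearIndependent p j ψ
    (squareConormal pr sq i q p m h π) (W := W) inf_le_right A rows (K := H.residueField z)
    (H.fromSpecResidueField z) hζ indep (default : ↥(Spec (H.residueField z)))
  refine ⟨V, s, ?_, hs, hV⟩
  have e := Scheme.fromSpecResidueField_apply (X := H) z (default : ↥(Spec (H.residueField z)))
  rwa [← e]

end CokernelNearPoint

/-! ### Standard charts cover -/

section Covers

attribute [local instance] MvPolynomial.gradedAlgebra

lemma ProjectiveSpace.exists_mem_chart {k : Type u} [Field k] {n : ℕ} (y : ProjectiveSpace k n) :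
    ∃ i, y ∈ ProjectiveSpace.ι k n i ''ᵁ ⊤ := by
  have h := Proj.iSup_basicOpen_eq_top' (MvPolynomial.homogeneousSubmodule (Fin (n + 1)) k)
    (fun i : Fin (n + 1) => MvPolynomial.X i) (fun i => ⟨1, MvPolynomial.isHomogeneous_X k i⟩) (by
      rw [eq_top_iff]
      rintro x -
      induction x using MvPolynomial.induction_on with
      | C a =>
        let c : MvPolynomial.homogeneousSubmodule (Fin (n + 1)) k 0 :=
          ⟨MvPolynomial.C a, MvPolynomial.isHomogeneous_C _ a⟩
        exact Subalgebra.algebraMap_mem (Algebra.adjoin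
          (MvPolynomial.homogeneousSubmodule (Fin (n + 1)) k 0) (Set.range MvPolynomial.X)) c
      | add p q hp hq => exact add_mem hp hq
      | mul_X p i hp => exact mul_mem hp (Algebra.subset_adjoin ⟨i, rfl⟩))
  have hy : y ∈ (⊤ : (ProjectiveSpace k n).Opens) := trivial
  obtain ⟨i, hi⟩ := TopologicalSpace.Opens.mem_iSup.mp (h.ge hy)
  refine ⟨i, ?_⟩
  rw [Scheme.Hom.image_top_eq_opensRange]
  have e := Proj.opensRange_awayι (MvPolynomial.homogeneousSubmodule (Fin (n + 1)) k)
    (MvPolynomial.X i) (MvPolynomial.isHomogeneous_X k i) one_pos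
  exact e.ge hi

lemma Grassmannian.exists_mem_chart {k : Type u} [Field k] {N r : ℕ} (y : Grassmannian k N r) :
    ∃ (I : Fin r ↪ Fin N) (x : ↥(chart k I)), Grassmannian.ι k N r I x = y := by
  obtain ⟨I, x, hx⟩ := (grassmannianGlueData k N r).ι_jointly_surjective y
  exact ⟨I.down, x, hx⟩

end Covers

/-- Write `Z` as the zero locus of `I`. If `I` contracts to zero, then some prime containing `I`
does too, and it is a point of `Z` over the generic point. Otherwise any nonzero element of the
contraction serves. -/
lemma exists_notMem_image {A B : CommRingCat.{u}} [IsDomain A] (φ : A ⟶ B)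
    (Z : Set ↥(Spec B)) (hZ : IsClosed Z)
    (h : ∀ z ∈ Z, (show PrimeSpectrum A from Spec.map φ z).asIdeal ≠ ⊥) :
    ∃ a : A, a ≠ 0 ∧ ∀ z ∈ Z, a ∈ (show PrimeSpectrum A from Spec.map φ z).asIdeal := by
  obtain ⟨I, rfl⟩ := (PrimeSpectrum.isClosed_iff_zeroLocus_ideal Z).mp hZ
  by_cases hI : I.comap φ.hom = ⊥
  · obtain ⟨q, hqI, hq, hqle⟩ := Ideal.exists_ideal_comap_le_prime (f := φ.hom) (⊥ : Ideal A) I hI.le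
    exact (h ⟨q, hq⟩ hqI (le_bot_iff.mp hqle)).elim
  · obtain ⟨a, ha, ha₀⟩ := Submodule.exists_mem_ne_zero_of_ne_bot hI
    exact ⟨a, ha₀, fun z hz => hz ha⟩

/-- The image of a closed set under a quasi-compact morphism to an integral affine scheme is not
dense if it avoids the generic point. -/
lemma exists_basicOpen_notMem {A : CommRingCat.{u}} [IsDomain A] {H : Scheme.{u}} [CompactSpace H]
    (q : H ⟶ Spec A) (Z : Set H) (hZ : IsClosed Z)
    (h : ∀ z ∈ Z, (show PrimeSpectrum A from q z).asIdeal ≠ ⊥) :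
    ∃ a : A, a ≠ 0 ∧ ∀ z ∈ Z, a ∈ (show PrimeSpectrum A from q z).asIdeal := by
  -- A quasi-compact scheme receives a surjection from an affine one, which reduces the claim to
  -- rings.
  obtain ⟨R, g, hg⟩ := compactSpace_iff_exists.mp ‹CompactSpace H›
  obtain ⟨φ, hφ⟩ := Spec.homEquiv.symm.surjective (g ≫ q)
  have hφ' : Spec.map φ = g ≫ q := hφ
  have e (w) : q (g w) = Spec.map φ w := by rw [hφ']; rfl
  obtain ⟨a, ha, hz⟩ := exists_notMem_image φ (g ⁻¹' Z) (hZ.preimage g.continuous)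
    (fun w hw => by rw [← e]; exact h _ hw)
  refine ⟨a, ha, fun z hz' => ?_⟩
  obtain ⟨w, rfl⟩ := hg z
  rw [e]
  exact hz w hz'

/-! ### The cokernel over generic points of the Grassmannian charts -/

section GenericFibre

variable {k : Type u} [Field k] {n r d : ℕ} {X 𝒳 : Scheme.{u}} (f : X ⟶ ProjectiveSpace k n)
  [FormallyUnramified f] [LocallyOfFiniteType f] (m : 𝒳 ⟶ X) [LocallyOfFiniteType m]
  {ℰ : 𝒳.Modules} (π : (Scheme.Modules.pullback m).obj (Differentials (overField f)) ⟶ ℰ) [Epi π]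

/-- A trivialisation of a vector bundle on a neighbourhood inside a given open. -/
lemma exists_restrict_iso_free {E : 𝒳.Modules} (hE : IsVectorBundleOfRank E d) {W : 𝒳.Opens}
    {x : 𝒳} (hx : x ∈ W) : ∃ V : 𝒳.Opens, x ∈ V ∧ V ≤ W ∧
      Nonempty (E.restrict V.ι ≅ freeModule V.toScheme d) := by
  obtain ⟨V, s, hxV, hs, ⟨ψ⟩⟩ := hE x
  obtain rfl : s = d := by exact_mod_cast hs
  refine ⟨V ⊓ W, ⟨hxV, hx⟩, inf_le_right, ?_⟩
  exact nonempty_restrict_iso_free_of_comp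
    (a := 𝒳.homOfLE (inf_le_left : V ⊓ W ≤ V)) (𝒳.homOfLE_ι _).symm ψ

theorem exists_free_cokernel_of_generic (hd : topologicalKrullDim 𝒳 ≤ d)
    (hℰ : IsVectorBundleOfRank ℰ d) (z : ↥(PullInc f r m)) (I : Fin r ↪ Fin (n + 1))
    (η : PrimeSpectrum (ChartRing k (n + 1) r I)) (hη : η.asIdeal = ⊥)
    (hzη : pullIncToGrass f r m z = Grassmannian.ι k (n + 1) r I (show ↥(chart k I) from η)) :
    ∃ (V : (PullInc f r m).Opens) (s : ℕ), z ∈ V ∧ r + s = d ∧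
      Nonempty ((cokernel (conormalToBundle f r m π)).restrict V.ι ≅
        freeModule V.toScheme s) := by
  obtain ⟨i₀, hi₀⟩ := ProjectiveSpace.exists_mem_chart (f (m (pullIncToBase f r m z)))
  obtain ⟨V₀, hz, hV₀, ⟨ψ⟩⟩ := exists_restrict_iso_free hℰ (x := pullIncToBase f r m z)
    (W := m ⁻¹ᵁ f ⁻¹ᵁ (ProjectiveSpace.ι k n i₀ ''ᵁ ⊤)) hi₀
  have hzx : prX f r (incι f r (pullIncToInc f r m z)) = m (pullIncToBase f r m z) :=
    congr_arg (fun φ : PullInc f r m ⟶ X => φ z) (pullInc_condition f r m)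
  have hzW : incι f r (pullIncToInc f r m z) ∈ chartOpen f i₀ I := by
    refine ⟨?_, ?_⟩
    · change f (prX f r (incι f r (pullIncToInc f r m z))) ∈ ProjectiveSpace.ι k n i₀ ''ᵁ ⊤
      rw [hzx]
      exact hi₀
    · exact ⟨_, trivial, hzη.symm⟩
  rw [conormalToBundle_eq]
  exact exists_free_cokernel_of_chart f m (prX f r) (prG f r) (overField_condition f r) (incι f r)
    (pullIncToInc f r m) (pullIncToBase f r m) (pullInc_condition f r m) π V₀.ι ψ hd i₀ I
    inf_le_left inf_le_right (incidenceForm f i₀ I) (fun x => rfl) (app_incidenceForm f i₀ I)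
    (exists_mem_span_incidenceForm f i₀ I) ((image_ι_top V₀).ge.trans hV₀) z
    ((image_ι_top V₀).le hz) hzW η hη hzη

end GenericFibre

/-! ### Spreading out to a dense open subset -/

section DenseOpen

/-- If a closed subset does not meet the fibres over the generic points of the charts of a scheme
covered by integral affine charts, then it does not meet the fibres over a dense open subset. -/
lemma exists_dense_opens_notMem {ι : Type*} {G H : Scheme.{u}} {A : ι → CommRingCat.{u}}
    [∀ I, IsDomain (A I)] (c : ∀ I, Spec (A I) ⟶ G) [∀ I, IsOpenImmersion (c I)]
    (hc : ∀ y, ∃ I x, c I x = y) (q : H ⟶ G) [QuasiCompact q] (Z : Set H) (hZ : IsClosed Z)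
    (h : ∀ z ∈ Z, ∀ I (η : PrimeSpectrum (A I)), η.asIdeal = ⊥ →
      q z ≠ c I (show ↥(Spec (A I)) from η)) :
    ∃ U : G.Opens, Dense (U : Set G) ∧ ∀ z, q z ∈ U → z ∉ Z := by
  have key (I : ι) : ∃ a : A I, a ≠ 0 ∧ ∀ z ∈ Z, ∀ x : PrimeSpectrum (A I),
      q z = c I (show ↥(Spec (A I)) from x) → a ∈ x.asIdeal := by
    obtain ⟨a, ha, haZ⟩ := exists_basicOpen_notMem (pullback.snd q (c I))
      (pullback.fst q (c I) ⁻¹' Z) (hZ.preimage (pullback.fst q (c I)).continuous) (by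
        intro w hw hη
        refine h _ hw I _ hη ?_
        exact congr_arg (fun φ : pullback q (c I) ⟶ G => φ w) pullback.condition)
    refine ⟨a, ha, fun z hz x hx => ?_⟩
    obtain ⟨w, rfl, rfl⟩ := Scheme.Pullback.exists_preimage_pullback _ _ hx
    exact haZ w hz
  choose a ha haZ using key
  let D (I : ι) : (Spec (A I)).Opens := PrimeSpectrum.basicOpen (a I)
  refine ⟨⨆ I, c I ''ᵁ D I, ?_, ?_⟩
  -- A nonempty open set meets some chart, so it contains the generic point of that chart, and this
  -- point lies in the basic open set of the nonzero `a I`.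
  · rw [dense_iff_inter_open]
    rintro O hO ⟨y, hy⟩
    obtain ⟨I, x, rfl⟩ := hc y
    let η : PrimeSpectrum (A I) := ⟨⊥, Ideal.isPrime_bot⟩
    have hη : η ⤳ x := (PrimeSpectrum.le_iff_specializes η x).mp bot_le
    have hO' : c I (show ↥(Spec (A I)) from η) ∈ O :=
      (hη.map (c I).continuous).mem_open hO hy
    refine ⟨_, hO', TopologicalSpace.Opens.mem_iSup.mpr ⟨I, η, ?_, rfl⟩⟩
    exact fun h0 => ha I h0
  · intro z hz hzZ
    obtain ⟨I, x, hx, hxz⟩ := TopologicalSpace.Opens.mem_iSup.mp hz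
    exact hx (haZ I z hzZ x hxz.symm)

/-- A sheaf of modules that is free near each point of an open subset restricts to a vector
bundle. -/
lemma isVectorBundleOfRank_restrict {H : Scheme.{u}} (Q : H.Modules) (ρ : ℤ) (W : H.Opens)
    (h : ∀ z ∈ W, ∃ (V : H.Opens) (s : ℕ), z ∈ V ∧ (s : ℤ) = ρ ∧
      Nonempty (Q.restrict V.ι ≅ freeModule V.toScheme s)) :
    IsVectorBundleOfRank (Q.restrict W.ι) ρ := by
  rintro ⟨z, hz⟩
  obtain ⟨V, s, hzV, hs, ⟨ψ⟩⟩ := h z hz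
  refine ⟨W.ι ⁻¹ᵁ V, s, hzV, hs, ?_⟩
  obtain ⟨e⟩ := nonempty_restrict_iso_free_of_comp (a := W.ι ∣_ V)
    (b := (W.ι ⁻¹ᵁ V).ι ≫ W.ι) (morphismRestrict_ι W.ι V).symm ψ
  exact ⟨((Scheme.Modules.restrictFunctorComp (W.ι ⁻¹ᵁ V).ι W.ι).app Q).symm ≪≫ e⟩

lemma pullback_snd_quasiCompact {A B C : Scheme.{u}} (a : A ⟶ C) (b : B ⟶ C) [QuasiCompact a] :
    QuasiCompact (pullback.snd a b) := inferInstance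

lemma quasiCompact_pullIncToGrass {k : Type u} [Field k] {n r : ℕ} {X 𝒳 : Scheme.{u}}
    (f : X ⟶ ProjectiveSpace k n) [QuasiCompact f] (m : 𝒳 ⟶ X) [QuasiCompact m] :
    QuasiCompact (pullIncToGrass f r m) := by
  have h₁ : QuasiCompact (pullIncToInc f r m) := inferInstance
  have h₂ : QuasiCompact (incι f r) := inferInstance
  have h₃ : QuasiCompact (overField f) := inferInstance
  have h₄ : QuasiCompact (prG f r) := pullback_snd_quasiCompact _ _
  infer_instance

/-- Over a dense open subset of the Grassmannian the cokernel is a vector bundle. -/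
theorem exists_dense_isVectorBundleOfRank {k : Type u} [Field k] {n r d : ℕ} {X 𝒳 : Scheme.{u}}
    (f : X ⟶ ProjectiveSpace k n) [LocallyOfFiniteType f] [QuasiCompact f] [FormallyUnramified f]
    (m : 𝒳 ⟶ X) [LocallyOfFiniteType m] [QuasiCompact m] (hd : topologicalKrullDim 𝒳 ≤ d)
    {ℰ : 𝒳.Modules} (hℰ : IsVectorBundleOfRank ℰ d)
    (π : (Scheme.Modules.pullback m).obj (Differentials (overField f)) ⟶ ℰ) [Epi π] :
    ∃ U : (Grassmannian k (n + 1) r).Opens, Dense (U : Set (Grassmannian k (n + 1) r)) ∧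
      IsVectorBundleOfRank ((cokernel (conormalToBundle f r m π)).restrict
        (pullIncToGrass f r m ⁻¹ᵁ U).ι) ((d : ℤ) - r) := by
  have := quasiCompact_pullIncToGrass (r := r) f m
  let Q := cokernel (conormalToBundle f r m π)
  -- The locus of local freeness of the right rank is open by its form. When `r > d` it is empty,
  -- and the argument shows that its complement, all of `H_𝒳`, misses a dense open set of `G`.
  let good : Set (PullInc f r m) := {z | ∃ (V : (PullInc f r m).Opens) (s : ℕ), z ∈ V ∧
    (s : ℤ) = d - r ∧ Nonempty (Q.restrict V.ι ≅ freeModule V.toScheme s)}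
  have hgood : IsOpen good := by
    rw [isOpen_iff_mem_nhds]
    rintro z ⟨V, s, hz, hs, hV⟩
    exact Filter.mem_of_superset (V.2.mem_nhds hz) fun w hw => ⟨V, s, hw, hs, hV⟩
  obtain ⟨U, hU, hUZ⟩ := exists_dense_opens_notMem (Grassmannian.ι k (n + 1) r)
    Grassmannian.exists_mem_chart (pullIncToGrass f r m) goodᶜ hgood.isClosed_compl (by
      intro z hz I η hη hzη
      obtain ⟨V, s, hzV, hs, hV⟩ := exists_free_cokernel_of_generic f m π hd hℰ z I η hη hzη
      exact hz ⟨V, s, hzV, by omega, hV⟩)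
  exact ⟨U, hU, isVectorBundleOfRank_restrict Q _ _ fun z hz => not_not.mp (hUZ z hz)⟩

end DenseOpen

end
end Bertini

theorem mainTheorem2 {k : Type u} [Field k] {n : ℕ} (r : ℕ) {X 𝒳 : Scheme.{u}}
    (f : X ⟶ Bertini.ProjectiveSpace k n)
    [LocallyOfFiniteType f] [QuasiCompact f] [FormallyUnramified f]
    (m : 𝒳 ⟶ X) [LocallyOfFiniteType m] [QuasiCompact m]
    (d : ℕ) (hd : topologicalKrullDim 𝒳 ≤ d)
    (ℰ : 𝒳.Modules) (hℰ : Bertini.IsVectorBundleOfRank ℰ d)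
    (π : (Scheme.Modules.pullback m).obj (Bertini.Differentials (Bertini.overField f)) ⟶ ℰ)
    [Epi π] :
    ∃ _ : IsIso (Bertini.differentialsComparison f r),
      ∃ U : (Bertini.Grassmannian k (n + 1) r).Opens,
        Dense (U : Set (Bertini.Grassmannian k (n + 1) r)) ∧
        Bertini.IsVectorBundleOfRank
          ((cokernel (Bertini.conormalToBundle f r m π)).restrict
            (Bertini.pullIncToGrass f r m ⁻¹ᵁ U).ι)
          ((d : ℤ) - r) := by
  obtain ⟨U, hU, h⟩ := Bertini.exists_dense_isVectorBundleOfRank (r := r) f m hd hℰ π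
  exact ⟨inferInstance, U, hU, h⟩
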